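/- Let $k$ be a field and let $(A,\varepsilon)$ be a Frobenius algebra over $k$: an associative unital $k$-algebra $A$ with a linear functional $\varepsilon\colon A\to k$ such that $a\mapsto \varepsilon(a\,\cdot)$ is a bijection $A\to A^*=\operatorname{Hom}_k(A,k)$. (Then $A$ is finite-dimensional.) Let $\sigma$ be its Nakayama automorphism, i.e. the algebra automorphism with $\varepsilon(ab)=\varepsilon(\sigma(b)a)$ for all $a,b\in A$, and let ${}_\sigma A$ be $A$ with right action by multiplication and left action $a\cdot m=\sigma(a)m$. Let $C_n(A,{}_\sigma A)=A\otimes A^{\otimes n}$ be the Hochschild chains, with differential $$d(a_0,\dots,a_n)=\sum_{i=0}^{n-1}(-1)^i(a_0,\dots,a_ia_{i+1},\dots,a_n)+(-1)^n(\sigma(a_n)a_0,a_1,\dots,a_{n-1})\qquad(n\ge1)$$ and $d=0$ on $C_0$, and let $H_\bullet(A,{}_\sigma A)$ be its homology. A (planar, counital) cooperad is a sequence of $k$-modules $\mathcal C(n)$, $n\ge 0$, with a counit $\mathcal C(1)\to k$ and partial decompositions $\Delta_{p,q,i}\colon\mathcal C(p+q-1)\to\mathcal C(p)\otimes\mathcal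 C(q)$, $1\le i\le p$, $q\ge 0$, that are counital and satisfy the coassociativity relations dual to those of the partial compositions of a nonsymmetric operad; a comultiplication on it is a morphism of cooperads $\psi$ to the arity-wise dual $\mathsf{Ass}^*$ of the unital associative operad, and one writes $\mu^c=\psi_2$. It induces on $\mathcal C(n)$, $n\geq 1$, the differential $$d=(\mu^c\otimes\mathrm{id})\Delta_{2,n-1,2}+\sum_{i=1}^{n-1}(-1)^i(\mathrm{id}\otimes\mu^c)\Delta_{n-1,2,i}+(-1)^n(\mu^c\otimes\mathrm{id})\Delta_{2,n-1,1},$$ and one defines on $\mathcal C(n)$ the cup coproduct $$\cup^c=\sum_{j=1}^{n+1}(\mu^c\otimes\mathrm{id}\otimes\mathrm{id})(\Delta_{2,j-1,1}\otimes\mathrm{id})\Delta_{j,n+1-j,j}$$ and the cobracket $$\{-\}=(\mathrm{id}-\rho)\sum_{p+q=n+1}\ \sum_{i=1}^{p}(-1)^{(q-1)(p-i)}\Delta_{p,q,i},$$ where $$\tau(a\otimes b)=(-1)^{|a||b|}\,b\otimes a,\qquad \rho(a\otimes b)=(-1)^{(|a|-1)(|b|-1)}\,b\otimes a,\qquad \varrho(a\otimes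 b)=(-1)^{|a|(|b|-1)}\,b\otimes a.$$ A Gerstenhaber coalgebra is a graded $k$-module $V=\bigoplus_{n\ge0}V_n$ with a coassociative counital coproduct $\cup^c$ of degree $0$, graded cocommutative ($\tau\circ\cup^c=\cup^c$), and a map $\{-\}\colon V_n\to\bigoplus_{p+q=n+1}V_p\otimes V_q$ with $\operatorname{Im}\{-\}\subseteq\operatorname{Im}(\mathrm{id}-\rho)$, satisfying the coJacobi identity $$\big(\mathrm{id}+(\mathrm{id}\otimes\rho)(\rho\otimes\mathrm{id})+(\rho\otimes\mathrm{id})(\mathrm{id}\otimes\rho)\big)(\{-\}\otimes\mathrm{id})\{-\}=0$$ and the coLeibniz identity $$(\mathrm{id}\otimes\cup^c)\{-\}=\big(\{-\}\otimes\mathrm{id}+(\varrho\otimes\mathrm{id})(\mathrm{id}\otimes\{-\})\big)\cup^c .$$ **Proposition.** The Hochschild chains $C_\bullet(A,{}_\sigma A)$ form a cooperad with comultiplication, where, for any bases $(e_j)$, $(e^j)$ of $A$ with $\varepsilon(e^je_i)=\delta_{ij}$ (so that $\sum_j e_j\otimes e^j$ is the Frobenius coproduct of $1$), $$\Delta_{p,q,i}(a_0,\dots,a_{p+q-1})=\sum_j(a_0,\dots,a_{i-1},e_j,a_{i+q},\dots,a_{p+q-1})\otimes(e^j,a_i,\dots,a_{i+q-1}),$$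 the counit is $(a_0,a_1)\mapsto\varepsilon(a_0a_1)$, and $\psi_n(a_0,\dots,a_n)=\varepsilon(a_0\cdots a_n)$ under the identification $\mathsf{Ass}(n)^*\cong k$. The differential induced by this comultiplication is the Hochschild differential. The cup coproduct, the counit $a_0\mapsto\varepsilon(a_0)$ (zero in positive degrees) and the cobracket induce on $H_\bullet(A,{}_\sigma A)$ the structure of a Gerstenhaber coalgebra. Consequently, with $A^e=A\otimes A^{\mathrm{op}}$, the groups $\operatorname{Tor}^{A^e}_\bullet({}_\sigma A,A)$ form a Gerstenhaber coalgebra, isomorphic to $H_\bullet(A,{}_\sigma A)$ via the canonical isomorphism induced by comparing the bar resolution of $A$ with projective resolutions of $A$ over $A^e$. -/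

import Mathlib

open scoped TensorProduct DirectSum ModuleCat
open CategoryTheory

namespace FrobHoch

universe u v w w'

/-! ### Graded modules and tensor flips with signs -/

section Graded

variable (k : Type u) [Field k] (V : ℕ → Type w) [∀ n, AddCommGroup (V n)] [∀ n, Module k (V n)]

/-- The total module of a graded module. -/
abbrev Tot := ⨁ n, V n

/-- The canonical inclusion of `V p ⊗ V q` into the tensor square of the total module. -/
noncomputable def incl₂ (p q : ℕ) : V p ⊗[k] V q →ₗ[k] Tot V ⊗[k] Tot V :=
  TensorProduct.map (DirectSum.lof k ℕ V p) (DirectSum.lof k ℕ V q)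

/-- The degree `m` part of the tensor square: the span of all `V p ⊗ V q` with `p + q = m`. -/
noncomputable def tensorDegree (m : ℕ) : Submodule k (Tot V ⊗[k] Tot V) :=
  ⨆ pq ∈ Finset.HasAntidiagonal.antidiagonal m, LinearMap.range (incl₂ k V pq.1 pq.2)

/-- The flip `a ⊗ b ↦ (-1) ^ s |a| |b| • b ⊗ a`. -/
noncomputable def signedFlip (s : ℕ → ℕ → ℕ) : Tot V ⊗[k] Tot V →ₗ[k] Tot V ⊗[k] Tot V :=
  TensorProduct.lift <| DirectSum.toModule k ℕ _ fun p =>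
    LinearMap.flip <| DirectSum.toModule k ℕ _ fun q =>
      (-1 : k) ^ s p q •
        ((TensorProduct.mk k (Tot V) (Tot V)).compl₁₂
          (DirectSum.lof k ℕ V q) (DirectSum.lof k ℕ V p))

theorem signedFlip_lof (s : ℕ → ℕ → ℕ) (p q : ℕ) (x : V p) (y : V q) :
    signedFlip k V s (DirectSum.lof k ℕ V p x ⊗ₜ DirectSum.lof k ℕ V q y) =
      (-1 : k) ^ s p q • (DirectSum.lof k ℕ V q y ⊗ₜ DirectSum.lof k ℕ V p x) := by
  simp [signedFlip]

/-- The graded flip, with sign `(-1) ^ (|a| * |b|)`. -/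
noncomputable def flipτ : Tot V ⊗[k] Tot V →ₗ[k] Tot V ⊗[k] Tot V :=
  signedFlip k V fun p q => p * q

/-- The (de)suspended flip, with sign `(-1) ^ ((|a| - 1) * (|b| - 1))`; the exponent only matters
modulo 2. -/
noncomputable def flipρ : Tot V ⊗[k] Tot V →ₗ[k] Tot V ⊗[k] Tot V :=
  signedFlip k V fun p q => (p + 1) * (q + 1)

/-- The mixed flip, with sign `(-1) ^ (|a| * (|b| - 1))`; the exponent only matters modulo 2. -/
noncomputable def flipMixed : Tot V ⊗[k] Tot V →ₗ[k] Tot V ⊗[k] Tot V :=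
  signedFlip k V fun p q => p * (q + 1)

/-- `f ⊗ id` on a threefold tensor product, bracketed to the right. -/
noncomputable def onFirstTwo (f : Tot V ⊗[k] Tot V →ₗ[k] Tot V ⊗[k] Tot V) :
    Tot V ⊗[k] (Tot V ⊗[k] Tot V) →ₗ[k] Tot V ⊗[k] (Tot V ⊗[k] Tot V) :=
  (TensorProduct.assoc k (Tot V) (Tot V) (Tot V)).toLinearMap ∘ₗ
    f.rTensor (Tot V) ∘ₗ (TensorProduct.assoc k (Tot V) (Tot V) (Tot V)).symm.toLinearMap

/-- `f ⊗ id : V ⊗ V → (V ⊗ V) ⊗ V`, rebracketed to the right. -/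
noncomputable def applyLeft (f : Tot V →ₗ[k] Tot V ⊗[k] Tot V) :
    Tot V ⊗[k] Tot V →ₗ[k] Tot V ⊗[k] (Tot V ⊗[k] Tot V) :=
  (TensorProduct.assoc k (Tot V) (Tot V) (Tot V)).toLinearMap ∘ₗ f.rTensor (Tot V)

/-- A Gerstenhaber coalgebra structure on the graded module `V`: a graded cocommutative,
coassociative and counital coproduct `cup`, and a graded Lie cobracket
`V n → ⨁_{p + q = n + 1} V p ⊗ V q` (that is, a Lie cobracket of degree zero on the suspension
`V[1]`, where the graded flip becomes `flipρ`), subject to the coLeibniz identity. -/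
structure GerstenhaberCoalgebra where
  cup : Tot V →ₗ[k] Tot V ⊗[k] Tot V
  counit : Tot V →ₗ[k] k
  cobracket : Tot V →ₗ[k] Tot V ⊗[k] Tot V
  cup_degree : ∀ n (x : V n), cup (DirectSum.lof k ℕ V n x) ∈ tensorDegree k V n
  counit_degree : ∀ n (x : V (n + 1)), counit (DirectSum.lof k ℕ V (n + 1) x) = 0
  cobracket_degree : ∀ n (x : V n),
    cobracket (DirectSum.lof k ℕ V n x) ∈ tensorDegree k V (n + 1)
  coassoc : applyLeft k V cup ∘ₗ cup = cup.lTensor (Tot V) ∘ₗ cup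
  counit_left :
    (TensorProduct.lid k (Tot V)).toLinearMap ∘ₗ counit.rTensor (Tot V) ∘ₗ cup = LinearMap.id
  counit_right :
    (TensorProduct.rid k (Tot V)).toLinearMap ∘ₗ counit.lTensor (Tot V) ∘ₗ cup = LinearMap.id
  cocomm : flipτ k V ∘ₗ cup = cup
  coantisymm : LinearMap.range cobracket ≤ LinearMap.range (LinearMap.id - flipρ k V)
  coJacobi :
    (LinearMap.id + (flipρ k V).lTensor (Tot V) ∘ₗ onFirstTwo k V (flipρ k V)
      + onFirstTwo k V (flipρ k V) ∘ₗ (flipρ k V).lTensor (Tot V)) ∘ₗ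
        applyLeft k V cobracket ∘ₗ cobracket = 0
  coLeibniz : cup.lTensor (Tot V) ∘ₗ cobracket =
    (applyLeft k V cobracket
      + onFirstTwo k V (flipMixed k V) ∘ₗ cobracket.lTensor (Tot V)) ∘ₗ cup

variable {k V}

/-- A degreewise linear isomorphism is an isomorphism of Gerstenhaber coalgebras if it respects
coproduct, counit and cobracket. -/
def GerstenhaberCoalgebra.IsIso {W : ℕ → Type w'} [∀ n, AddCommGroup (W n)]
    [∀ n, Module k (W n)] (G : GerstenhaberCoalgebra k V) (G' : GerstenhaberCoalgebra k W)
    (θ : ∀ n, V n ≃ₗ[k] W n) : Prop :=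
  let Θ : Tot V →ₗ[k] Tot W := DirectSum.lmap fun n => (θ n).toLinearMap
  G'.cup ∘ₗ Θ = TensorProduct.map Θ Θ ∘ₗ G.cup ∧
  G'.counit ∘ₗ Θ = G.counit ∧
  G'.cobracket ∘ₗ Θ = TensorProduct.map Θ Θ ∘ₗ G.cobracket

end Graded

/-! ### Homology, and operations induced on homology -/

section Homology

variable {k : Type u} [Field k] {X : ℕ → Type w} [∀ n, AddCommGroup (X n)]
  [∀ n, Module k (X n)] (d : ∀ n, X (n + 1) →ₗ[k] X n)

/-- The cycles; everything in degree `0` is a cycle. -/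
def cycles : ∀ n, Submodule k (X n)
  | 0 => ⊤
  | n + 1 => LinearMap.ker (d n)

/-- The `n`-th homology, cycles modulo boundaries. -/
abbrev Homology (n : ℕ) := cycles d n ⧸ (LinearMap.range (d n)).submoduleOf (cycles d n)

/-- The class of a cycle. -/
def homologyClass (n : ℕ) : cycles d n →ₗ[k] Homology d n := Submodule.mkQ _

/-- The differential on the total module. -/
noncomputable def totalDiff : Tot X →ₗ[k] Tot X :=
  DirectSum.toModule k ℕ _ fun n => match n with
    | 0 => 0
    | n + 1 => DirectSum.lof k ℕ X n ∘ₗ d n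

/-- The differential `x ⊗ y ↦ d x ⊗ y + (-1) ^ (|x| + e) • x ⊗ d y` on the tensor square. For
`e = 0` it is the usual one, for `e = 1` it is the one belonging to the suspended complex, in which
`x` has degree `|x| - 1`. -/
noncomputable def tensorDiff (e : ℕ) : Tot X ⊗[k] Tot X →ₗ[k] Tot X ⊗[k] Tot X :=
  (totalDiff d).rTensor (Tot X) +
    TensorProduct.map (DirectSum.toModule k ℕ _ fun n => (-1 : k) ^ (n + e) • DirectSum.lof k ℕ X n)
      (totalDiff d)

/-- `φ` is the operation induced on homology by the operation `Φ` on chains, via the Künneth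
identification of the homology of the tensor square with the tensor square of the homology: for
every cycle `z` there is a tensor `t` of cycles whose class is `φ [z]` and which is homologous
to `Φ z`. -/
def IsInducedOnHomology (e : ℕ) (Φ : Tot X →ₗ[k] Tot X ⊗[k] Tot X)
    (φ : Tot (Homology d) →ₗ[k] Tot (Homology d) ⊗[k] Tot (Homology d)) : Prop :=
  ∀ (n : ℕ) (z : cycles d n),
    ∃ t : Tot (fun m => cycles d m) ⊗[k] Tot (fun m => cycles d m),
      TensorProduct.map (DirectSum.lmap (homologyClass d)) (DirectSum.lmap (homologyClass d)) t =
        φ (DirectSum.lof k ℕ (Homology d) n (homologyClass d n z)) ∧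
      Φ (DirectSum.lof k ℕ X n z) -
        TensorProduct.map (DirectSum.lmap fun m => (cycles d m).subtype)
          (DirectSum.lmap fun m => (cycles d m).subtype) t ∈ LinearMap.range (tensorDiff d e)

end Homology

/-! ### Cooperads -/

section Cooperad

variable (k : Type u) [Field k] (X : ℕ → Type w) [∀ n, AddCommGroup (X n)] [∀ n, Module k (X n)]

/-- A planar counital cooperad structure on the sequence `X` of modules, by partial decompositions
`Δ_{p,q,i} : X (p + q - 1) → X p ⊗ X q` for `1 ≤ i ≤ p`. The source degree `n = p + q - 1` is
carried as an index of its own; `decomp n p q i` is declared zero for meaningless indices. -/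
structure Cooperad where
  counit : X 1 →ₗ[k] k
  decomp : ∀ n p q : ℕ, ℕ → (X n →ₗ[k] X p ⊗[k] X q)
  decomp_eq_zero : ∀ n p q i, ¬ (p + q = n + 1 ∧ 1 ≤ i ∧ i ≤ p) → decomp n p q i = 0
  counit_left : ∀ n,
    (TensorProduct.lid k (X n)).toLinearMap ∘ₗ counit.rTensor (X n) ∘ₗ decomp n 1 n 1 =
      LinearMap.id
  counit_right : ∀ n i, 1 ≤ i → i ≤ n →
    (TensorProduct.rid k (X n)).toLinearMap ∘ₗ counit.lTensor (X n) ∘ₗ decomp n n 1 i =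
      LinearMap.id
  coassoc_left : ∀ n p q r i j, p + q + r = n + 2 → 1 ≤ i → i ≤ p → 1 ≤ j → j + 1 ≤ p + q →
    i + q ≤ j →
    (decomp (p + q - 1) p q i).rTensor (X r) ∘ₗ decomp n (p + q - 1) r j =
      (TensorProduct.rightComm k (X p) (X r) (X q)).toLinearMap ∘ₗ
        (decomp (p + r - 1) p r (j + 1 - q)).rTensor (X q) ∘ₗ decomp n (p + r - 1) q i
  coassoc_middle : ∀ n p q r i j, p + q + r = n + 2 → 1 ≤ i → i ≤ p → 1 ≤ j → j + 1 ≤ p + q →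
    j < i + q → i ≤ j →
    (decomp (p + q - 1) p q i).rTensor (X r) ∘ₗ decomp n (p + q - 1) r j =
      (TensorProduct.assoc k (X p) (X q) (X r)).symm.toLinearMap ∘ₗ
        (decomp (q + r - 1) q r (j + 1 - i)).lTensor (X p) ∘ₗ decomp n p (q + r - 1) i
  coassoc_right : ∀ n p q r i j, p + q + r = n + 2 → 1 ≤ i → i ≤ p → 1 ≤ j → j + 1 ≤ p + q →
    j < i →
    (decomp (p + q - 1) p q i).rTensor (X r) ∘ₗ decomp n (p + q - 1) r j =
      (TensorProduct.rightComm k (X p) (X r) (X q)).toLinearMap ∘ₗ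
        (decomp (p + r - 1) p r j).rTensor (X q) ∘ₗ decomp n (p + r - 1) q (i + r - 1)

variable {k X}

/-- A morphism of cooperads. -/
structure Cooperad.Hom {Y : ℕ → Type w'} [∀ n, AddCommGroup (Y n)] [∀ n, Module k (Y n)]
    (C : Cooperad k X) (D : Cooperad k Y) where
  map : ∀ n, X n →ₗ[k] Y n
  counit_map : D.counit ∘ₗ map 1 = C.counit
  decomp_map : ∀ n p q i,
    D.decomp n p q i ∘ₗ map n = TensorProduct.map (map p) (map q) ∘ₗ C.decomp n p q i

variable (k)

/-- The dual of the unital associative operad: `k` in every arity, spanned by the dual `ν_n^*` of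
the generator `ν_n`; all partial decompositions are `ν_{p+q-1}^* ↦ ν_p^* ⊗ ν_q^*`. -/
noncomputable def assDual : Cooperad k (fun _ => k) where
  counit := LinearMap.id
  decomp n p q i := if p + q = n + 1 ∧ 1 ≤ i ∧ i ≤ p then (TensorProduct.mk k k k).flip 1 else 0
  decomp_eq_zero n p q i h := if_neg h
  counit_left n := by
    rw [if_pos (by omega)]; ext; simp
  counit_right n i h h' := by
    rw [if_pos (by omega)]; ext; simp
  coassoc_left n p q r i j _ _ _ _ _ _ := by
    rw [if_pos (by omega), if_pos (by omega), if_pos (by omega), if_pos (by omega)]; ext; simp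
  coassoc_middle n p q r i j _ _ _ _ _ _ _ := by
    rw [if_pos (by omega), if_pos (by omega), if_pos (by omega), if_pos (by omega)]; ext; simp
  coassoc_right n p q r i j _ _ _ _ _ _ := by
    rw [if_pos (by omega), if_pos (by omega), if_pos (by omega), if_pos (by omega)]; ext; simp

variable {k}

/-- A comultiplication on a cooperad: a morphism of cooperads to the dual of the associative
operad. -/
abbrev Cooperad.Comultiplication (C : Cooperad k X) := C.Hom (assDual k)

variable (C : Cooperad k X) (ψ : C.Comultiplication)

/-- The differential induced by a comultiplication, with `μ = ψ 2`: on `X (n + 1)`, the alternating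
sum of `d_0 = (μ ⊗ id) Δ_{2,n,2}`, of `d_i = (id ⊗ μ) Δ_{n,2,i}` for `1 ≤ i ≤ n`, and of
`d_{n+1} = (μ ⊗ id) Δ_{2,n,1}`. -/
noncomputable def Cooperad.differential (n : ℕ) : X (n + 1) →ₗ[k] X n :=
  (TensorProduct.lid k (X n)).toLinearMap ∘ₗ (ψ.map 2).rTensor (X n) ∘ₗ C.decomp (n + 1) 2 n 2
  + ∑ i ∈ Finset.Icc 1 n, (-1 : k) ^ i •
    ((TensorProduct.rid k (X n)).toLinearMap ∘ₗ (ψ.map 2).lTensor (X n) ∘ₗ C.decomp (n + 1) n 2 i)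
  + (-1 : k) ^ (n + 1) •
    ((TensorProduct.lid k (X n)).toLinearMap ∘ₗ (ψ.map 2).rTensor (X n) ∘ₗ C.decomp (n + 1) 2 n 1)

/-- The cup coproduct: on `X n`, the sum over `j = p + 1` (where `p + q = n`) of
`(μ ⊗ id ⊗ id) (Δ_{2,j-1,1} ⊗ id) Δ_{j,n+1-j,j}`, with `μ = ψ 2`. -/
noncomputable def Cooperad.cup : Tot X →ₗ[k] Tot X ⊗[k] Tot X :=
  DirectSum.toModule k ℕ _ fun n => ∑ pq ∈ Finset.HasAntidiagonal.antidiagonal n,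
    incl₂ k X pq.1 pq.2 ∘ₗ
      ((TensorProduct.lid k (X pq.1)).toLinearMap ∘ₗ (ψ.map 2).rTensor (X pq.1) ∘ₗ
        C.decomp (pq.1 + 1) 2 pq.1 1).rTensor (X pq.2) ∘ₗ
      C.decomp n (pq.1 + 1) pq.2 (pq.1 + 1)

/-- The cobrace: on `X n`, the sum of `(-1) ^ ((q - 1) * (p - i)) Δ_{p,q,i}` over `p + q = n + 1` and
`1 ≤ i ≤ p`; the exponent only matters modulo 2. -/
noncomputable def Cooperad.cobrace : Tot X →ₗ[k] Tot X ⊗[k] Tot X :=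
  DirectSum.toModule k ℕ _ fun n => ∑ pq ∈ Finset.HasAntidiagonal.antidiagonal (n + 1),
    ∑ i ∈ Finset.Icc 1 pq.1, (-1 : k) ^ ((pq.2 + 1) * (pq.1 - i)) •
      (incl₂ k X pq.1 pq.2 ∘ₗ C.decomp n pq.1 pq.2 i)

/-- The cobracket of a cooperad. -/
noncomputable def Cooperad.cobracket : Tot X →ₗ[k] Tot X ⊗[k] Tot X :=
  (LinearMap.id - flipρ k X) ∘ₗ C.cobrace

end Cooperad

/-! ### Frobenius algebras -/

section Frobenius

variable {k : Type u} [Field k] {A : Type v} [Ring A] [Algebra k A]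

/-- `ε` is a Frobenius functional: `a ↦ ε (a * ·)` is a bijection from `A` to its dual. -/
def IsFrobenius (ε : A →ₗ[k] k) : Prop :=
  Function.Bijective fun a : A => (ε ∘ₗ LinearMap.mulLeft k a : Module.Dual k A)

/-- `σ` is the Nakayama automorphism of `(A, ε)`. -/
def IsNakayama (ε : A →ₗ[k] k) (σ : A ≃ₐ[k] A) : Prop :=
  ∀ a b, ε (a * b) = ε (σ b * a)

/-- `(e_i)`, `(e^i)` is a pair of dual bases: `ε (e^j e_i) = δ_{ij}`. -/
def IsDualBases (ε : A →ₗ[k] k) {m : ℕ} (e e' : Module.Basis (Fin m) k A) : Prop :=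
  ∀ i j, ε (e' j * e i) = if i = j then 1 else 0

end Frobenius

/-! ### Hochschild chains with coefficients in the twisted bimodule -/

section Hochschild

variable (k : Type u) [Field k] (A : Type v) [Ring A] [Algebra k A]

/-- The Hochschild chains `C_n(A, σA) = σA ⊗ A^{⊗ n}`, where `σA` is `A` with right action by
multiplication and left action `a • m = σ a * m`; the underlying module is `A^{⊗ (n + 1)}`. -/
abbrev HochschildChain (n : ℕ) := ⨂[k] _ : Fin (n + 1), A

variable {A}

/-- The elementary chain `(a_0, …, a_n)` formed from the first `n + 1` terms of a sequence. -/
noncomputable def chain (n : ℕ) (a : ℕ → A) : HochschildChain k A n :=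
  PiTensorProduct.tprod k fun l : Fin (n + 1) => a l

variable {k}

/-- A map of tuples gives a multilinear map to the tensor power if changing one input entry `x`
changes exactly one output entry, in a way linear in `x`. -/
noncomputable def tprodComp {m n : ℕ} (g : (Fin m → A) → (Fin n → A))
    (hg : ∀ a j, ∃ (l : Fin n) (L : A →ₗ[k] A), ∀ x,
      g (Function.update a j x) = Function.update (g a) l (L x)) :
    MultilinearMap k (fun _ : Fin m => A) (⨂[k] _ : Fin n, A) where
  toFun a := PiTensorProduct.tprod k (g a)
  map_update_add' {inst} a j x y := by
    obtain rfl : inst = instDecidableEqFin m := Subsingleton.elim _ _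
    obtain ⟨l, L, h⟩ := hg a j
    simp [h]
  map_update_smul' {inst} a j c x := by
    obtain rfl : inst = instDecidableEqFin m := Subsingleton.elim _ _
    obtain ⟨l, L, h⟩ := hg a j
    simp [h]

/-- The face `(a_0, …, a_{n+1}) ↦ (a_0, …, a_i a_{i+1}, …, a_{n+1})`, for `0 ≤ i ≤ n`. -/
noncomputable def innerFace (n : ℕ) (i : Fin (n + 1)) :
    HochschildChain k A (n + 1) →ₗ[k] HochschildChain k A n :=
  PiTensorProduct.lift <| tprodComp
    (fun a l => if l < i then a l.castSucc else
      if l = i then a l.castSucc * a l.succ else a l.succ) (by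
    intro a j
    rcases lt_trichotomy j i.castSucc with h | h | h
    · refine ⟨⟨j, by grind⟩, LinearMap.id, fun x => funext fun l => ?_⟩
      simp only [Function.update_apply, Fin.ext_iff, Fin.lt_def, Fin.val_castSucc, Fin.val_succ,
        LinearMap.id_apply] at h ⊢
      grind
    · refine ⟨i, LinearMap.mulRight k (a i.succ), fun x => funext fun l => ?_⟩
      simp only [Function.update_apply, Fin.ext_iff, Fin.lt_def, Fin.val_castSucc, Fin.val_succ,
        LinearMap.mulRight_apply] at h ⊢
      grind
    · by_cases h' : j = i.succ
      · refine ⟨i, LinearMap.mulLeft k (a i.castSucc), fun x => funext fun l => ?_⟩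
        simp only [Function.update_apply, Fin.ext_iff, Fin.lt_def, Fin.val_castSucc, Fin.val_succ,
          LinearMap.mulLeft_apply] at h h' ⊢
        grind
      · refine ⟨j.pred (by grind), LinearMap.id, fun x => funext fun l => ?_⟩
        simp only [Function.update_apply, Fin.ext_iff, Fin.lt_def, Fin.val_castSucc, Fin.val_succ,
          Fin.val_pred, LinearMap.id_apply] at h h' ⊢
        grind)

/-- The face `(a_0, …, a_{n+1}) ↦ (σ(a_{n+1}) a_0, a_1, …, a_n)`. -/
noncomputable def lastFace (σ : A ≃ₐ[k] A) (n : ℕ) :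
    HochschildChain k A (n + 1) →ₗ[k] HochschildChain k A n :=
  PiTensorProduct.lift <| tprodComp
    (fun a l => if l = 0 then σ (a (Fin.last (n + 1))) * a 0 else a l.castSucc) (by
    intro a j
    by_cases h : j = Fin.last (n + 1)
    · refine ⟨0, LinearMap.mulRight k (a 0) ∘ₗ σ.toLinearMap, fun x => funext fun l => ?_⟩
      simp only [Function.update_apply, Fin.ext_iff, Fin.val_castSucc, Fin.val_last, Fin.val_zero,
        LinearMap.comp_apply, LinearMap.mulRight_apply, AlgEquiv.toLinearMap_apply] at h ⊢
      grind
    · by_cases h' : j = 0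
      · refine ⟨0, LinearMap.mulLeft k (σ (a (Fin.last (n + 1)))), fun x => funext fun l => ?_⟩
        simp only [Function.update_apply, Fin.ext_iff, Fin.val_castSucc, Fin.val_last, Fin.val_zero,
          LinearMap.mulLeft_apply] at h h' ⊢
        grind
      · refine ⟨⟨j, by grind⟩, LinearMap.id, fun x => funext fun l => ?_⟩
        simp only [Function.update_apply, Fin.ext_iff, Fin.val_castSucc, Fin.val_last, Fin.val_zero,
          LinearMap.id_apply] at h h' ⊢
        grind)

/-- The Hochschild differential `C_{n+1}(A, σA) → C_n(A, σA)`. -/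
noncomputable def hochschildD (σ : A ≃ₐ[k] A) (n : ℕ) :
    HochschildChain k A (n + 1) →ₗ[k] HochschildChain k A n :=
  ∑ i : Fin (n + 1), (-1 : k) ^ (i : ℕ) • innerFace n i + (-1 : k) ^ (n + 1) • lastFace σ n

/-- The Hochschild homology `H_n(A, σA)`. -/
abbrev HochschildHomology (σ : A ≃ₐ[k] A) (n : ℕ) := Homology (hochschildD σ) n

end Hochschild

/-! ### Tor over the enveloping algebra -/

section Tor

variable (k : Type u) [Field k] (A : Type v) [Ring A] [Algebra k A]

/-- The enveloping algebra. -/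
abbrev Env := A ⊗[k] Aᵐᵒᵖ

/-- `A` as a left module over its enveloping algebra, `(a ⊗ b) • x = a * x * b`. -/
noncomputable def selfBimodule : ModuleCat.{v} (Env k A) :=
  letI : Module (Env k A) A := TensorProduct.Algebra.module
  ModuleCat.of (Env k A) A

theorem selfBimodule_smul (a b x : A) :
    ((a ⊗ₜ[k] MulOpposite.op b : Env k A) • (show selfBimodule k A from x) : selfBimodule k A) =
      (a * (x * b) : A) := rfl

variable {k A}

/-- The relations `m · (a ⊗ b) ⊗ x = m ⊗ (a ⊗ b) • x` defining `σA ⊗ N` over the enveloping algebra,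
where `m · (a ⊗ b) = σ b * m * a` is the right action on the twisted bimodule `σA`. -/
def balancing (σ : A ≃ₐ[k] A) (N : ModuleCat.{v} (Env k A)) : Submodule k (A ⊗[k] N) :=
  Submodule.span k {t | ∃ (a b m : A) (x : N),
    t = (σ b * m * a) ⊗ₜ[k] x - m ⊗ₜ[k] ((a ⊗ₜ[k] MulOpposite.op b : Env k A) • x)}

/-- A morphism of modules over the enveloping algebra is linear over the ground field. -/
noncomputable def groundLinear {N N' : ModuleCat.{v} (Env k A)} (f : N ⟶ N') : N →ₗ[k] N' :=
  f.hom.restrictScalars k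

/-- The functor `σA ⊗ -` from modules over the enveloping algebra to vector spaces. -/
noncomputable def twistedTensor (σ : A ≃ₐ[k] A) :
    ModuleCat.{v} (Env k A) ⥤ ModuleCat.{v} k where
  obj N := ModuleCat.of k ((A ⊗[k] N) ⧸ balancing σ N)
  map {N N'} f := ModuleCat.ofHom <|
    Submodule.mapQ (balancing σ N) (balancing σ N') ((groundLinear f).lTensor A) (by
      rw [balancing, Submodule.span_le]
      rintro _ ⟨a, b, m, x, rfl⟩
      refine Submodule.subset_span ⟨a, b, m, f x, ?_⟩
      simp [groundLinear])
  map_id N := by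
    ext : 1
    refine Submodule.linearMap_qext _ (TensorProduct.ext' fun m x => ?_)
    simp [groundLinear]
  map_comp f g := by
    ext : 1
    refine Submodule.linearMap_qext _ (TensorProduct.ext' fun m x => ?_)
    simp [groundLinear]

instance (σ : A ≃ₐ[k] A) : (twistedTensor σ).Additive where
  map_add {N N' f g} := by
    ext : 1
    refine Submodule.linearMap_qext _ (TensorProduct.ext' fun m x => ?_)
    change (balancing σ N').mkQ (m ⊗ₜ (f x + g x)) =
      (balancing σ N').mkQ (m ⊗ₜ f x) + (balancing σ N').mkQ (m ⊗ₜ g x)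
    rw [TensorProduct.tmul_add, map_add]

/-- `Tor_n(σA, A)` over the enveloping algebra: the `n`-th left derived functor of `σA ⊗ -`,
at `A`. -/
noncomputable abbrev TorEnv (σ : A ≃ₐ[k] A) (n : ℕ) : ModuleCat.{v} k :=
  ((twistedTensor σ).leftDerived n).obj (selfBimodule k A)

/-- Multiply the entries `i` and `i + 1` of a sequence. -/
def merge (i : ℕ) (a : ℕ → A) : ℕ → A := fun l =>
  if l < i then a l else if l = i then a i * a (i + 1) else a (l + 1)

/-- A morphism of complexes of modules over the enveloping algebra, lifting the identity of `A`, from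
the bar resolution `A ⊗ A^{⊗ n} ⊗ A` to a projective resolution `P` of `A`. It is given by its
values `f n (a_0, …, a_{n-1})` on the generators `1 ⊗ (a_0, …, a_{n-1}) ⊗ 1`. -/
structure BarComparison (P : ProjectiveResolution (selfBimodule k A)) where
  f : ∀ n, MultilinearMap k (fun _ : Fin n => A) (P.complex.X n)
  comm : ∀ (n : ℕ) (a : ℕ → A),
    P.complex.d (n + 1) n (f (n + 1) fun l => a l) =
      (a 0 ⊗ₜ[k] 1 : Env k A) • f n (fun l => a (l + 1))
      + ∑ i ∈ Finset.range n, (-1 : k) ^ (i + 1) • f n (fun l => merge i a l)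
      + (-1 : k) ^ (n + 1) • ((1 ⊗ₜ[k] MulOpposite.op (a n) : Env k A) • f n (fun l => a l))
  augmentation :
    (P.π.f 0 ≫ (HomologicalComplex.singleObjXSelf (ComplexShape.down ℕ) 0
      (selfBimodule k A)).hom) (f 0 Fin.elim0) = (1 : A)

/-- The map `(m, a_1, …, a_n) ↦ m ⊗ f_n(a_1, …, a_n)` from Hochschild chains to `σA ⊗ P` over the
enveloping algebra, induced by a comparison of `P` with the bar resolution. -/
noncomputable def BarComparison.chainMap {P : ProjectiveResolution (selfBimodule k A)}
    (B : BarComparison P) (σ : A ≃ₐ[k] A) (n : ℕ) :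
    HochschildChain k A n →ₗ[k]
      (((twistedTensor σ).mapHomologicalComplex (ComplexShape.down ℕ)).obj P.complex).X n :=
  PiTensorProduct.lift <| LinearMap.uncurryLeft <|
    show A →ₗ[k] MultilinearMap k (fun _ : Fin n => A)
      ((A ⊗[k] P.complex.X n) ⧸ balancing σ (P.complex.X n)) from
    { toFun := fun m =>
        ((balancing σ (P.complex.X n)).mkQ ∘ₗ TensorProduct.mk k A (P.complex.X n) m
          ).compMultilinearMap (B.f n)
      map_add' := fun m m' => by
        ext x
        change (balancing σ (P.complex.X n)).mkQ ((m + m') ⊗ₜ (B.f n x)) =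
          (balancing σ (P.complex.X n)).mkQ (m ⊗ₜ (B.f n x)) +
            (balancing σ (P.complex.X n)).mkQ (m' ⊗ₜ (B.f n x))
        rw [TensorProduct.add_tmul, map_add]
      map_smul' := fun c m => by
        ext x
        change (balancing σ (P.complex.X n)).mkQ ((c • m) ⊗ₜ (B.f n x)) =
          c • (balancing σ (P.complex.X n)).mkQ (m ⊗ₜ (B.f n x))
        rw [← TensorProduct.smul_tmul', map_smul] }

/-- The linear isomorphisms `θ` are the canonical ones between Hochschild homology and `Tor`: for
every projective resolution `P` of `A` over the enveloping algebra and every comparison of `P` with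
the bar resolution, they are given on cycles by the map induced by the comparison. -/
def IsCanonicalTorIso (σ : A ≃ₐ[k] A) (θ : ∀ n, HochschildHomology σ n ≃ₗ[k] TorEnv σ n) : Prop :=
  ∀ (P : ProjectiveResolution (selfBimodule k A)) (B : BarComparison P) (n : ℕ)
    (z : cycles (hochschildD σ) n)
    (c : (((twistedTensor σ).mapHomologicalComplex (ComplexShape.down ℕ)).obj P.complex).cycles n),
    (((twistedTensor σ).mapHomologicalComplex (ComplexShape.down ℕ)).obj P.complex).iCycles n c =
      B.chainMap σ n z →
    (P.isoLeftDerivedObj (twistedTensor σ) n).hom (θ n (homologyClass (hochschildD σ) n z)) =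
      (((twistedTensor σ).mapHomologicalComplex (ComplexShape.down ℕ)).obj P.complex).homologyπ n c

end Tor

end FrobHoch

open FrobHoch

namespace FrobHoch

universe u v w w'

/-! ### Substitution operators on the free algebra -/

section FreeOperators

variable {k : Type u} [Field k] {ι : Type w}

/-! The Frobenius form turns a functional f on C_n into a cochain F : A^{⊗n} → A by the rule f(a_0,
…, a_n) = ε(a_0 F(a_1, …, a_n)). Under this identification every structure map on chains is the
transpose of a classical operation on Hochschild cochains. Pairing with Δ_{p,q,i} inserts one
cochain into the i-th argument of another, the cup coproduct is dual to the cup product, the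
cobracket to Gerstenhaber's bracket, and the twisted differential to the Hochschild codifferential;
the automorphism σ is absorbed by ε(ab) = ε(σ(b)a). The statement on homology is therefore
Gerstenhaber's theorem, transposed. Since k is a field, identities between maps into tensor powers
may be tested on products of homogeneous functionals.

Cochains are encoded as noncommutative polynomials ∑_w F(e_w) ⊗ x_w in A ⊗ k⟨x_c⟩. The cup product
becomes multiplication, and inserting g into f becomes applying to f the twisted derivation `der`
with x_c ↦ g_c, the c-th coordinate of g. A twisted derivation is determined by its values on
generators, which makes the usual sign computations short. The graded pre-Lie identity is `der_der`,
and it gives `jacobi`. `delta_mul` and `delta_bracket` say that product and bracket are compatible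
with the codifferential. Two identities hold only up to homotopy: graded commutativity, where a
single insertion is the homotopy (`delta_der`), and the Leibniz rule, where the double insertion
`der₂` is the homotopy (`der_mul_homotopy`). `polyOf_insertFun`, `polyOf_cupFun` and
`polyOf_comp_hochschildD` form the dictionary between functionals and polynomials.

To pass to homology, a complex over a field is contracted onto its homology (`exists_homotopy`).
Operations that are chain maps induce operations there, and iterated induced operations may be
computed on chains (`star_star_left`, `star_star_right`), so each axiom follows from an identity of
polynomials that holds modulo coboundaries.

For Tor, the bar complex is built together with its contracting extra degeneracy, and its tensor
product with σA is the Hochschild complex (`bijective_chainMap`). Naturality of left derived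
functors then shows that the resulting isomorphism is the one given by every comparison with every
projective resolution, and the coalgebra structure is transported along it. -/

/-- The linear operator on triples `(d, w)` used to define operators on the free algebra by left
recursion. -/
noncomputable def recStep (R : ι → FreeAlgebra k ι →ₗ[k] FreeAlgebra k ι) (c : ι) :
    Module.End k (FreeAlgebra k ι × FreeAlgebra k ι) :=
  LinearMap.prod
    (LinearMap.mulLeft k (FreeAlgebra.ι k c) ∘ₗ LinearMap.fst k _ _ + R c ∘ₗ LinearMap.snd k _ _)
    (LinearMap.mulLeft k (FreeAlgebra.ι k c) ∘ₗ LinearMap.snd k _ _)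

/-- The linear operator `L` on the free algebra with `L 1 = 0` and `L (x_c v) = x_c L v + R_c v`. -/
noncomputable def recOp (R : ι → FreeAlgebra k ι →ₗ[k] FreeAlgebra k ι) :
    FreeAlgebra k ι →ₗ[k] FreeAlgebra k ι :=
  LinearMap.fst k _ _ ∘ₗ
    LinearMap.applyₗ ((0, 1) : FreeAlgebra k ι × FreeAlgebra k ι) ∘ₗ
      (FreeAlgebra.lift k (recStep R)).toLinearMap

/-- The second component accumulates the polynomial read so far, to which R_c is applied when the
letter x_c is prepended. -/
theorem lift_recStep_snd (R : ι → FreeAlgebra k ι →ₗ[k] FreeAlgebra k ι) (v : FreeAlgebra k ι)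
    (z : FreeAlgebra k ι × FreeAlgebra k ι) :
    (FreeAlgebra.lift k (recStep R) v z).2 = v * z.2 := by
  induction v using FreeAlgebra.induction generalizing z with
  | grade0 r => simp [Module.algebraMap_end_apply, Algebra.smul_def]
  | grade1 x => simp [recStep]
  | mul a b ha hb => simp [ha, hb, mul_assoc]
  | add a b ha hb => simp [ha, hb, add_mul]

theorem recOp_ι_mul (R : ι → FreeAlgebra k ι →ₗ[k] FreeAlgebra k ι) (c : ι)
    (v : FreeAlgebra k ι) :
    recOp R (FreeAlgebra.ι k c * v) = FreeAlgebra.ι k c * recOp R v + R c v := by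
  have h := lift_recStep_snd R v (0, 1)
  simp only [mul_one] at h
  simp [recOp, recStep, h]

theorem recOp_algebraMap (R : ι → FreeAlgebra k ι →ₗ[k] FreeAlgebra k ι) (r : k) :
    recOp R (algebraMap k _ r) = 0 := by
  simp [recOp, Module.algebraMap_end_apply]

theorem recOp_one (R : ι → FreeAlgebra k ι →ₗ[k] FreeAlgebra k ι) :
    recOp R 1 = 0 := by
  simpa using recOp_algebraMap R 1

/-- The automorphism of the free algebra multiplying each generator by `(-1) ^ s`. -/
noncomputable def signHom (s : ℕ) : FreeAlgebra k ι →ₐ[k] FreeAlgebra k ι :=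
  FreeAlgebra.lift k fun c => (-1 : k) ^ s • FreeAlgebra.ι k c

@[simp]
theorem signHom_ι (s : ℕ) (c : ι) :
    signHom s (FreeAlgebra.ι k c) = (-1 : k) ^ s • FreeAlgebra.ι k c := by
  simp [signHom]

/-- The twisted derivation `D` with `D x_c = γ_c` and `D (u v) = D u * signHom s v + u * D v`. -/
noncomputable def freeDer (s : ℕ) (γ : ι → FreeAlgebra k ι) :
    FreeAlgebra k ι →ₗ[k] FreeAlgebra k ι :=
  recOp fun c => LinearMap.mulLeft k (γ c) ∘ₗ (signHom s).toLinearMap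

/-- Every letter to the right of the substituted one contributes (-1)^s, so a substitution in the
left factor twists the whole right factor. -/
theorem freeDer_mul (s : ℕ) (γ : ι → FreeAlgebra k ι) (u v : FreeAlgebra k ι) :
    freeDer s γ (u * v) = freeDer s γ u * signHom s v + u * freeDer s γ v := by
  induction u using FreeAlgebra.induction generalizing v with
  | grade0 r =>
    rw [← Algebra.smul_def, map_smul, freeDer, recOp_algebraMap, zero_mul, zero_add,
      Algebra.smul_def]
  | grade1 c =>
    have h := recOp_ι_mul (fun c => LinearMap.mulLeft k (γ c) ∘ₗ (signHom s).toLinearMap) c 1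
    rw [recOp_one, mul_one] at h
    rw [freeDer, recOp_ι_mul, h]
    simp [add_comm]
  | mul a b ha hb => rw [mul_assoc, ha, hb, ha, map_mul]; noncomm_ring
  | add a b ha hb => rw [add_mul, map_add, ha, hb, map_add]; noncomm_ring

theorem freeDer_ι (s : ℕ) (γ : ι → FreeAlgebra k ι) (c : ι) :
    freeDer s γ (FreeAlgebra.ι k c) = γ c := by
  have h := recOp_ι_mul (fun c => LinearMap.mulLeft k (γ c) ∘ₗ (signHom s).toLinearMap) c 1
  rw [recOp_one, mul_one] at h
  rw [freeDer, h]; simp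

theorem freeDer_algebraMap (s : ℕ) (γ : ι → FreeAlgebra k ι) (r : k) :
    freeDer s γ (algebraMap k _ r) = 0 := recOp_algebraMap _ _

theorem freeDer_one (s : ℕ) (γ : ι → FreeAlgebra k ι) : freeDer s γ 1 = 0 := recOp_one _

/-- The insertion of two twisted derivations, the one for `γ` to the left of the one for `η`. -/
noncomputable def freeDer₂ (s : ℕ) (γ : ι → FreeAlgebra k ι) (t : ℕ) (η : ι → FreeAlgebra k ι) :
    FreeAlgebra k ι →ₗ[k] FreeAlgebra k ι :=
  -- `signHom s` counts all letters to the right of x_c. The extra (-1)^s discounts the one that the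
  -- second substitution replaces.
  recOp fun c => (-1 : k) ^ s •
    (LinearMap.mulLeft k (γ c) ∘ₗ freeDer t η ∘ₗ (signHom s).toLinearMap)

theorem signHom_signHom (s t : ℕ) (u : FreeAlgebra k ι) :
    signHom s (signHom t u) = signHom (s + t) u := by
  have : (signHom (k := k) (ι := ι) s).comp (signHom t) = signHom (s + t) := by
    ext c; simp [pow_add, smul_smul, mul_comm]
  exact DFunLike.congr_fun this u

/-- The two substituted letters lie both in v, one in each factor, or both in u. -/
theorem freeDer₂_mul (s : ℕ) (γ : ι → FreeAlgebra k ι) (t : ℕ) (η : ι → FreeAlgebra k ι)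
    (u v : FreeAlgebra k ι) :
    freeDer₂ s γ t η (u * v) = u * freeDer₂ s γ t η v
      + (-1 : k) ^ s • (freeDer s γ u * freeDer t η (signHom s v))
      + freeDer₂ s γ t η u * signHom (t + s) v := by
  induction u using FreeAlgebra.induction generalizing v with
  | grade0 r =>
    rw [← Algebra.smul_def, map_smul, freeDer₂, freeDer_algebraMap, recOp_algebraMap,
      zero_mul, zero_mul, smul_zero, add_zero, add_zero, Algebra.smul_def]
  | grade1 c =>
    have h := recOp_ι_mul (fun c => (-1 : k) ^ s •
      (LinearMap.mulLeft k (γ c) ∘ₗ freeDer t η ∘ₗ (signHom s).toLinearMap)) c 1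
    rw [recOp_one, mul_one] at h
    rw [freeDer₂, recOp_ι_mul, h, freeDer_ι]
    simp [freeDer_one]
  | mul a b ha hb =>
    rw [mul_assoc, ha, hb, ha, freeDer_mul, map_mul (signHom s), map_mul (signHom (t + s)),
      freeDer_mul, signHom_signHom]
    simp only [mul_add, add_mul, smul_add, mul_smul_comm, smul_mul_assoc, mul_assoc]
    abel
  | add a b ha hb =>
    rw [add_mul, map_add, ha, hb, map_add, map_add]
    simp only [add_mul, smul_add]
    abel

theorem freeDer₂_ι (s : ℕ) (γ : ι → FreeAlgebra k ι) (t : ℕ) (η : ι → FreeAlgebra k ι) (c : ι) :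
    freeDer₂ s γ t η (FreeAlgebra.ι k c) = 0 := by
  have h := recOp_ι_mul (fun c => (-1 : k) ^ s •
      (LinearMap.mulLeft k (γ c) ∘ₗ freeDer t η ∘ₗ (signHom s).toLinearMap)) c 1
  rw [recOp_one, mul_one] at h
  rw [freeDer₂, h]; simp [freeDer_one]

theorem freeDer₂_one (s : ℕ) (γ : ι → FreeAlgebra k ι) (t : ℕ) (η : ι → FreeAlgebra k ι) :
    freeDer₂ s γ t η 1 = 0 := recOp_one _

end FreeOperators

/-! ### Twisted derivations of `A ⊗ k⟨x_c⟩` -/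

section NCPoly

variable {k : Type u} [Field k] {A : Type v} [Ring A] [Algebra k A] {ι : Type w}

variable (k A ι) in
/-- Noncommutative polynomials with coefficients in `A`. -/
abbrev NCPoly := A ⊗[k] FreeAlgebra k ι

variable (k A) in
/-- The generators. -/
noncomputable def genX (c : ι) : NCPoly k A ι := 1 ⊗ₜ FreeAlgebra.ι k c

/-- Constants and letters generate A ⊗ k⟨x_c⟩ as a ring, so operators obeying a product rule need
only be examined there. -/
theorem NCPoly.induction {P : NCPoly k A ι → Prop} (coeff : ∀ a : A, P (a ⊗ₜ 1))
    (gen : ∀ c, P (genX k A c)) (mul : ∀ u v, P u → P v → P (u * v))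
    (add : ∀ u v, P u → P v → P (u + v)) (u : NCPoly k A ι) : P u := by
  have key (w : FreeAlgebra k ι) : P (1 ⊗ₜ w) := by
    induction w using FreeAlgebra.induction with
    | grade0 r =>
      rw [Algebra.algebraMap_eq_smul_one, ← TensorProduct.smul_tmul]
      exact coeff _
    | grade1 c => exact gen c
    | mul a b ha hb => simpa using mul _ _ ha hb
    | add a b ha hb => rw [TensorProduct.tmul_add]; exact add _ _ ha hb
  induction u using TensorProduct.induction_on with
  | zero => simpa using coeff 0
  | tmul a w => simpa using mul _ _ (coeff a) (key w)
  | add a b ha hb => exact add _ _ ha hb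

/-- The automorphism multiplying each generator by `(-1) ^ s`. -/
noncomputable def sgn (s : ℕ) : NCPoly k A ι →ₐ[k] NCPoly k A ι :=
  Algebra.TensorProduct.map (AlgHom.id k A) (signHom s)

@[simp]
theorem sgn_tmul (s : ℕ) (a : A) (u : FreeAlgebra k ι) :
    sgn s (a ⊗ₜ[k] u) = a ⊗ₜ signHom s u := by
  simp [sgn]

@[simp]
theorem sgn_genX (s : ℕ) (c : ι) : sgn s (genX k A c) = (-1 : k) ^ s • genX k A c := by
  simp [genX]

theorem sgn_sgn (s t : ℕ) (u : NCPoly k A ι) : sgn s (sgn t u) = sgn (s + t) u := by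
  induction u using NCPoly.induction with
  | coeff a => simp
  | gen c => simp [pow_add, smul_smul, mul_comm]
  | mul a b ha hb => simp only [map_mul, ha, hb]
  | add a b ha hb => simp only [map_add, ha, hb]

/-- The coefficient of `u` at the basis vector `e_c` of `A`. -/
noncomputable def component (e : Module.Basis ι k A) (c : ι) :
    NCPoly k A ι →ₗ[k] FreeAlgebra k ι :=
  (TensorProduct.lid k _).toLinearMap ∘ₗ (e.coord c).rTensor _

theorem component_tmul (e : Module.Basis ι k A) (c : ι) (a : A) (u : FreeAlgebra k ι) :
    component e c (a ⊗ₜ u) = e.coord c a • u := by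
  simp [component]

theorem sum_component [Fintype ι] (e : Module.Basis ι k A) (u : NCPoly k A ι) :
    ∑ c, e c ⊗ₜ component e c u = u := by
  induction u using TensorProduct.induction_on with
  | zero => simp
  | tmul a w =>
    simp_rw [component_tmul, TensorProduct.tmul_smul, TensorProduct.smul_tmul',
      ← TensorProduct.sum_tmul]
    simp [e.sum_repr]
  | add a b ha hb => simp_rw [map_add, TensorProduct.tmul_add, Finset.sum_add_distrib, ha, hb]

/-- The coefficient of `u` at `e_c`, as a polynomial with scalar coefficients. -/
noncomputable def scalarComponent (e : Module.Basis ι k A) (c : ι) :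
    NCPoly k A ι →ₗ[k] NCPoly k A ι :=
  TensorProduct.mk k A (FreeAlgebra k ι) 1 ∘ₗ component e c

/-- L acts on the polynomial factor and the coordinate is taken in the factor A, so the two commute.
-/
theorem lTensor_scalarComponent (e : Module.Basis ι k A) (c : ι)
    (L : FreeAlgebra k ι →ₗ[k] FreeAlgebra k ι) (u : NCPoly k A ι) :
    L.lTensor A (scalarComponent e c u) = scalarComponent e c (L.lTensor A u) := by
  induction u using TensorProduct.induction_on with
  | zero => simp
  | tmul a w => simp [scalarComponent, component_tmul]
  | add a b ha hb => simp only [map_add, ha, hb]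

theorem sgn_scalarComponent (e : Module.Basis ι k A) (c : ι) (s : ℕ) (u : NCPoly k A ι) :
    sgn s (scalarComponent e c u) = scalarComponent e c (sgn s u) :=
  lTensor_scalarComponent e c (signHom s).toLinearMap u

/-- The twisted derivation with values `g_c` on the generators `x_c`, where `g = ∑ e_c ⊗ g_c`. -/
noncomputable def der (e : Module.Basis ι k A) (s : ℕ) (g : NCPoly k A ι) :
    NCPoly k A ι →ₗ[k] NCPoly k A ι :=
  (freeDer s fun c => component e c g).lTensor A

variable (e : Module.Basis ι k A)

theorem der_mul (s : ℕ) (g u v : NCPoly k A ι) :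
    der e s g (u * v) = der e s g u * sgn s v + u * der e s g v := by
  induction u using TensorProduct.induction_on with
  | zero => simp
  | tmul a w =>
    induction v using TensorProduct.induction_on with
    | zero => simp
    | tmul b z => simp [der, freeDer_mul, TensorProduct.tmul_add]
    | add x y hx hy => simp only [mul_add, map_add, hx, hy]; abel
  | add x y hx hy => simp only [add_mul, map_add, hx, hy]; abel

@[simp]
theorem der_coeff (s : ℕ) (g : NCPoly k A ι) (a : A) : der e s g (a ⊗ₜ 1) = 0 := by
  simp [der, freeDer_one]

theorem der_genX (s : ℕ) (g : NCPoly k A ι) (c : ι) :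
    der e s g (genX k A c) = scalarComponent e c g := by
  simp [der, genX, freeDer_ι, scalarComponent]

theorem der_scalarComponent (s : ℕ) (g u : NCPoly k A ι) (c : ι) :
    der e s g (scalarComponent e c u) = scalarComponent e c (der e s g u) :=
  lTensor_scalarComponent _ _ _ _

/-- The product rule propagates vanishing from generators. Most operator identities below reduce to
this uniqueness. -/
theorem eq_zero_of_twisted (s : ℕ) (L : NCPoly k A ι →ₗ[k] NCPoly k A ι)
    (mul : ∀ u v, L (u * v) = L u * sgn s v + u * L v) (coeff : ∀ a : A, L (a ⊗ₜ 1) = 0)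
    (gen : ∀ c, L (genX k A c) = 0) : L = 0 := by
  ext1
  refine LinearMap.ext fun a => LinearMap.ext fun w => ?_
  change L (a ⊗ₜ w) = 0
  induction (a ⊗ₜ[k] w : NCPoly k A ι) using NCPoly.induction with
  | coeff a => exact coeff a
  | gen c => exact gen c
  | mul u v hu hv => rw [mul, hu, hv]; simp
  | add u v hu hv => rw [map_add, hu, hv, add_zero]

theorem der_eq_of_twisted (s : ℕ) (g : NCPoly k A ι) (L : NCPoly k A ι →ₗ[k] NCPoly k A ι)
    (mul : ∀ u v, L (u * v) = L u * sgn s v + u * L v) (coeff : ∀ a : A, L (a ⊗ₜ 1) = 0)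
    (gen : ∀ c, L (genX k A c) = scalarComponent e c g) : L = der e s g := by
  rw [← sub_eq_zero]
  refine eq_zero_of_twisted s _ (fun u v => ?_) (fun a => ?_) fun c => ?_
  · simp only [LinearMap.sub_apply, mul, der_mul, sub_mul, mul_sub]; abel
  · simp [coeff]
  · simp [gen, der_genX]

@[simp]
theorem der_zero (s : ℕ) : der e s 0 = 0 :=
  (der_eq_of_twisted e s 0 0 (by simp) (by simp) (by simp)).symm

theorem der_smul (s : ℕ) (r : k) (g : NCPoly k A ι) : der e s (r • g) = r • der e s g := by
  refine (der_eq_of_twisted e s _ _ (fun u v => ?_) (fun a => ?_) fun c => ?_).symm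
  · simp only [LinearMap.smul_apply, der_mul, smul_add, smul_mul_assoc, mul_smul_comm]
  · simp
  · simp [der_genX]

/-- `u` is homogeneous of parity `p`. -/
def HasParity (p : ℕ) (u : NCPoly k A ι) : Prop := ∀ t, sgn t u = (-1 : k) ^ (t * p) • u

/-- Substitution trades one letter for a polynomial of parity q, changing the parity by q - 1,
written q + 1 to stay in ℕ. -/
theorem sgn_der {q : ℕ} {g : NCPoly k A ι} (hg : HasParity q g) (t s : ℕ) (u : NCPoly k A ι) :
    sgn t (der e s g u) = (-1 : k) ^ (t * (q + 1)) • der e s g (sgn t u) := by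
  induction u using NCPoly.induction with
  | coeff a => simp
  | gen c =>
    rw [sgn_genX, der_genX, sgn_scalarComponent, hg, map_smul, map_smul, der_genX, smul_smul,
      mul_add, mul_one, pow_add, mul_assoc, ← mul_pow]
    simp
  | mul u v hu hv =>
    rw [der_mul, map_add, map_mul, map_mul, map_mul, hu, hv, der_mul, sgn_sgn, sgn_sgn,
      add_comm t s, smul_add, smul_mul_assoc, mul_smul_comm]
  | add u v hu hv => simp only [map_add, hu, hv, smul_add]

theorem HasParity.mul {p q : ℕ} {f g : NCPoly k A ι} (hf : HasParity p f) (hg : HasParity q g) :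
    HasParity (p + q) (f * g) := fun t => by
  rw [map_mul, hf, hg, smul_mul_smul_comm, ← pow_add, mul_add]

theorem neg_one_pow_congr {s t : ℕ} (h : Even (s + t)) : (-1 : k) ^ s = (-1) ^ t := by
  rcases Nat.even_or_odd s with hs | hs
  · rw [hs.neg_one_pow, (by grind : Even t).neg_one_pow]
  · rw [hs.neg_one_pow, (by grind : Odd t).neg_one_pow]

theorem HasParity.congr {p q : ℕ} {f : NCPoly k A ι} (hf : HasParity p f) (h : Even (p + q)) :
    HasParity q f := fun t => by
  rw [hf, neg_one_pow_congr]
  rw [← mul_add]; exact h.mul_left t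

theorem sgn_congr {s t : ℕ} (h : Even (s + t)) (u : NCPoly k A ι) : sgn s u = sgn t u := by
  induction u using NCPoly.induction with
  | coeff a => simp
  | gen c => rw [sgn_genX, sgn_genX, neg_one_pow_congr h]
  | mul a b ha hb => simp only [map_mul, ha, hb]
  | add a b ha hb => simp only [map_add, ha, hb]

theorem der_congr {s t : ℕ} (h : Even (s + t)) (g : NCPoly k A ι) : der e s g = der e t g :=
  der_eq_of_twisted e t g _ (fun u v => by rw [der_mul, sgn_congr h]) (by simp)
    (der_genX e s g)

/-- The commutator of twisted derivations; equivalently, the graded pre-Lie identity. -/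
theorem der_der {q r : ℕ} {g h : NCPoly k A ι} (hg : HasParity q g) (hh : HasParity r h)
    (u : NCPoly k A ι) :
    der e (r + 1) h (der e (q + 1) g u)
      - (-1 : k) ^ ((q + 1) * (r + 1)) • der e (q + 1) g (der e (r + 1) h u) =
    der e (q + r) (der e (r + 1) h g - (-1 : k) ^ ((q + 1) * (r + 1)) • der e (q + 1) g h) u := by
  have key := der_eq_of_twisted e (q + r)
    (der e (r + 1) h g - (-1 : k) ^ ((q + 1) * (r + 1)) • der e (q + 1) g h)
    (der e (r + 1) h ∘ₗ der e (q + 1) g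
      - (-1 : k) ^ ((q + 1) * (r + 1)) • der e (q + 1) g ∘ₗ der e (r + 1) h)
    (fun u v => ?_) (fun a => by simp) fun c => by
      simp [der_genX, der_scalarComponent]
  · exact LinearMap.congr_fun key u
  -- The cross terms, with one substitution in u and the other in v, cancel in the graded commutator
  -- by `sgn_der`. Hence the commutator is again a twisted derivation.
  · simp only [LinearMap.sub_apply, LinearMap.smul_apply, LinearMap.comp_apply, der_mul, map_add,
      sgn_der e hg, sgn_der e hh, sgn_sgn]
    rw [sgn_congr (show Even ((r + 1) + (q + 1) + (q + r)) by grind),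
      sgn_congr (show Even ((q + 1) + (r + 1) + (q + r)) by grind), mul_comm (r + 1) (q + 1)]
    simp only [smul_add, mul_smul_comm, smul_smul, ← mul_pow, mul_sub, sub_mul, smul_mul_assoc,
      neg_one_mul, neg_neg, one_pow, one_smul]
    abel

/-- The double insertion of `f` and `g`. -/
noncomputable def der₂ (s : ℕ) (f : NCPoly k A ι) (t : ℕ) (g : NCPoly k A ι) :
    NCPoly k A ι →ₗ[k] NCPoly k A ι :=
  (freeDer₂ s (fun c => component e c f) t fun c => component e c g).lTensor A

theorem der₂_mul (s : ℕ) (f : NCPoly k A ι) (t : ℕ) (g u v : NCPoly k A ι) :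
    der₂ e s f t g (u * v) = u * der₂ e s f t g v
      + (-1 : k) ^ s • (der e s f u * der e t g (sgn s v)) + der₂ e s f t g u * sgn (t + s) v := by
  induction u using TensorProduct.induction_on with
  | zero => simp
  | tmul a w =>
    induction v using TensorProduct.induction_on with
    | zero => simp
    | tmul b z => simp [der, der₂, freeDer₂_mul, TensorProduct.tmul_add]
    | add x y hx hy => simp only [mul_add, map_add, hx, hy, smul_add]; abel
  | add x y hx hy => simp only [add_mul, map_add, hx, hy, smul_add]; abel

@[simp]
theorem der₂_coeff (s : ℕ) (f : NCPoly k A ι) (t : ℕ) (g : NCPoly k A ι) (a : A) :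
    der₂ e s f t g (a ⊗ₜ 1) = 0 := by
  simp [der₂, freeDer₂_one]

@[simp]
theorem der₂_genX (s : ℕ) (f : NCPoly k A ι) (t : ℕ) (g : NCPoly k A ι) (c : ι) :
    der₂ e s f t g (genX k A c) = 0 := by
  simp [der₂, genX, freeDer₂_ι]

theorem der₂_scalarComponent (s : ℕ) (f : NCPoly k A ι) (t : ℕ) (g u : NCPoly k A ι) (c : ι) :
    der₂ e s f t g (scalarComponent e c u) = scalarComponent e c (der₂ e s f t g u) :=
  lTensor_scalarComponent _ _ _ _

/-- Two letters are traded for polynomials of parities p and q, so the parity changes by p + q - 2.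
-/
theorem sgn_der₂ {p q : ℕ} {f g : NCPoly k A ι} (hf : HasParity p f) (hg : HasParity q g)
    (s t n : ℕ) (u : NCPoly k A ι) :
    sgn n (der₂ e s f t g u) = (-1 : k) ^ (n * (p + q)) • der₂ e s f t g (sgn n u) := by
  induction u using NCPoly.induction with
  | coeff a => simp
  | gen c => simp
  | mul u v hu hv =>
    rw [der₂_mul, map_add, map_add, map_mul, map_mul, map_smul, map_mul, hu, hv, sgn_der e hf,
      sgn_der e hg, map_mul, der₂_mul, sgn_sgn, sgn_sgn, sgn_sgn, sgn_sgn, add_comm n s,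
      add_comm n (t + s), smul_add, smul_add, smul_mul_smul_comm, ← pow_add, mul_smul_comm,
      smul_mul_assoc, smul_comm ((-1 : k) ^ s),
      neg_one_pow_congr (show Even (n * (p + 1) + n * (q + 1) + n * (p + q)) by grind)]
  | add u v hu hv => simp only [map_add, hu, hv, smul_add]

end NCPoly

/-! ### The graded bracket and its Jacobi identity -/

section Bracket

variable {k : Type u} [Field k] {A : Type v} [Ring A] [Algebra k A] {ι : Type w}
  (e : Module.Basis ι k A)

/-- The graded pre-Lie bracket of elements of degrees `p` and `q`. -/
noncomputable def bracket (p q : ℕ) (f g : NCPoly k A ι) : NCPoly k A ι :=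
  der e (q + 1) g f - (-1 : k) ^ ((p + 1) * (q + 1)) • der e (p + 1) f g

/-- Each iterated bracket expands into four compositions of two substitutions. In the cyclic sum
each of the six possible compositions occurs twice, with opposite signs. -/
theorem jacobi {p q r : ℕ} {f g h : NCPoly k A ι} (hf : HasParity p f) (hg : HasParity q g)
    (hh : HasParity r h) :
    bracket e (p + q + 1) r (bracket e p q f g) h
      + (-1 : k) ^ ((p + 1) * (q + 1) + (p + 1) * (r + 1)) •
        bracket e (q + r + 1) p (bracket e q r g h) f
      + (-1 : k) ^ ((p + 1) * (r + 1) + (q + 1) * (r + 1)) •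
        bracket e (r + p + 1) q (bracket e r p h f) g = 0 := by
  have key {p q r : ℕ} {f g : NCPoly k A ι} (hf : HasParity p f) (hg : HasParity q g)
      (h : NCPoly k A ι) : bracket e (p + q + 1) r (bracket e p q f g) h =
      der e (r + 1) h (der e (q + 1) g f)
        - (-1 : k) ^ ((p + 1) * (q + 1)) • der e (r + 1) h (der e (p + 1) f g)
        - (-1 : k) ^ ((p + q) * (r + 1)) • (der e (q + 1) g (der e (p + 1) f h)
          - (-1 : k) ^ ((p + 1) * (q + 1)) • der e (p + 1) f (der e (q + 1) g h)) := by
    -- Substituting the bracket of f and g into h is, by `der_der`, the graded commutator of the two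
    -- substitutions applied to h.
    rw [der_der e hf hg, bracket, der_congr e (show Even (p + q + 1 + 1 + (p + q)) by grind),
      bracket, map_sub, map_smul,
      neg_one_pow_congr (show Even ((p + q + 1 + 1) * (r + 1) + (p + q) * (r + 1)) by
        rw [← add_mul]; exact Even.mul_right (by grind) _)]
  rw [key hf hg, key hg hh, key hh hf]
  rcases neg_one_pow_eq_or k p with hp | hp <;> rcases neg_one_pow_eq_or k q with hq | hq <;>
    rcases neg_one_pow_eq_or k r with hr | hr <;>
    simp only [pow_add, pow_mul, hp, hq, hr, one_mul, one_pow, pow_one, mul_neg, neg_neg,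
      neg_mul] <;>
    module

end Bracket

/-! ### The Hochschild codifferential on polynomials -/

section Delta

variable {k : Type u} [Field k] {A : Type v} [Ring A] [Algebra k A] {ι : Type w} [Fintype ι]
  (e : Module.Basis ι k A)

/-- The universal element `∑ e_c ⊗ x_c`. -/
noncomputable def univElt : NCPoly k A ι := ∑ c, e c ⊗ₜ FreeAlgebra.ι k c

theorem hasParity_univElt : HasParity 1 (univElt e) := fun t => by
  simp [univElt, Finset.smul_sum, TensorProduct.smul_tmul']

/-- The universal element plays the role of the identity cochain A → A: substitution reassembles g
from its coordinates. -/
theorem der_univElt (s : ℕ) (g : NCPoly k A ι) : der e s g (univElt e) = g := by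
  simp [univElt, der, freeDer_ι, sum_component]

theorem der₂_univElt (s : ℕ) (f : NCPoly k A ι) (t : ℕ) (g : NCPoly k A ι) :
    der₂ e s f t g (univElt e) = 0 := by
  simp [univElt, der₂, freeDer₂_ι]

/-- The twisted derivation dual to the product of `A`. -/
noncomputable def derMul : NCPoly k A ι →ₗ[k] NCPoly k A ι := der e 1 (univElt e * univElt e)

theorem hasParity_univElt_sq : HasParity 2 (univElt e * univElt e) :=
  ((hasParity_univElt e).mul (hasParity_univElt e)).congr (by decide)

/-- The Hochschild codifferential on elements of degree `p`. -/
noncomputable def delta (p : ℕ) : NCPoly k A ι →ₗ[k] NCPoly k A ι :=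
  LinearMap.mulLeft k (univElt e) - (-1 : k) ^ p • LinearMap.mulRight k (univElt e)
    + (-1 : k) ^ p • derMul e

theorem delta_apply (p : ℕ) (f : NCPoly k A ι) :
    delta e p f = univElt e * f - (-1 : k) ^ p • (f * univElt e) + (-1 : k) ^ p • derMul e f := rfl

theorem derMul_mul {q : ℕ} {g : NCPoly k A ι} (hg : HasParity q g) (f : NCPoly k A ι) :
    derMul e (f * g) = (-1 : k) ^ q • (derMul e f * g) + f * derMul e g := by
  rw [derMul, der_mul, hg, one_mul, mul_smul_comm]

theorem derMul_univElt : derMul e (univElt e) = univElt e * univElt e := der_univElt _ _ _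

theorem delta_congr {p q : ℕ} (h : Even (p + q)) (f : NCPoly k A ι) :
    delta e p f = delta e q f := by
  rw [delta_apply, delta_apply, neg_one_pow_congr h]

/-- This is associativity of A: on x_c the square is a coordinate of the difference of the two
bracketings of the triple product of the universal element. -/
theorem derMul_derMul (f : NCPoly k A ι) : derMul e (derMul e f) = 0 := by
  have h : derMul e ∘ₗ derMul e = 0 := by
    refine eq_zero_of_twisted 0 _ (fun u v => ?_) (fun a => by simp [derMul]) fun c => ?_
    · simp only [derMul, LinearMap.comp_apply, der_mul, map_add, sgn_sgn,
        sgn_der e (hasParity_univElt_sq e)]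
      rw [sgn_congr (show Even (1 + 1 + 0) by decide)]
      simp only [mul_smul_comm]
      module
    · rw [LinearMap.comp_apply, derMul, der_genX, der_scalarComponent, ← derMul,
        derMul_mul e (hasParity_univElt e), derMul_univElt]
      simp only [mul_assoc, pow_one, map_add, map_smul]
      module
  exact LinearMap.congr_fun h f

/-- The two terms in which the universal element stands between f and g cancel; the rest is the
product rule of `derMul`. -/
theorem delta_mul {p q : ℕ} {f g : NCPoly k A ι} (hg : HasParity q g) :
    delta e (p + q) (f * g) = delta e p f * g + (-1 : k) ^ p • (f * delta e q g) := by
  simp only [delta_apply, derMul_mul e hg, pow_add]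
  rcases neg_one_pow_eq_or k p with hp | hp <;> rcases neg_one_pow_eq_or k q with hq | hq <;>
    simp only [hp, hq, mul_add, add_mul, mul_sub, sub_mul, smul_mul_assoc, mul_smul_comm,
      mul_assoc] <;> module

theorem delta_delta {p : ℕ} {f : NCPoly k A ι} (hf : HasParity p f) :
    delta e (p + 1) (delta e p f) = 0 := by
  simp only [delta_apply, map_add, map_sub, map_smul, derMul_mul e hf, derMul_derMul,
    derMul_mul e (hasParity_univElt e), derMul_univElt, pow_succ]
  rcases neg_one_pow_eq_or k p with hp | hp <;>
    simp only [hp, mul_assoc] <;> module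

theorem der_univElt_sq (q : ℕ) (g : NCPoly k A ι) :
    der e (q + 1) g (univElt e * univElt e) =
      (-1 : k) ^ (q + 1) • (g * univElt e) + univElt e * g := by
  rw [der_mul, der_univElt, hasParity_univElt, mul_one, mul_smul_comm]

/-- `der_der` is applied with the squared universal element as one argument. Substituting g into
that square leaves g on one side of a universal letter, and these terms together with `derMul e g`
make up δg. -/
theorem derMul_der {q : ℕ} {g : NCPoly k A ι} (hg : HasParity q g) (f : NCPoly k A ι) :
    derMul e (der e (q + 1) g f) = (-1 : k) ^ (q + 1) • der e (q + 1) g (derMul e f)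
      + (-1 : k) ^ q • der e q (delta e q g) f := by
  have h := der_der e hg (hasParity_univElt_sq e) f
  rw [der_congr e (show Even (2 + 1 + 1) by decide), der_univElt_sq, ← derMul,
    der_congr e (show Even (q + 2 + q) by grind), sub_eq_iff_eq_add] at h
  have h2 : derMul e g - (-1 : k) ^ ((q + 1) * (2 + 1)) •
      ((-1 : k) ^ (q + 1) • (g * univElt e) + univElt e * g) = (-1 : k) ^ q • delta e q g := by
    rw [delta_apply]
    simp only [pow_add, pow_mul]
    rcases neg_one_pow_eq_or k q with hq | hq <;> simp only [hq] <;> module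
  rw [h, h2, der_smul, LinearMap.smul_apply, add_comm,
    neg_one_pow_congr (show Even ((q + 1) * (2 + 1) + (q + 1)) by grind)]

/-- Substituting g into the outer terms of δf also hits the extra universal letter, which leaves g *
f and f * g. For cocycles f and g this exhibits the graded commutator of the cup product as a
coboundary. -/
theorem delta_der {p q : ℕ} {f g : NCPoly k A ι} (hf : HasParity p f) (hg : HasParity q g) :
    delta e (p + q + 1) (der e (q + 1) g f) =
      der e (q + 1) g (delta e p f) + (-1 : k) ^ (p + 1) • der e q (delta e q g) f
      + (-1 : k) ^ p • (f * g - (-1 : k) ^ (p * q) • (g * f)) := by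
  rw [delta_apply, derMul_der e hg, delta_apply e p f]
  simp only [map_add, map_sub, map_smul, der_mul, der_univElt, hf (q + 1),
    hasParity_univElt e (q + 1), mul_one, mul_smul_comm]
  rcases neg_one_pow_eq_or k p with hp | hp <;> rcases neg_one_pow_eq_or k q with hq | hq <;>
    simp only [pow_add, pow_mul, add_mul, mul_comm q p, hp, hq, one_mul, one_pow, pow_one] <;>
    module

/-- The cup commutators produced by `delta_der` for the two insertions cancel in the
antisymmetrization. -/
theorem delta_bracket {p q : ℕ} {f g : NCPoly k A ι} (hf : HasParity p f) (hg : HasParity q g) :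
    delta e (p + q + 1) (bracket e p q f g) = bracket e (p + 1) q (delta e p f) g
      + (-1 : k) ^ (p + 1) • bracket e p (q + 1) f (delta e q g) := by
  rw [bracket, map_sub, map_smul, delta_der e hf hg,
    delta_congr e (show Even (p + q + 1 + (q + p + 1)) by grind), delta_der e hg hf, bracket,
    bracket, der_congr e (show Even (p + 1 + 1 + p) by grind),
    der_congr e (show Even (q + 1 + 1 + q) by grind)]
  rcases neg_one_pow_eq_or k p with hp | hp <;> rcases neg_one_pow_eq_or k q with hq | hq <;>
    simp only [pow_add, pow_mul, add_mul, mul_comm q p, hp, hq, one_mul, one_pow, pow_one] <;>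
    module

theorem derMul_of_delta {p : ℕ} {f : NCPoly k A ι} (h : delta e p f = 0) :
    derMul e f = f * univElt e - (-1 : k) ^ p • (univElt e * f) := by
  rw [delta_apply] at h
  rcases neg_one_pow_eq_or k p with hp | hp <;> rw [hp] at h ⊢
  · linear_combination (norm := module) (1 : k) • h
  · linear_combination (norm := module) (-1 : k) • h

theorem derMul_der_of_delta {q : ℕ} {g : NCPoly k A ι} (hg : HasParity q g)
    (hδ : delta e q g = 0) (u : NCPoly k A ι) :
    derMul e (der e (q + 1) g u) = (-1 : k) ^ (q + 1) • der e (q + 1) g (derMul e u) := by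
  simp [derMul_der e hg, hδ]

theorem derMul_sgn (s : ℕ) (u : NCPoly k A ι) :
    sgn s (derMul e u) = (-1 : k) ^ s • derMul e (sgn s u) := by
  rw [derMul, sgn_der e (hasParity_univElt_sq e), neg_one_pow_congr]
  grind

/-- The product substitution splits a letter into two adjacent ones. Filling these with f and g in
order amounts to substituting f * g for the original letter; all other terms cancel because f and g
are cocycles. -/
theorem derMul_der₂ {p q : ℕ} {f g : NCPoly k A ι} (hf : HasParity p f) (hg : HasParity q g)
    (hδf : delta e p f = 0) (hδg : delta e q g = 0) (u : NCPoly k A ι) :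
    derMul e (der₂ e (p + 1) f (q + 1) g u)
      - (-1 : k) ^ (p + q) • der₂ e (p + 1) f (q + 1) g (derMul e u) =
    -(-1 : k) ^ (p + q) • der e (p + q + 1) (f * g) u := by
  rw [← LinearMap.smul_apply (-(-1 : k) ^ (p + q)), ← der_smul]
  have key := der_eq_of_twisted e (p + q + 1) (-(-1 : k) ^ (p + q) • (f * g))
    (derMul e ∘ₗ der₂ e (p + 1) f (q + 1) g
      - (-1 : k) ^ (p + q) • der₂ e (p + 1) f (q + 1) g ∘ₗ derMul e)
    (fun u v => ?_) (fun a => by simp [derMul]) fun c => ?_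
  · exact LinearMap.congr_fun key u
  · have hd (u v : NCPoly k A ι) :
        derMul e (u * v) = derMul e u * sgn 1 v + u * derMul e v := der_mul e 1 _ u v
    simp only [LinearMap.sub_apply, LinearMap.smul_apply, LinearMap.comp_apply, der₂_mul, hd,
      map_add, map_smul, sgn_sgn, sgn_der₂ e hf hg, sgn_der e hg, derMul_sgn,
      derMul_der_of_delta e hf hδf, derMul_der_of_delta e hg hδg]
    rw [sgn_congr (show Even (1 + (q + 1 + (p + 1)) + (p + q + 1)) by grind),
      sgn_congr (show Even (q + 1 + (p + 1) + 1 + (p + q + 1)) by grind),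
      sgn_congr (show Even (q + 1 + (p + 1) + (p + q)) by grind), add_comm 1 (p + 1)]
    rcases neg_one_pow_eq_or k p with hp | hp <;> rcases neg_one_pow_eq_or k q with hq | hq <;>
      simp only [pow_add, hp, hq, pow_one, one_mul, mul_add, smul_mul_assoc,
        mul_smul_comm, mul_sub, sub_mul] <;>
      module
  -- On x_c only the second composite survives: its two letters come from the squared universal
  -- element, and filling them gives f * g up to sign.
  · rw [LinearMap.sub_apply, LinearMap.comp_apply, der₂_genX, LinearMap.smul_apply,
      LinearMap.comp_apply, derMul, der_genX, der₂_scalarComponent, der₂_mul, der₂_univElt,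
      hasParity_univElt, map_smul, der_univElt, der_univElt, map_zero, zero_sub, mul_zero,
      zero_mul, zero_add, add_zero, mul_one, mul_smul_comm, smul_smul, ← mul_pow, neg_one_mul,
      neg_neg, one_pow, one_smul, map_smul]
    module

/-- The right Leibniz identity up to the coboundary of a double insertion. -/
theorem der_mul_homotopy {p q r : ℕ} {f g h : NCPoly k A ι} (hf : HasParity p f)
    (hg : HasParity q g) (hh : HasParity r h) (hδf : delta e p f = 0) (hδg : delta e q g = 0)
    (hδh : delta e r h = 0) :
    der e (p + q + 1) (f * g) h =
      -(-1 : k) ^ r • delta e (r + p + q) (der₂ e (p + 1) f (q + 1) g h)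
      + der e (p + 1) f h * g + (-1 : k) ^ (p * (r + 1)) • (f * der e (q + 1) g h) := by
  -- Since δh = 0, `derMul e h` is a combination of h multiplied on either side by the universal
  -- element. The double insertion into these products yields the two Leibniz terms when one
  -- insertion hits the universal letter, and otherwise the outer terms of the coboundary.
  have h1 := derMul_der₂ e hf hg hδf hδg h
  rw [derMul_of_delta e hδh, map_sub, map_smul, der₂_mul, der₂_mul, der₂_univElt, der_univElt,
    hasParity_univElt e (p + 1), map_smul, der_univElt, hasParity_univElt e (q + 1 + (p + 1)),
    hh (p + 1), map_smul] at h1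
  rw [delta_apply]
  have h2 : der e (p + q + 1) (f * g) h = -(-1 : k) ^ (p + q) • (-(-1 : k) ^ (p + q) •
      der e (p + q + 1) (f * g) h) := by
    rw [smul_smul, neg_mul_neg, ← mul_pow]; simp
  rw [h2, ← h1]
  rcases neg_one_pow_eq_or k p with hp | hp <;> rcases neg_one_pow_eq_or k q with hq | hq <;>
    rcases neg_one_pow_eq_or k r with hr | hr <;>
    simp only [pow_add, pow_mul, mul_one, add_mul, mul_add, hp, hq, hr, one_mul, one_pow, pow_one,
      mul_neg, neg_neg, mul_smul_comm, zero_mul, mul_zero] <;>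
    module

end Delta

/-! ### Homogeneous polynomials and their coefficients -/

section WordSum

variable {k : Type u} [Field k] {A : Type v} [Ring A] [Algebra k A] {ι : Type w}

variable (k) in
/-- The operation of the free algebra on functions of words, by prepending letters. -/
noncomputable def prepend (c : ι) : Module.End k (List ι → k) where
  toFun φ w := open Classical in if w.head? = some c then φ w.tail else 0
  map_add' φ χ := by
    ext w; by_cases h : w.head? = some c <;> simp [h]
  map_smul' r φ := by
    ext w; by_cases h : w.head? = some c <;> simp [h]

/-- The coefficient of a word. -/
noncomputable def wordCoeff (w : List ι) : NCPoly k A ι →ₗ[k] A :=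
  (TensorProduct.rid k A).toLinearMap ∘ₗ
    (LinearMap.proj w ∘ₗ LinearMap.applyₗ (fun v : List ι => if v.isEmpty then (1 : k) else 0) ∘ₗ
      (FreeAlgebra.lift k (prepend k)).toLinearMap).lTensor A

/-- In the action by prepending, x_v sends the indicator function of the empty word to that of v.
Evaluation at w therefore reads off a coefficient. -/
theorem wordCoeff_cons_genX_mul [DecidableEq ι] (c d : ι) (w : List ι) (u : NCPoly k A ι) :
    wordCoeff (d :: w) (genX k A c * u) = if d = c then wordCoeff w u else 0 := by
  induction u using TensorProduct.induction_on with
  | zero => simp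
  | tmul a z => by_cases h : d = c <;> simp [wordCoeff, genX, prepend, h]
  | add x y hx hy => by_cases h : d = c <;> simp_all [mul_add]

variable [Fintype ι]

variable (k) in
/-- The polynomial `∑ F w ⊗ x_w`, where `w` ranges over the words of length `n`. -/
noncomputable def wordSum : ℕ → (List ι → A) → NCPoly k A ι
  | 0, F => F [] ⊗ₜ 1
  | n + 1, F => ∑ c, genX k A c * wordSum n fun w => F (c :: w)

theorem wordSum_congr {n : ℕ} {F G : List ι → A} (h : ∀ w, w.length = n → F w = G w) :
    wordSum k n F = wordSum k n G := by
  induction n generalizing F G with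
  | zero => simp [wordSum, h [] rfl]
  | succ n ih =>
    exact Finset.sum_congr rfl fun c _ => by rw [ih fun w hw => h (c :: w) (by simp [hw])]

theorem wordSum_add (n : ℕ) (F G : List ι → A) :
    wordSum k n (fun w => F w + G w) = wordSum k n F + wordSum k n G := by
  induction n generalizing F G with
  | zero => simp [wordSum, TensorProduct.add_tmul]
  | succ n ih => simp [wordSum, ih, mul_add, Finset.sum_add_distrib]

theorem wordSum_smul (n : ℕ) (r : k) (F : List ι → A) :
    wordSum k n (fun w => r • F w) = r • wordSum k n F := by
  induction n generalizing F with
  | zero => simp [wordSum, TensorProduct.smul_tmul']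
  | succ n ih => simp only [wordSum, ih, mul_smul_comm, Finset.smul_sum]

theorem wordSum_zero (n : ℕ) : wordSum k n (fun _ : List ι => (0 : A)) = 0 := by
  simpa using wordSum_smul n (0 : k) (fun _ : List ι => (0 : A))

theorem wordSum_sum {κ : Type*} (n : ℕ) (s : Finset κ) (F : κ → List ι → A) :
    wordSum k n (fun w => ∑ i ∈ s, F i w) = ∑ i ∈ s, wordSum k n (F i) := by
  classical
  induction s using Finset.induction_on with
  | empty => simp [wordSum_zero]
  | insert a s ha ih => simp [Finset.sum_insert ha, wordSum_add, ih]

theorem coeff_mul_wordSum (n : ℕ) (a : A) (F : List ι → A) :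
    (a ⊗ₜ 1 : NCPoly k A ι) * wordSum k n F = wordSum k n fun w => a * F w := by
  induction n generalizing F with
  | zero => simp [wordSum]
  | succ n ih =>
    simp_rw [wordSum, Finset.mul_sum, ← ih, ← mul_assoc]
    simp [genX]

theorem wordSum_mul_wordSum (p q : ℕ) (F G : List ι → A) :
    wordSum k p F * wordSum k q G =
      wordSum k (p + q) fun w => F (w.take p) * G (w.drop p) := by
  induction p generalizing F with
  | zero => simp [wordSum, coeff_mul_wordSum]
  | succ p ih =>
    rw [add_right_comm]
    simp [wordSum, Finset.sum_mul, mul_assoc, ih]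

theorem genX_mul_wordSum (c : ι) (n : ℕ) (F : List ι → A) [DecidableEq ι] :
    genX k A c * wordSum k n F =
      wordSum k (n + 1) fun w => if w.head? = some c then F w.tail else 0 := by
  rw [wordSum, Finset.sum_eq_single c]
  · simp
  · intro b _ hb
    simp [hb, wordSum_zero]
  · simp

theorem hasParity_wordSum (n : ℕ) (F : List ι → A) : HasParity n (wordSum k n F) := by
  induction n generalizing F with
  | zero => intro t; simp [wordSum]
  | succ n ih =>
    intro t
    simp only [wordSum, map_sum, map_mul, ih _ t, sgn_genX, smul_mul_smul_comm, Finset.smul_sum,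
      ← pow_add, mul_add, mul_one, add_comm t]

theorem wordCoeff_wordSum (n : ℕ) (F : List ι → A) (w : List ι) (hw : w.length = n) :
    wordCoeff w (wordSum k n F) = F w := by
  classical
  induction n generalizing F w with
  | zero =>
    obtain rfl := List.length_eq_zero_iff.mp hw
    simp [wordSum, wordCoeff]
  | succ n ih =>
    obtain ⟨d, w, rfl⟩ := List.exists_cons_of_length_eq_add_one hw
    simp only [wordSum, map_sum, wordCoeff_cons_genX_mul]
    rw [Finset.sum_ite_eq, if_pos (Finset.mem_univ _), ih _ w (by simpa using hw)]

variable (e : Module.Basis ι k A)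

theorem scalarComponent_wordSum (c : ι) (n : ℕ) (F : List ι → A) :
    scalarComponent e c (wordSum k n F) =
      wordSum k n fun w => e.coord c (F w) • (1 : A) := by
  have hmul (d : ι) (u : NCPoly k A ι) :
      scalarComponent e c (genX k A d * u) = genX k A d * scalarComponent e c u := by
    induction u using TensorProduct.induction_on with
    | zero => simp
    | tmul a z => simp only [scalarComponent, LinearMap.comp_apply, component_tmul, genX,
        Algebra.TensorProduct.tmul_mul_tmul, one_mul, map_smul, TensorProduct.mk_apply,
        mul_smul_comm]
    | add x y hx hy => simp only [mul_add, map_add, hx, hy]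
  induction n generalizing F with
  | zero => simp [wordSum, scalarComponent, component_tmul, TensorProduct.smul_tmul']
  | succ n ih => simp only [wordSum, map_sum, hmul, ih]

/-- The window of q letters starting at i is fed to G, and the p - 1 - i remaining letters of F to
its right give the sign. The induction separates substitution in the first letter from substitution
further on. -/
theorem der_wordSum (s p q n : ℕ) (hn : n + 1 = p + q) (F G : List ι → A) :
    der e s (wordSum k q G) (wordSum k p F) =
      wordSum k n fun w => ∑ i ∈ Finset.range p, (-1 : k) ^ (s * (p - 1 - i)) •
        ∑ c, e.coord c (G ((w.drop i).take q)) • F (w.take i ++ c :: w.drop (i + q)) := by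
  induction p generalizing n F with
  | zero => simp [wordSum, wordSum_zero]
  | succ p ih =>
    simp only [Finset.sum_range_succ', wordSum_add, wordSum_smul, wordSum_sum]
    have h0 : der e s (wordSum k q G) (wordSum k (p + 1) F) =
        ∑ c, genX k A c * der e s (wordSum k q G) (wordSum k p fun w => F (c :: w)) +
          (-1 : k) ^ (s * p) • ∑ c, scalarComponent e c (wordSum k q G) *
            wordSum k p fun w => F (c :: w) := by
      rw [wordSum, map_sum, Finset.smul_sum, ← Finset.sum_add_distrib]
      refine Finset.sum_congr rfl fun c _ => ?_
      rw [der_mul, der_genX, hasParity_wordSum, mul_smul_comm, add_comm]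
    rw [h0]
    congr 1
    · rcases p with _ | p
      · simp [wordSum]
      · obtain ⟨n, rfl⟩ : ∃ n', n = n' + 1 := ⟨n - 1, by omega⟩
        simp only [ih n (by omega), ← wordSum_smul, ← wordSum_sum]
        conv_rhs => rw [wordSum]
        refine Finset.sum_congr rfl fun c _ => ?_
        congr 2
        funext w
        refine Finset.sum_congr rfl fun i _ => ?_
        simp only [add_tsub_cancel_right, List.drop_succ_cons, List.take_succ_cons,
          List.cons_append, add_right_comm i 1 q]
        rw [show p + 1 - (i + 1) = p - i by omega]
    · simp only [add_tsub_cancel_right, tsub_zero, scalarComponent_wordSum, wordSum_mul_wordSum]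
      rw [show n = q + p by omega]
      simp

/-- Only homogeneity matters here: a polynomial of this form corresponds to a functional on chains,
so the Leibniz homotopy can be transposed back. -/
theorem der₂_wordSum (s t p q r n : ℕ) (hn : n + 2 = r + p + q) (F G H : List ι → A) :
    ∃ K : List ι → A,
      der₂ e s (wordSum k p F) t (wordSum k q G) (wordSum k r H) = wordSum k n K := by
  classical
  have h0 (H : List ι → A) : der₂ e s (wordSum k p F) t (wordSum k q G) (wordSum k 0 H) = 0 :=
    der₂_coeff ..
  have hstep (r : ℕ) (H : List ι → A) :
      der₂ e s (wordSum k p F) t (wordSum k q G) (wordSum k (r + 1) H) =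
      ∑ c, (genX k A c * der₂ e s (wordSum k p F) t (wordSum k q G)
          (wordSum k r fun w => H (c :: w)) +
        (-1 : k) ^ s • (scalarComponent e c (wordSum k p F) * ((-1 : k) ^ (s * r) •
          der e t (wordSum k q G) (wordSum k r fun w => H (c :: w))))) := by
    rw [wordSum, map_sum]
    refine Finset.sum_congr rfl fun c _ => ?_
    rw [der₂_mul, der₂_genX, der_genX, zero_mul, add_zero, hasParity_wordSum, map_smul]
  have h1 (H : List ι → A) : der₂ e s (wordSum k p F) t (wordSum k q G) (wordSum k 1 H) = 0 := by
    rw [hstep]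
    simp [wordSum]
  induction r generalizing n H with
  | zero => exact ⟨fun _ => 0, by rw [h0, wordSum_zero]⟩
  | succ r ih =>
    have hA (c : ι) : ∃ K : List ι → A, genX k A c * der₂ e s (wordSum k p F) t (wordSum k q G)
        (wordSum k r fun w => H (c :: w)) = wordSum k n K := by
      rcases r with _ | r
      · exact ⟨fun _ => 0, by rw [h0, mul_zero, wordSum_zero]⟩
      · rcases n with _ | n
        · obtain rfl : r = 0 := by omega
          exact ⟨fun _ => 0, by rw [h1, mul_zero, wordSum_zero]⟩
        · obtain ⟨K, hK⟩ := ih n (by omega) fun w => H (c :: w)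
          exact ⟨_, by rw [hK, genX_mul_wordSum]⟩
    have hB (c : ι) : ∃ K : List ι → A, scalarComponent e c (wordSum k p F) *
        ((-1 : k) ^ (s * r) • der e t (wordSum k q G) (wordSum k r fun w => H (c :: w))) =
          wordSum k n K := by
      rcases r with _ | r
      · exact ⟨fun _ => 0, by rw [wordSum, der_coeff, smul_zero, mul_zero, wordSum_zero]⟩
      · rw [der_wordSum e t (r + 1) q (r + q) (by omega), scalarComponent_wordSum,
          ← wordSum_smul, wordSum_mul_wordSum, show p + (r + q) = n by omega]
        exact ⟨_, rfl⟩
    choose K hK using hA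
    choose K' hK' using hB
    refine ⟨fun w => ∑ c, (K c w + (-1 : k) ^ s • K' c w), ?_⟩
    simp only [hstep, hK, hK', wordSum_sum, wordSum_add, wordSum_smul]

end WordSum

/-! ### Dual bases of a Frobenius algebra -/

section DualBases

variable {k : Type u} [Field k] {A : Type v} [Ring A] [Algebra k A] {ε : A →ₗ[k] k}

/-- A space isomorphic to its dual is finite-dimensional, and pulling a dual basis back along a ↦
ε(a ·) gives the second basis. -/
theorem IsFrobenius.exists_dualBases (hε : IsFrobenius ε) :
    ∃ (m : ℕ) (e e' : Module.Basis (Fin m) k A), IsDualBases ε e e' := by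
  let Φ : A ≃ₗ[k] Module.Dual k A := LinearEquiv.ofBijective
    { toFun := fun a => ε ∘ₗ LinearMap.mulLeft k a
      map_add' := fun a b => by ext; simp [add_mul]
      map_smul' := fun r a => by ext; simp } hε
  have : FiniteDimensional k A := Basis.linearEquiv_dual_iff_finiteDimensional.mp ⟨Φ⟩
  let e := Module.finBasis k A
  refine ⟨_, e, e.dualBasis.map Φ.symm, fun i j => ?_⟩
  have h : Φ (e.dualBasis.map Φ.symm j) (e i) = if i = j then 1 else 0 := by
    simp [Finsupp.single_apply]
  exact h

variable {m : ℕ} {e e' : Module.Basis (Fin m) k A}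

theorem IsDualBases.coord (h : IsDualBases ε e e') (j : Fin m) (y : A) :
    ε (e' j * y) = e.repr y j := by
  have : ε ∘ₗ LinearMap.mulLeft k (e' j) = e.coord j := by
    refine e.ext fun i => ?_
    simp [h i j, Finsupp.single_apply]
  exact LinearMap.congr_fun this y

theorem IsDualBases.sum_left (h : IsDualBases ε e e') (y : A) :
    ∑ j, ε (e' j * y) • e j = y := by
  simp_rw [h.coord, e.sum_repr]

theorem IsDualBases.sum_right (h : IsDualBases ε e e') (y : A) :
    ∑ j, ε (y * e j) • e' j = y := by
  have : ∑ j, LinearMap.smulRight (ε ∘ₗ LinearMap.mulRight k (e j)) (e' j) =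
      (LinearMap.id : A →ₗ[k] A) := by
    refine e'.ext fun i => ?_
    simp [h _ i]
  simpa using LinearMap.congr_fun this y

/-- The Casimir element does not depend on the dual bases. -/
theorem IsDualBases.sum_bilin {m₁ : ℕ} {f f' : Module.Basis (Fin m₁) k A}
    (h : IsDualBases ε e e') (h₁ : IsDualBases ε f f') {M : Type*} [AddCommGroup M] [Module k M]
    (G : A →ₗ[k] A →ₗ[k] M) : ∑ j, G (f j) (f' j) = ∑ j, G (e j) (e' j) := by
  calc ∑ i, G (f i) (f' i) = ∑ i, G (∑ j, ε (e' j * f i) • e j) (f' i) := by simp_rw [h.sum_left]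
    _ = ∑ j, G (e j) (∑ i, ε (e' j * f i) • f' i) := by
      simp only [map_sum, map_smul, LinearMap.sum_apply, LinearMap.smul_apply]
      exact Finset.sum_comm
    _ = _ := by simp_rw [h₁.sum_right]

end DualBases

section Sequences

variable {A : Type v}

/-- The left factor `(a_0, …, a_{i-1}, b, a_{i+q}, …)` of a partial decomposition. -/
def outerSeq (i q : ℕ) (b : A) (a : ℕ → A) : ℕ → A :=
  fun l => if l < i then a l else if l = i then b else a (l + q - 1)

/-- The right factor `(b, a_i, …)` of a partial decomposition. -/
def innerSeq (i : ℕ) (b : A) (a : ℕ → A) : ℕ → A :=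
  fun l => if l = 0 then b else a (i + l - 1)

theorem innerSeq_zero_eq {a : ℕ → A} {y : A} (h : y = a 0) : innerSeq 1 y a = a := by
  funext l
  rcases l with _ | l
  · exact h
  · simp [innerSeq]

theorem outerSeq_one_eq {i : ℕ} {a : ℕ → A} {y : A} (h : y = a i) : outerSeq i 1 y a = a := by
  funext l
  simp only [outerSeq]
  split_ifs with h1 h2
  · rfl
  · rw [h, h2]
  · rfl

end Sequences

/-! ### The cooperad of Hochschild chains -/

section Chains

variable {k : Type u} [Field k] {A : Type v} [Ring A] [Algebra k A]

theorem chain_congr {n : ℕ} {a b : ℕ → A} (h : ∀ l ≤ n, a l = b l) :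
    chain k n a = chain k n b := by
  unfold chain
  congr 1
  funext l
  exact h l (by omega)

/-- Extend a tuple by zero. -/
def extTuple {n : ℕ} (x : Fin (n + 1) → A) : ℕ → A := fun l => if h : l < n + 1 then x ⟨l, h⟩ else 0

theorem extTuple_val {n : ℕ} (x : Fin (n + 1) → A) (l : Fin (n + 1)) : extTuple x l = x l := by
  exact dif_pos l.2

theorem extTuple_restrict {n : ℕ} (a : ℕ → A) {l : ℕ} (h : l ≤ n) :
    extTuple (fun l : Fin (n + 1) => a l) l = a l := by
  simp [extTuple, Nat.lt_succ_of_le h]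

theorem chain_extTuple {n : ℕ} (x : Fin (n + 1) → A) :
    chain k n (extTuple x) = PiTensorProduct.tprod k x := by
  simp [chain, extTuple_val]

theorem extTuple_update {n : ℕ} (x : Fin (n + 1) → A) (j : Fin (n + 1)) (y : A) :
    extTuple (Function.update x j y) = Function.update (extTuple x) j y := by
  funext l
  simp only [extTuple, Function.update_apply, Fin.ext_iff]
  grind

/-- Every pure tensor is an elementary chain, after extending its tuple by zero to a sequence. -/
theorem hom_ext_chain {n : ℕ} {M : Type*} [AddCommMonoid M] [Module k M]
    {f g : HochschildChain k A n →ₗ[k] M} (h : ∀ a : ℕ → A, f (chain k n a) = g (chain k n a)) :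
    f = g := by
  refine PiTensorProduct.ext (MultilinearMap.ext fun x => ?_)
  simpa [chain_extTuple] using h (extTuple x)

/-- The chain `(a_0, …, a_n)`, as a linear function of the entry at `i`. -/
noncomputable def slot (n i : ℕ) (hi : i ≤ n) (a : ℕ → A) : A →ₗ[k] HochschildChain k A n :=
  (PiTensorProduct.tprod k).toLinearMap (fun l : Fin (n + 1) => a l) ⟨i, by omega⟩

theorem slot_apply (n i : ℕ) (hi : i ≤ n) (a : ℕ → A) (b : A) :
    slot (k := k) n i hi a b = chain k n (Function.update a i b) := by
  rw [slot, MultilinearMap.toLinearMap_apply, chain]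
  congr 1
  funext l
  simp only [Function.update_apply, Fin.ext_iff]

theorem outerSeq_eq_update (i q : ℕ) (b : A) (a : ℕ → A) :
    outerSeq i q b a = Function.update (outerSeq i q 0 a) i b := by
  funext l; simp only [outerSeq, Function.update_apply]; grind

theorem innerSeq_eq_update (i : ℕ) (b : A) (a : ℕ → A) :
    innerSeq i b a = Function.update (innerSeq i 0 a) 0 b := by
  funext l; simp only [innerSeq, Function.update_apply]; grind

variable (k) in
/-- `b ⊗ b' ↦ (a_0, …, a_{i-1}, b, a_{i+q}, …) ⊗ (b', a_i, …, a_{i+q-1})` as a bilinear map. -/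
noncomputable def splitBilin (p q i : ℕ) (hi : i ≤ p) (a : ℕ → A) :
    A →ₗ[k] A →ₗ[k] HochschildChain k A p ⊗[k] HochschildChain k A q :=
  (TensorProduct.mk k _ _).compl₁₂ (slot p i hi (outerSeq i q 0 a))
    (slot q 0 (Nat.zero_le q) (innerSeq i 0 a))

theorem splitBilin_apply (p q i : ℕ) (hi : i ≤ p) (a : ℕ → A) (b b' : A) :
    splitBilin k p q i hi a b b' =
      chain k p (outerSeq i q b a) ⊗ₜ chain k q (innerSeq i b' a) := by
  rw [splitBilin, LinearMap.compl₁₂_apply, slot_apply, slot_apply, ← outerSeq_eq_update,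
    ← innerSeq_eq_update, TensorProduct.mk_apply]

variable (k) in
/-- For fixed new entries `b`, `b'`, the split chains depend on the old entries multilinearly. -/
noncomputable def splitMultilin (n p q i : ℕ) (h : p + q = n + 1 ∧ 1 ≤ i ∧ i ≤ p) (b b' : A) :
    MultilinearMap k (fun _ : Fin (n + 1) => A)
      (HochschildChain k A p ⊗[k] HochschildChain k A q) :=
  -- Each old entry lands in exactly one place of exactly one factor. The three cases are entries
  -- before, inside and after the block cut out by the right factor.
  have key (x : Fin (n + 1) → A) (j : Fin (n + 1)) :
      ∃ L : A →ₗ[k] HochschildChain k A p ⊗[k] HochschildChain k A q, ∀ y,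
        chain k p (outerSeq i q b (extTuple (Function.update x j y))) ⊗ₜ
          chain k q (innerSeq i b' (extTuple (Function.update x j y))) = L y := by
    simp_rw [extTuple_update]
    by_cases h1 : (j : ℕ) < i
    · refine ⟨(TensorProduct.mk k _ _).flip (chain k q (innerSeq i b' (extTuple x))) ∘ₗ
        slot p j (by omega) (outerSeq i q b (extTuple x)), fun y => ?_⟩
      rw [LinearMap.comp_apply, slot_apply, LinearMap.flip_apply, TensorProduct.mk_apply]
      congr 1 <;> refine chain_congr fun l hl => ?_ <;>
        simp only [outerSeq, innerSeq, Function.update_apply] <;> grind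
    · by_cases h2 : (j : ℕ) < i + q
      · refine ⟨TensorProduct.mk k _ _ (chain k p (outerSeq i q b (extTuple x))) ∘ₗ
          slot q (j + 1 - i) (by omega) (innerSeq i b' (extTuple x)), fun y => ?_⟩
        rw [LinearMap.comp_apply, slot_apply, TensorProduct.mk_apply]
        congr 1 <;> refine chain_congr fun l hl => ?_ <;>
          simp only [outerSeq, innerSeq, Function.update_apply] <;> grind
      · refine ⟨(TensorProduct.mk k _ _).flip (chain k q (innerSeq i b' (extTuple x))) ∘ₗ
          slot p (j + 1 - q) (by omega) (outerSeq i q b (extTuple x)), fun y => ?_⟩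
        rw [LinearMap.comp_apply, slot_apply, LinearMap.flip_apply, TensorProduct.mk_apply]
        congr 1 <;> refine chain_congr fun l hl => ?_ <;>
          simp only [outerSeq, innerSeq, Function.update_apply] <;> grind
  { toFun := fun x => chain k p (outerSeq i q b (extTuple x)) ⊗ₜ
      chain k q (innerSeq i b' (extTuple x))
    map_update_add' := fun {inst} x j y z => by
      obtain rfl : inst = instDecidableEqFin (n + 1) := Subsingleton.elim _ _
      obtain ⟨L, hL⟩ := key x j
      simp [hL]
    map_update_smul' := fun {inst} x j r y => by
      obtain rfl : inst = instDecidableEqFin (n + 1) := Subsingleton.elim _ _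
      obtain ⟨L, hL⟩ := key x j
      simp [hL] }

variable {m : ℕ} (e e' : Module.Basis (Fin m) k A)

/-- The partial decompositions of Hochschild chains. -/
noncomputable def decompose (n p q i : ℕ) :
    HochschildChain k A n →ₗ[k] HochschildChain k A p ⊗[k] HochschildChain k A q :=
  if h : p + q = n + 1 ∧ 1 ≤ i ∧ i ≤ p then
    ∑ j, PiTensorProduct.lift (splitMultilin k n p q i h (e j) (e' j)) else 0

theorem decompose_chain {n p q i : ℕ} (h : p + q = n + 1) (h1 : 1 ≤ i) (h2 : i ≤ p) (a : ℕ → A) :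
    decompose e e' n p q i (chain k n a) =
      ∑ j, chain k p (outerSeq i q (e j) a) ⊗ₜ chain k q (innerSeq i (e' j) a) := by
  rw [decompose, dif_pos ⟨h, h1, h2⟩, LinearMap.sum_apply]
  refine Finset.sum_congr rfl fun j _ => ?_
  rw [chain, PiTensorProduct.lift.tprod]
  change chain k p _ ⊗ₜ chain k q _ = _
  congr 1 <;> refine chain_congr fun l hl => ?_ <;> simp only [outerSeq, innerSeq]
  · split_ifs
    · exact extTuple_restrict a (by omega)
    · rfl
    · exact extTuple_restrict a (by omega)
  · split_ifs
    · rfl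
    · exact extTuple_restrict a (by omega)

variable (ε : A →ₗ[k] k)

/-- The maps `(a_0, …, a_n) ↦ ε (a_0 ⋯ a_n)`. -/
noncomputable def augProd (n : ℕ) : HochschildChain k A n →ₗ[k] k :=
  ε ∘ₗ PiTensorProduct.lift (MultilinearMap.mkPiAlgebraFin k (n + 1) A)

theorem augProd_chain (n : ℕ) (a : ℕ → A) :
    augProd ε n (chain k n a) = ε (List.ofFn fun l : Fin (n + 1) => a l).prod := by
  simp [augProd, chain]

/-- The product `a_s ⋯ a_{s+n-1}`. -/
def seqProd (a : ℕ → A) (s n : ℕ) : A := ((List.range' s n).map a).prod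

theorem augProd_chain' (n : ℕ) (a : ℕ → A) :
    augProd ε n (chain k n a) = ε (seqProd a 0 (n + 1)) := by
  rw [augProd_chain, seqProd, ← List.range_eq_range', List.ofFn_eq_map,
    ← List.map_coe_finRange_eq_range,
    List.map_map]
  rfl

theorem seqProd_add (a : ℕ → A) (s n n' : ℕ) :
    seqProd a s (n + n') = seqProd a s n * seqProd a (s + n) n' := by
  rw [seqProd, seqProd, seqProd, ← List.prod_append, ← List.map_append, List.range'_append_1]

theorem seqProd_succ (a : ℕ → A) (s n : ℕ) :
    seqProd a s (n + 1) = a s * seqProd a (s + 1) n := by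
  simp [seqProd, List.range'_succ]

theorem seqProd_congr {a b : ℕ → A} {s s' n : ℕ} (h : ∀ l < n, a (s + l) = b (s' + l)) :
    seqProd a s n = seqProd b s' n := by
  induction n generalizing s s' with
  | zero => simp [seqProd]
  | succ n ih =>
    rw [seqProd_succ, seqProd_succ, show a s = b s' by simpa using h 0 (by omega),
      ih (s' := s' + 1) fun l hl => by
        have := h (l + 1) (by omega); simpa [add_assoc, add_comm 1] using this]

variable {ε e e'}

theorem sum_smul_chain_update {n i : ℕ} (hi : i ≤ n) (a : ℕ → A) (c : Fin m → k) (b : Fin m → A) :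
    ∑ j, c j • chain k n (Function.update a i (b j)) =
      chain k n (Function.update a i (∑ j, c j • b j)) := by
  simp only [← slot_apply (k := k) n i hi, map_sum, map_smul]

theorem IsDualBases.sum_outer (h : IsDualBases ε e e') {p q i : ℕ} (hi : i ≤ p) (a : ℕ → A)
    (y : A) : ∑ j, ε (e' j * y) • chain k p (outerSeq i q (e j) a) =
      chain k p (outerSeq i q y a) := by
  simpa only [← outerSeq_eq_update, h.sum_left] using
    sum_smul_chain_update hi (outerSeq i q 0 a) (fun j => ε (e' j * y)) fun j => e j

theorem IsDualBases.sum_inner (h : IsDualBases ε e e') {q i : ℕ} (a : ℕ → A)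
    (y : A) : ∑ j, ε (y * e j) • chain k q (innerSeq i (e' j) a) =
      chain k q (innerSeq i y a) := by
  simpa only [← innerSeq_eq_update, h.sum_right] using
    sum_smul_chain_update q.zero_le (innerSeq i 0 a) (fun j => ε (y * e j)) fun j => e' j

/-- The cooperad of Hochschild chains. -/
noncomputable def chainCooperad (h : IsDualBases ε e e') : Cooperad k (HochschildChain k A) where
  counit := augProd ε 1
  decomp := decompose e e'
  decomp_eq_zero n p q i hn := dif_neg hn
  counit_left n := by
    refine hom_ext_chain fun a => ?_
    simp only [LinearMap.comp_apply, decompose_chain e e' (add_comm 1 n) le_rfl le_rfl, map_sum,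
      LinearMap.rTensor_tmul, LinearEquiv.coe_coe, TensorProduct.lid_tmul, augProd_chain',
      LinearMap.id_apply]
    -- The counit of the left factor is ε(a_0 e_j), and these numbers are the coefficients of a_0 in
    -- the basis e'.
    have h1 (j : Fin m) : seqProd (outerSeq 1 n (e j) a) 0 (1 + 1) = a 0 * e j := by
      rw [seqProd_succ, seqProd_succ]; simp [seqProd, outerSeq]
    simp only [h1, h.sum_inner]
    rw [innerSeq_zero_eq rfl]
  counit_right n i hi hi' := by
    refine hom_ext_chain fun a => ?_
    simp only [LinearMap.comp_apply, decompose_chain e e' rfl hi hi', map_sum,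
      LinearMap.lTensor_tmul, LinearEquiv.coe_coe, TensorProduct.rid_tmul, augProd_chain',
      LinearMap.id_apply]
    have h1 (j : Fin m) : seqProd (innerSeq i (e' j) a) 0 (1 + 1) = e' j * a i := by
      rw [seqProd_succ, seqProd_succ]; simp [seqProd, innerSeq]
    simp only [h1, h.sum_outer hi']
    rw [outerSeq_one_eq rfl]
  coassoc_left n p q r i j hn h1 h2 h3 h4 h5 := by
    refine hom_ext_chain fun a => ?_
    simp only [LinearMap.comp_apply, decompose_chain e e' (show p + q - 1 + r = n + 1 by omega) h3
        (show j ≤ p + q - 1 by omega),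
      decompose_chain e e' (show p + q = p + q - 1 + 1 by omega) h1 h2, map_sum,
      decompose_chain e e' (show p + r - 1 + q = n + 1 by omega) h1
        (show i ≤ p + r - 1 by omega),
      decompose_chain e e' (show p + r = p + r - 1 + 1 by omega)
        (show 1 ≤ j + 1 - q by omega) (show j + 1 - q ≤ p by omega),
      LinearMap.rTensor_tmul, LinearEquiv.coe_coe, TensorProduct.sum_tmul,
      TensorProduct.rightComm_tmul]
    -- The two Casimir insertions are independent, so both sides are one double sum taken in
    -- different orders; it remains to match entries.
    rw [Finset.sum_comm]
    refine Finset.sum_congr rfl fun u _ => Finset.sum_congr rfl fun v _ => ?_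
    congr 1
    · congr 1 <;> refine chain_congr fun l hl => ?_ <;> simp only [outerSeq, innerSeq] <;> grind
    · refine chain_congr fun l hl => ?_
      simp only [outerSeq, innerSeq]
      grind
  coassoc_middle n p q r i j hn h1 h2 h3 h4 h5 h6 := by
    refine hom_ext_chain fun a => ?_
    simp only [LinearMap.comp_apply, decompose_chain e e' (show p + q - 1 + r = n + 1 by omega) h3
        (show j ≤ p + q - 1 by omega),
      decompose_chain e e' (show p + q = p + q - 1 + 1 by omega) h1 h2, map_sum,
      decompose_chain e e' (show p + (q + r - 1) = n + 1 by omega) h1 h2,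
      decompose_chain e e' (show q + r = q + r - 1 + 1 by omega)
        (show 1 ≤ j + 1 - i by omega) (show j + 1 - i ≤ q by omega),
      LinearMap.rTensor_tmul, LinearMap.lTensor_tmul, LinearEquiv.coe_coe, TensorProduct.sum_tmul,
      TensorProduct.tmul_sum, TensorProduct.assoc_symm_tmul]
    rw [Finset.sum_comm]
    refine Finset.sum_congr rfl fun u _ => Finset.sum_congr rfl fun v _ => ?_
    congr 1
    · congr 1 <;> refine chain_congr fun l hl => ?_ <;> simp only [outerSeq, innerSeq] <;> grind
    · refine chain_congr fun l hl => ?_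
      simp only [innerSeq]
      grind
  coassoc_right n p q r i j hn h1 h2 h3 h4 h5 := by
    refine hom_ext_chain fun a => ?_
    simp only [LinearMap.comp_apply, decompose_chain e e' (show p + q - 1 + r = n + 1 by omega) h3
        (show j ≤ p + q - 1 by omega),
      decompose_chain e e' (show p + q = p + q - 1 + 1 by omega) h1 h2, map_sum,
      decompose_chain e e' (show p + r - 1 + q = n + 1 by omega)
        (show 1 ≤ i + r - 1 by omega) (show i + r - 1 ≤ p + r - 1 by omega),
      decompose_chain e e' (show p + r = p + r - 1 + 1 by omega) h3 (show j ≤ p by omega),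
      LinearMap.rTensor_tmul, LinearEquiv.coe_coe, TensorProduct.sum_tmul,
      TensorProduct.rightComm_tmul]
    rw [Finset.sum_comm]
    refine Finset.sum_congr rfl fun u _ => Finset.sum_congr rfl fun v _ => ?_
    congr 1
    · congr 1 <;> refine chain_congr fun l hl => ?_ <;> simp only [outerSeq, innerSeq] <;> grind
    · refine chain_congr fun l hl => ?_
      simp only [outerSeq, innerSeq]
      grind

theorem chainCooperad_decomp (h : IsDualBases ε e e') (n p q i : ℕ) :
    (chainCooperad h).decomp n p q i = decompose e e' n p q i := rfl

/-- The comultiplication on Hochschild chains. -/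
noncomputable def chainComultiplication (h : IsDualBases ε e e') :
    (chainCooperad h).Comultiplication where
  map := augProd ε
  counit_map := rfl
  decomp_map n p q i := by
    by_cases hn : p + q = n + 1 ∧ 1 ≤ i ∧ i ≤ p
    · obtain ⟨h1, h2, h3⟩ := hn
      refine hom_ext_chain fun a => ?_
      simp only [assDual, LinearMap.comp_apply, if_pos (And.intro h1 (And.intro h2 h3)),
        chainCooperad_decomp, decompose_chain e e' h1 h2 h3, map_sum, TensorProduct.map_tmul,
        LinearMap.flip_apply, TensorProduct.mk_apply, augProd_chain']
      have hl (j : Fin m) : seqProd (outerSeq i q (e j) a) 0 (p + 1) =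
          seqProd a 0 i * (e j * seqProd a (i + q) (p - i)) := by
        rw [show p + 1 = i + (p - i + 1) by omega, seqProd_add, seqProd_succ]
        congr 1
        · exact seqProd_congr fun l hl => by simp [outerSeq, hl]
        · congr 1
          · simp [outerSeq]
          · exact seqProd_congr fun l hl => by simp only [outerSeq]; grind
      have hr (j : Fin m) : seqProd (innerSeq i (e' j) a) 0 (q + 1) = e' j * seqProd a i q := by
        rw [seqProd_succ]
        congr 1
        exact seqProd_congr fun l hl => by simp only [innerSeq]; grind
      have ha : seqProd a 0 (n + 1) =
          seqProd a 0 i * (seqProd a i q * seqProd a (i + q) (p - i)) := by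
        rw [show n + 1 = i + (q + (p - i)) by omega, seqProd_add, seqProd_add, zero_add]
      simp only [hl, hr, ha]
      -- Expanding the middle block y in the basis e splits ε(xyz) as ∑ ε(e'_j y) ε(x e_j z).
      have h4 : ε (seqProd a 0 i * (seqProd a i q * seqProd a (i + q) (p - i))) =
          ∑ j, ε (e' j * seqProd a i q) *
            ε (seqProd a 0 i * (e j * seqProd a (i + q) (p - i))) := by
        conv_lhs => rw [← h.sum_left (seqProd a i q)]
        simp [Finset.sum_mul, Finset.mul_sum]
      rw [h4, TensorProduct.sum_tmul]
      refine Finset.sum_congr rfl fun j _ => ?_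
      rw [← smul_eq_mul, TensorProduct.smul_tmul, smul_eq_mul, mul_one]
    · rw [(assDual k).decomp_eq_zero _ _ _ _ hn, (chainCooperad h).decomp_eq_zero _ _ _ _ hn]
      simp

theorem sum_Icc_one_eq {M : Type*} [AddCommMonoid M] (n : ℕ) (G : ℕ → M) :
    ∑ d ∈ Finset.Icc 1 n, G d = ∑ i : Fin n, G (i + 1) := by
  rw [Fin.sum_univ_eq_sum_range (fun i => G (i + 1)), Finset.range_eq_Ico,
    Finset.sum_Ico_add' G 0 n 1, zero_add, Finset.Ico_add_one_right_eq_Icc]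

theorem innerFace_chain (n : ℕ) (i : Fin (n + 1)) (a : ℕ → A) :
    innerFace (k := k) n i (chain k (n + 1) a) = chain k n (outerSeq i 2 (a i * a (i + 1)) a) := by
  rw [innerFace, chain, PiTensorProduct.lift.tprod]
  change PiTensorProduct.tprod k _ = PiTensorProduct.tprod k _
  congr 1
  funext l
  simp only [outerSeq, Fin.lt_def, Fin.ext_iff, Fin.val_castSucc, Fin.val_succ]
  grind

theorem lastFace_chain (σ : A ≃ₐ[k] A) (n : ℕ) (a : ℕ → A) :
    lastFace σ n (chain k (n + 1) a) = chain k n (innerSeq 1 (σ (a (n + 1)) * a 0) a) := by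
  rw [lastFace, chain, PiTensorProduct.lift.tprod]
  change PiTensorProduct.tprod k _ = PiTensorProduct.tprod k _
  congr 1
  funext l
  simp only [innerSeq, Fin.ext_iff, Fin.val_castSucc, Fin.val_last, Fin.val_zero]
  grind

theorem differential_chainCooperad (h : IsDualBases ε e e') {σ : A ≃ₐ[k] A} (hσ : IsNakayama ε σ)
    (n : ℕ) :
    (chainCooperad h).differential (chainComultiplication h) n = hochschildD σ n := by
  refine hom_ext_chain fun a => ?_
  rw [Cooperad.differential, hochschildD, LinearMap.add_apply, LinearMap.add_apply,
    LinearMap.add_apply, LinearMap.sum_apply, LinearMap.sum_apply, Fin.sum_univ_succ]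
  congr 1
  · congr 1
    · simp only [LinearMap.comp_apply, chainCooperad_decomp, chainComultiplication,
        decompose_chain e e' (show 2 + n = n + 1 + 1 by omega) one_le_two le_rfl, map_sum,
        LinearMap.rTensor_tmul, LinearEquiv.coe_coe, TensorProduct.lid_tmul, augProd_chain',
        innerFace_chain, Fin.val_zero, pow_zero, one_smul]
      have h1 (j : Fin m) : seqProd (outerSeq 2 n (e j) a) 0 (2 + 1) = a 0 * a 1 * e j := by
        rw [seqProd_succ, seqProd_succ, seqProd_succ]; simp [seqProd, outerSeq, mul_assoc]
      simp only [h1, h.sum_inner]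
      refine chain_congr fun l hl => ?_
      simp only [outerSeq, innerSeq]
      grind
    · rw [sum_Icc_one_eq]
      refine Finset.sum_congr rfl fun i _ => ?_
      rw [LinearMap.smul_apply, LinearMap.smul_apply, innerFace_chain, Fin.val_succ]
      congr 1
      simp only [LinearMap.comp_apply, chainCooperad_decomp, chainComultiplication,
        decompose_chain e e' (show n + 2 = n + 1 + 1 by omega) (show 1 ≤ (i : ℕ) + 1 by omega)
          (show (i : ℕ) + 1 ≤ n by omega), map_sum,
        LinearMap.lTensor_tmul, LinearEquiv.coe_coe, TensorProduct.rid_tmul, augProd_chain']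
      have h1 (j : Fin m) : seqProd (innerSeq (i + 1) (e' j) a) 0 (2 + 1) =
          e' j * (a (i + 1) * a (i + 1 + 1)) := by
        rw [seqProd_succ, seqProd_succ, seqProd_succ]; simp [seqProd, innerSeq]
      simp only [h1, h.sum_outer (show (i : ℕ) + 1 ≤ n by omega)]
  · rw [LinearMap.smul_apply, LinearMap.smul_apply, lastFace_chain]
    congr 1
    simp only [LinearMap.comp_apply, chainCooperad_decomp, chainComultiplication,
      decompose_chain e e' (show 2 + n = n + 1 + 1 by omega) le_rfl one_le_two, map_sum,
      LinearMap.rTensor_tmul, LinearEquiv.coe_coe, TensorProduct.lid_tmul, augProd_chain']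
    -- The twist enters here: the product a_0 e_j a_{n+1} is rotated by the Nakayama identity,
    -- bringing σ(a_{n+1}) to the front.
    have h1 (j : Fin m) : ε (seqProd (outerSeq 1 n (e j) a) 0 (2 + 1)) =
        ε (σ (a (n + 1)) * a 0 * e j) := by
      rw [seqProd_succ, seqProd_succ, seqProd_succ, mul_assoc, ← hσ]
      simp [seqProd, outerSeq, mul_assoc, add_comm]
    simp only [h1, h.sum_inner]

end Chains

/-! ### Products of functionals -/

section PairFunctional

variable {k : Type u} [Field k] {M N : Type*} [AddCommGroup M] [Module k M] [AddCommGroup N]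
  [Module k N]

/-- The functional `x ⊗ y ↦ f x * g y`. -/
noncomputable def pairFun (f : Module.Dual k M) (g : Module.Dual k N) : Module.Dual k (M ⊗[k] N) :=
  LinearMap.mul' k k ∘ₗ TensorProduct.map f g

@[simp]
theorem pairFun_tmul (f : Module.Dual k M) (g : Module.Dual k N) (x : M) (y : N) :
    pairFun f g (x ⊗ₜ y) = f x * g y := by
  simp [pairFun]

theorem pairFun_comp_map {M' N' : Type*} [AddCommGroup M'] [Module k M'] [AddCommGroup N']
    [Module k N'] (f : Module.Dual k M) (g : Module.Dual k N) (a : M' →ₗ[k] M) (b : N' →ₗ[k] N) :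
    pairFun f g ∘ₗ TensorProduct.map a b = pairFun (f ∘ₗ a) (g ∘ₗ b) := by
  ext; simp

end PairFunctional

/-! ### Functionals on chains as cochains and as polynomials -/

section Cochains

variable {k : Type u} [Field k] {A : Type v} [Ring A] [Algebra k A] {ε : A →ₗ[k] k}
  {m : ℕ} {e e' : Module.Basis (Fin m) k A}

/-- The sequence consisting of `y`, followed by the basis vectors `e_c` for the letters of a
word. -/
noncomputable def wordSeq (e : Module.Basis (Fin m) k A) (y : A) (w : List (Fin m)) : ℕ → A
  | 0 => y
  | l + 1 => (w[l]?).elim 0 e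

theorem wordSeq_succ (y : A) (w : List (Fin m)) (l : ℕ) :
    wordSeq e y w (l + 1) = (w[l]?).elim 0 e := rfl

/-- The values of a functional on the chains `(y, e_w)`. -/
noncomputable def evalWord (e : Module.Basis (Fin m) k A) {n : ℕ}
    (f : Module.Dual k (HochschildChain k A n)) (y : A) (w : List (Fin m)) : k :=
  f (chain k n (wordSeq e y w))

theorem wordSeq_eq_update (y : A) (w : List (Fin m)) :
    wordSeq e y w = Function.update (wordSeq e 0 w) 0 y := by
  funext l
  rcases l with _ | l <;> simp [wordSeq]

theorem evalWord_sum {n : ℕ} (f : Module.Dual k (HochschildChain k A n)) (c : Fin m → k)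
    (y : Fin m → A) (w : List (Fin m)) :
    ∑ j, c j * evalWord e f (y j) w = evalWord e f (∑ j, c j • y j) w := by
  have h := congrArg f (sum_smul_chain_update n.zero_le (wordSeq e 0 w) c y)
  simpa only [evalWord, ← wordSeq_eq_update, map_sum, map_smul, smul_eq_mul] using h

/-- The cochain with values in `A` corresponding to a functional on chains, on words in the
basis. -/
noncomputable def cochainOf (e e' : Module.Basis (Fin m) k A) {n : ℕ}
    (f : Module.Dual k (HochschildChain k A n)) (w : List (Fin m)) : A :=
  ∑ c, evalWord e f (e' c) w • e c

/-- Expanding y in the basis e' proves the identity. By nondegeneracy of ε it determines the value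
of the cochain on w. -/
theorem IsDualBases.mul_cochainOf (h : IsDualBases ε e e') {n : ℕ}
    (f : Module.Dual k (HochschildChain k A n)) (y : A) (w : List (Fin m)) :
    ε (y * cochainOf e e' f w) = evalWord e f y w := by
  simp only [cochainOf, Finset.mul_sum, mul_smul_comm, map_sum, map_smul, smul_eq_mul]
  rw [Finset.sum_congr rfl fun c _ => mul_comm _ _, evalWord_sum, h.sum_right]

theorem coord_cochainOf {n : ℕ} (f : Module.Dual k (HochschildChain k A n)) (w : List (Fin m))
    (c : Fin m) : e.coord c (cochainOf e e' f w) = evalWord e f (e' c) w := by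
  simp [cochainOf, Finsupp.single_apply]

theorem IsDualBases.cochainOf_eq (h : IsDualBases ε e e') {n : ℕ}
    {f : Module.Dual k (HochschildChain k A n)} {w : List (Fin m)} {z : A}
    (hz : ∀ y, evalWord e f y w = ε (y * z)) : cochainOf e e' f w = z := by
  simp only [cochainOf, hz, h.sum_left]

/-- The noncommutative polynomial corresponding to a functional on chains. -/
noncomputable def polyOf (e e' : Module.Basis (Fin m) k A) (n : ℕ)
    (f : Module.Dual k (HochschildChain k A n)) : NCPoly k A (Fin m) :=
  wordSum k n (cochainOf e e' f)

theorem cochainOf_add {n : ℕ} (f g : Module.Dual k (HochschildChain k A n)) (w : List (Fin m)) :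
    cochainOf e e' (f + g) w = cochainOf e e' f w + cochainOf e e' g w := by
  simp [cochainOf, evalWord, add_smul, Finset.sum_add_distrib]

theorem cochainOf_smul {n : ℕ} (r : k) (f : Module.Dual k (HochschildChain k A n))
    (w : List (Fin m)) : cochainOf e e' (r • f) w = r • cochainOf e e' f w := by
  simp [cochainOf, evalWord, mul_smul, Finset.smul_sum]

theorem polyOf_add (n : ℕ) (f g : Module.Dual k (HochschildChain k A n)) :
    polyOf e e' n (f + g) = polyOf e e' n f + polyOf e e' n g := by
  simp only [polyOf, ← wordSum_add, ← cochainOf_add]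

theorem polyOf_smul (n : ℕ) (r : k) (f : Module.Dual k (HochschildChain k A n)) :
    polyOf e e' n (r • f) = r • polyOf e e' n f := by
  simp only [polyOf, ← wordSum_smul, ← cochainOf_smul]

/-- The bases used in the factors of the chains: `e'` in the first factor, `e` in the others. -/
noncomputable def chainBases (e e' : Module.Basis (Fin m) k A) (n : ℕ) (i : Fin (n + 1)) :
    Module.Basis (Fin m) k A := if i = 0 then e' else e

theorem tprod_chainBases (n : ℕ) (v : Fin (n + 1) → Fin m) :
    (PiTensorProduct.tprod k fun i => chainBases e e' n i (v i)) =
      chain k n (wordSeq e (e' (v 0)) (List.ofFn fun i : Fin n => v i.succ)) := by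
  unfold chain
  congr 1
  funext l
  induction l using Fin.cases with
  | zero => simp [chainBases, wordSeq]
  | succ l => simp [chainBases, wordSeq]

/-- Chains with first entry in e' and the others in e form a basis, and the value of f on such a
chain is a coordinate of a coefficient of the polynomial. -/
theorem eq_zero_of_polyOf_eq_zero {n : ℕ} {f : Module.Dual k (HochschildChain k A n)}
    (h : polyOf e e' n f = 0) : f = 0 := by
  refine PiTensorProduct.ext (Module.Basis.ext_multilinear (chainBases e e' n) fun v => ?_)
  have h1 := wordCoeff_wordSum (k := k) n (cochainOf e e' f)
    (List.ofFn fun i : Fin n => v i.succ) (by simp)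
  rw [← polyOf, h, map_zero] at h1
  have h2 := coord_cochainOf (e := e) (e' := e') f (List.ofFn fun i : Fin n => v i.succ) (v 0)
  rw [← h1, map_zero] at h2
  simp only [LinearMap.compMultilinearMap_apply, LinearMap.zero_apply]
  rw [tprod_chainBases]
  exact h2.symm

theorem IsDualBases.exists_polyOf_eq (h : IsDualBases ε e e') (n : ℕ) (K : List (Fin m) → A) :
    ∃ f : Module.Dual k (HochschildChain k A n), polyOf e e' n f = wordSum k n K := by
  let b := Basis.piTensorProduct (chainBases e e' n)
  let f : Module.Dual k (HochschildChain k A n) :=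
    b.constr k fun v => ε (e' (v 0) * K (List.ofFn fun i : Fin n => v i.succ))
  refine ⟨f, wordSum_congr fun w hw => ?_⟩
  subst hw
  have hf (c : Fin m) : evalWord e f (e' c) w = ε (e' c * K w) := by
    have h1 : f (b (Fin.cons c w.get)) = _ := b.constr_basis k _ _
    rw [Basis.piTensorProduct_apply, tprod_chainBases] at h1
    simpa [evalWord] using h1
  simp only [cochainOf, hf, h.sum_left]

variable (e e') in
/-- Insertion of `g` into `f`, with the signs of the cobrace. -/
noncomputable def insertFun {p q : ℕ} (n : ℕ) (f : Module.Dual k (HochschildChain k A p))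
    (g : Module.Dual k (HochschildChain k A q)) : Module.Dual k (HochschildChain k A n) :=
  ∑ i ∈ Finset.Icc 1 p, (-1 : k) ^ ((q + 1) * (p - i)) • (pairFun f g ∘ₗ decompose e e' n p q i)

theorem chain_outerSeq_wordSeq (p q i : ℕ) (y : A) (w : List (Fin m)) (j : Fin m)
    (hi : i ≤ w.length) :
    chain k p (outerSeq (i + 1) q (e j) (wordSeq e y w)) =
      chain k p (wordSeq e y (w.take i ++ j :: w.drop (i + q))) := by
  congr 1
  funext l
  rcases l with _ | l
  · simp [outerSeq, wordSeq]
  · simp only [outerSeq, wordSeq_succ, List.getElem?_append, List.length_take, List.getElem?_take,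
      min_eq_left hi]
    by_cases h1 : l < i
    · simp [h1]
    · by_cases h2 : l = i
      · simp [h2]
      · obtain ⟨t, rfl⟩ : ∃ t, l = i + 1 + t := ⟨l - i - 1, by omega⟩
        rw [if_neg (by omega), if_neg (by omega), if_neg (by omega),
          show i + 1 + t - i = t + 1 by omega, List.getElem?_cons_succ, List.getElem?_drop,
          show i + 1 + t + 1 + q - 1 = (i + q + t) + 1 by omega, wordSeq_succ]

theorem chain_innerSeq_wordSeq (q i : ℕ) (y z : A) (w : List (Fin m)) :
    chain k q (innerSeq (i + 1) z (wordSeq e y w)) =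
      chain k q (wordSeq e z ((w.drop i).take q)) := by
  refine chain_congr fun l hl => ?_
  rcases l with _ | l
  · simp [innerSeq, wordSeq]
  · simp only [innerSeq, wordSeq_succ, List.getElem?_take, List.getElem?_drop]
    rw [if_neg (by omega), if_pos (by omega), show i + 1 + (l + 1) - 1 = i + l + 1 by omega,
      wordSeq_succ]

/-- In ∑ f(…, e_c, …) g(e'_c, …) the second factor is the c-th coordinate of the cochain of g, so
the pairing inserts that cochain into one argument of f. -/
theorem evalWord_pairFun_decompose {n p q i : ℕ} (h : p + q = n + 1) (hi : i < p)
    (f : Module.Dual k (HochschildChain k A p)) (g : Module.Dual k (HochschildChain k A q))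
    (y : A) (w : List (Fin m)) (hw : w.length = n) :
    evalWord e (pairFun f g ∘ₗ decompose e e' n p q (i + 1)) y w =
      ∑ c, e.coord c (cochainOf e e' g ((w.drop i).take q)) *
        evalWord e f y (w.take i ++ c :: w.drop (i + q)) := by
  rw [evalWord, LinearMap.comp_apply, decompose_chain e e' h (by omega) (by omega), map_sum]
  refine Finset.sum_congr rfl fun j _ => ?_
  rw [pairFun_tmul, chain_outerSeq_wordSeq _ _ _ _ _ _ (by omega), chain_innerSeq_wordSeq,
    coord_cochainOf, mul_comm]
  rfl

/-- In the cobrace sign, p - i is the number of letters to the right of the i-th one, which is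
exactly the twist of `der`. -/
theorem polyOf_insertFun {n p q : ℕ} (h : p + q = n + 1)
    (f : Module.Dual k (HochschildChain k A p)) (g : Module.Dual k (HochschildChain k A q)) :
    polyOf e e' n (insertFun e e' n f g) =
      der e (q + 1) (polyOf e e' q g) (polyOf e e' p f) := by
  rw [polyOf, polyOf, polyOf, der_wordSum e (q + 1) p q n h.symm]
  refine wordSum_congr fun w hw => ?_
  have h1 (y : A) : evalWord e (insertFun e e' n f g) y w =
      ∑ i ∈ Finset.range p, (-1 : k) ^ ((q + 1) * (p - 1 - i)) *
        ∑ c, e.coord c (cochainOf e e' g ((w.drop i).take q)) *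
          evalWord e f y (w.take i ++ c :: w.drop (i + q)) := by
    rw [insertFun, evalWord, LinearMap.sum_apply, sum_Icc_one_eq,
      ← Fin.sum_univ_eq_sum_range (fun i => (-1 : k) ^ ((q + 1) * (p - 1 - i)) *
        ∑ c, e.coord c (cochainOf e e' g ((w.drop i).take q)) *
          evalWord e f y (w.take i ++ c :: w.drop (i + q)))]
    refine Finset.sum_congr rfl fun i _ => ?_
    rw [LinearMap.smul_apply, smul_eq_mul, Nat.sub_sub, add_comm 1 (i : ℕ),
      ← evalWord_pairFun_decompose h i.2 f g y w hw]
    rfl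
  simp only [cochainOf, h1, Finset.sum_smul, Finset.smul_sum, Finset.mul_sum, mul_smul]
  rw [Finset.sum_comm]
  refine Finset.sum_congr rfl fun i _ => ?_
  rw [Finset.sum_comm]

variable (e e' ε) in
/-- The functional dual to the `(p, q)` component of the cup coproduct. -/
noncomputable def cupFun {p q : ℕ} (n : ℕ) (f : Module.Dual k (HochschildChain k A p))
    (g : Module.Dual k (HochschildChain k A q)) : Module.Dual k (HochschildChain k A n) :=
  pairFun f g ∘ₗ ((TensorProduct.lid k _).toLinearMap ∘ₗ (augProd ε 2).rTensor _ ∘ₗ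
    decompose e e' (p + 1) 2 p 1).rTensor _ ∘ₗ decompose e e' n (p + 1) q (p + 1)

theorem polyOf_cupFun (hd : IsDualBases ε e e') {σ : A ≃ₐ[k] A} (hσ : IsNakayama ε σ)
    {n p q : ℕ} (h : p + q = n)
    (f : Module.Dual k (HochschildChain k A p)) (g : Module.Dual k (HochschildChain k A q)) :
    polyOf e e' n (cupFun ε e e' n f g) = polyOf e e' p f * polyOf e e' q g := by
  subst h
  rw [polyOf, polyOf, polyOf, wordSum_mul_wordSum]
  refine wordSum_congr fun w hw => hd.cochainOf_eq fun y => ?_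
  rw [evalWord, cupFun, LinearMap.comp_apply, LinearMap.comp_apply,
    decompose_chain e e' (by omega) (by omega) le_rfl]
  simp only [map_sum, LinearMap.rTensor_tmul, LinearMap.comp_apply, LinearEquiv.coe_coe,
    decompose_chain e e' (show 2 + p = p + 1 + 1 by omega) le_rfl one_le_two,
    TensorProduct.lid_tmul, augProd_chain']
  have h1 (j l : Fin m) : ε (seqProd (outerSeq 1 p (e l) (outerSeq (p + 1) q (e j)
      (wordSeq e y w))) 0 (2 + 1)) = ε (σ (e j) * y * e l) := by
    rw [seqProd_succ, seqProd_succ, seqProd_succ, mul_assoc, ← hσ]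
    simp [seqProd, outerSeq, mul_assoc, add_comm, wordSeq]
  simp only [h1, hd.sum_inner]
  have h2 (j : Fin m) : chain k p (innerSeq 1 (σ (e j) * y) (outerSeq (p + 1) q (e j)
      (wordSeq e y w))) = chain k p (wordSeq e (σ (e j) * y) (w.take p)) := by
    refine chain_congr fun l hl => ?_
    rcases l with _ | l
    · simp [innerSeq, wordSeq]
    · simp only [innerSeq, outerSeq, wordSeq_succ, List.getElem?_take]
      rw [if_neg (by omega), if_pos (by omega), if_pos (by omega),
        show 1 + (l + 1) - 1 = l + 1 by omega, wordSeq_succ]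
  simp only [pairFun_tmul, h2, chain_innerSeq_wordSeq]
  have h3 : (w.drop p).take q = w.drop p := List.take_of_length_le (by simp; omega)
  rw [h3, ← mul_assoc]
  conv_rhs =>
    rw [show cochainOf e e' g (w.drop p) = ∑ c, evalWord e g (e' c) (w.drop p) • e c from rfl,
      Finset.mul_sum, map_sum]
  refine Finset.sum_congr rfl fun j _ => ?_
  rw [mul_smul_comm, map_smul, smul_eq_mul, mul_comm]
  congr 1
  -- The factor σ(e_j) that the cup coproduct placed in front returns to the right end as e_j, where
  -- it meets the expansion of the cochain of g.
  rw [hσ, ← mul_assoc, hd.mul_cochainOf]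
  rfl

theorem wordSum_one_eq_univElt :
    wordSum k 1 (fun w : List (Fin m) => (w[0]?).elim 0 e) = univElt e := by
  simp [wordSum, univElt, genX]

theorem sub_smul_eq_add {ι : Type*} (a b : NCPoly k A ι) (r : k) :
    a - r • b = a + (-r) • b := by
  module

/-- The zeroth face transposes to left multiplication by the universal element, the last face to
right multiplication, and the remaining ones to substitution of the product. -/
theorem polyOf_comp_hochschildD (hd : IsDualBases ε e e') {σ : A ≃ₐ[k] A} (hσ : IsNakayama ε σ)
    {n : ℕ} (f : Module.Dual k (HochschildChain k A n)) :
    polyOf e e' (n + 1) (f ∘ₗ hochschildD σ n) = delta e n (polyOf e e' n f) := by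
  have hμ : univElt e * univElt e = wordSum k 2 fun w : List (Fin m) =>
      (w[0]?).elim 0 e * (w[1]?).elim 0 e := by
    rw [← wordSum_one_eq_univElt, wordSum_mul_wordSum]
    simp
  have h1 : univElt e * polyOf e e' n f = wordSum k (n + 1) fun w : List (Fin m) =>
      (w[0]?).elim 0 e * cochainOf e e' f (w.drop 1) := by
    rw [← wordSum_one_eq_univElt, polyOf, wordSum_mul_wordSum, add_comm]
    simp
  have h2 : polyOf e e' n f * univElt e = wordSum k (n + 1) fun w : List (Fin m) =>
      cochainOf e e' f (w.take n) * (w[n]?).elim 0 e := by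
    rw [← wordSum_one_eq_univElt, polyOf, wordSum_mul_wordSum]
    simp
  have h3 : derMul e (polyOf e e' n f) = wordSum k (n + 1) fun w : List (Fin m) =>
      ∑ i ∈ Finset.range n, (-1 : k) ^ (n - 1 - i) • ∑ c, e.coord c ((w[i]?).elim 0 e *
        (w[i + 1]?).elim 0 e) • cochainOf e e' f (w.take i ++ c :: w.drop (i + 2)) := by
    rw [derMul, hμ, polyOf, der_wordSum e 1 n 2 (n + 1) rfl]
    simp
  rw [delta_apply, h1, h2, h3, sub_smul_eq_add, ← wordSum_smul, ← wordSum_smul,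
    ← wordSum_add, ← wordSum_add, polyOf]
  refine wordSum_congr fun w hw => hd.cochainOf_eq fun y => ?_
  rw [evalWord, LinearMap.comp_apply, hochschildD, LinearMap.add_apply, LinearMap.sum_apply,
    Fin.sum_univ_succ, map_add, map_add, mul_add, mul_add, map_add, map_add]
  -- The last face is the last summand of the differential, whereas right multiplication is the
  -- middle summand of `delta`.
  have comb {a b c a' b' c' : k} (ha : a = a') (hc : c = b') (hb : b = c') :
      a + b + c = a' + b' + c' := by rw [ha, hb, hc]; ring
  refine comb ?_ ?_ ?_
  · rw [← mul_assoc, hd.mul_cochainOf, evalWord]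
    simp only [Fin.val_zero, pow_zero, one_smul, innerFace_chain]
    congr 1
    refine chain_congr fun l hl => ?_
    rcases l with _ | l
    · simp [outerSeq, wordSeq]
    · simp [outerSeq, wordSeq]
  · rw [LinearMap.smul_apply, map_smul, mul_smul_comm, map_smul, pow_succ, mul_neg_one,
      lastFace_chain, ← mul_assoc, hσ, ← mul_assoc, hd.mul_cochainOf]
    congr 2
    refine chain_congr fun l hl => ?_
    rcases l with _ | l
    · simp [innerSeq, wordSeq]
    · have : l < n := by omega
      simp [innerSeq, wordSeq, this]
  · rw [map_sum, mul_smul_comm, map_smul, Finset.mul_sum, map_sum, smul_eq_mul, Finset.mul_sum,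
      ← Fin.sum_univ_eq_sum_range (fun i => (-1 : k) ^ n * ε (y * (-1 : k) ^ (n - 1 - i) •
        ∑ c, e.coord c ((w[i]?).elim 0 e * (w[i + 1]?).elim 0 e) •
          cochainOf e e' f (w.take i ++ c :: w.drop (i + 2))))]
    refine Finset.sum_congr rfl fun i _ => ?_
    rw [LinearMap.smul_apply, map_smul, innerFace_chain, mul_smul_comm, map_smul, smul_eq_mul,
      smul_eq_mul, ← mul_assoc, ← pow_add, Fin.val_succ,
      neg_one_pow_congr (show Even (n + (n - 1 - i) + (i + 1)) by
        have := i.2; rw [show n + (n - 1 - i) + (i + 1) = n + n by omega]; exact ⟨n, rfl⟩)]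
    congr 1
    simp only [Finset.mul_sum, mul_smul_comm, map_sum, map_smul, hd.mul_cochainOf, smul_eq_mul,
      evalWord]
    have h4 (j : Fin m) := chain_outerSeq_wordSeq (k := k) (e := e) n 2 i y w j (by omega)
    simp only [← h4]
    have h5 := sum_smul_chain_update (k := k) (show (i : ℕ) + 1 ≤ n by omega)
      (outerSeq (i + 1) 2 0 (wordSeq e y w))
      (fun j => e.coord j ((w[(i : ℕ)]?).elim 0 e * (w[(i : ℕ) + 1]?).elim 0 e)) fun j => e j
    simp only [← outerSeq_eq_update, Module.Basis.coord_apply, e.sum_repr] at h5 ⊢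
    rw [show wordSeq e y w ((i : ℕ) + 1) = (w[(i : ℕ)]?).elim 0 e from rfl,
      show wordSeq e y w ((i : ℕ) + 1 + 1) = (w[(i : ℕ) + 1]?).elim 0 e from rfl, ← h5, map_sum]
    simp

end Cochains

/-! ### Homogeneous functionals and transposed operations -/

section Pure

variable {k : Type u} [Field k] {V : ℕ → Type w} [∀ n, AddCommGroup (V n)] [∀ n, Module k (V n)]

/-- A functional on one degree, extended by zero to the total module. -/
noncomputable def pureFun (p : ℕ) (f : Module.Dual k (V p)) : Module.Dual k (Tot V) :=
  f ∘ₗ DirectSum.component k ℕ V p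

theorem pureFun_lof (p : ℕ) (f : Module.Dual k (V p)) (x : V p) :
    pureFun p f (DirectSum.lof k ℕ V p x) = f x := by
  simp [pureFun, DirectSum.component.lof_self]

theorem pureFun_lof_of_ne {p q : ℕ} (h : q ≠ p) (f : Module.Dual k (V p)) (x : V q) :
    pureFun p f (DirectSum.lof k ℕ V q x) = 0 := by
  simp [pureFun, DirectSum.component.of, h]

/-- The functional dual to an operation, applied to two functionals. -/
noncomputable def star (Φ : Tot V →ₗ[k] Tot V ⊗[k] Tot V) (F G : Module.Dual k (Tot V)) :
    Module.Dual k (Tot V) := pairFun F G ∘ₗ Φ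

theorem pairFun_pureFun_incl₂ (p q : ℕ) (f : Module.Dual k (V p)) (g : Module.Dual k (V q))
    (t : V p ⊗[k] V q) :
    pairFun (pureFun p f) (pureFun q g) (incl₂ k V p q t) = pairFun f g t := by
  have : pairFun (pureFun p f) (pureFun q g) ∘ₗ incl₂ k V p q = pairFun f g := by
    ext; simp [incl₂, pureFun_lof]
  exact LinearMap.congr_fun this t

theorem pairFun_pureFun_incl₂_of_ne {p q p' q' : ℕ} (h : (p', q') ≠ (p, q))
    (f : Module.Dual k (V p)) (g : Module.Dual k (V q)) (t : V p' ⊗[k] V q') :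
    pairFun (pureFun p f) (pureFun q g) (incl₂ k V p' q' t) = 0 := by
  have : pairFun (pureFun p f) (pureFun q g) ∘ₗ incl₂ k V p' q' = 0 := by
    ext x y
    by_cases hp : p' = p
    · have hq : q' ≠ q := fun hq => h (by rw [hp, hq])
      simp [incl₂, pureFun_lof_of_ne hq]
    · simp [incl₂, pureFun_lof_of_ne hp]
  exact LinearMap.congr_fun this t

/-- Transposing the flip exchanges the functionals, and the sign is that of the one bidegree (q, p)
on which the pairing does not vanish. -/
theorem pairFun_comp_signedFlip (s : ℕ → ℕ → ℕ) (p q : ℕ) (f : Module.Dual k (V p))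
    (g : Module.Dual k (V q)) :
    pairFun (pureFun p f) (pureFun q g) ∘ₗ signedFlip k V s =
      (-1 : k) ^ s q p • pairFun (pureFun q g) (pureFun p f) := by
  refine TensorProduct.ext (DirectSum.linearMap_ext k fun a => LinearMap.ext fun x =>
    DirectSum.linearMap_ext k fun b => LinearMap.ext fun y => ?_)
  change pairFun (pureFun p f) (pureFun q g) (signedFlip k V s
      (DirectSum.lof k ℕ V a x ⊗ₜ DirectSum.lof k ℕ V b y)) =
    (-1 : k) ^ s q p • pairFun (pureFun q g) (pureFun p f)
      (DirectSum.lof k ℕ V a x ⊗ₜ DirectSum.lof k ℕ V b y)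
  simp only [signedFlip_lof, map_smul, pairFun_tmul]
  by_cases hb : b = p
  · by_cases ha : a = q
    · subst ha hb; rw [mul_comm]
    · simp [pureFun_lof_of_ne ha]
  · simp [pureFun_lof_of_ne hb]

end Pure

/-! ### The Leibniz rule up to homotopy -/

section RestBracket

variable {k : Type u} [Field k] {A : Type v} [Ring A] [Algebra k A] {ι : Type w} [Fintype ι]
  (e : Module.Basis ι k A)

/-- Inserting h into f * g is strictly Leibniz by `der_mul`. Inserting f * g into h is Leibniz up to
the coboundary of a double insertion, which is the whole defect. -/
theorem bracket_mul_homotopy {p q r : ℕ} {f g h : NCPoly k A ι} (hf : HasParity p f)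
    (hg : HasParity q g) (hh : HasParity r h) (hδf : delta e p f = 0) (hδg : delta e q g = 0)
    (hδh : delta e r h = 0) :
    bracket e r (p + q) h (f * g) - bracket e r p h f * g
      - (-1 : k) ^ (p * (r + 1)) • (f * bracket e r q h g) =
    -(-1 : k) ^ r • delta e (r + p + q) (der₂ e (p + 1) f (q + 1) g h) := by
  rw [bracket, bracket, bracket, der_mul_homotopy e hf hg hh hδf hδg hδh, der_mul, hg, mul_sub,
    sub_mul]
  rcases neg_one_pow_eq_or k p with hp | hp <;> rcases neg_one_pow_eq_or k q with hq | hq <;>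
    rcases neg_one_pow_eq_or k r with hr | hr <;>
    simp only [pow_add, pow_mul, mul_one, add_mul, mul_add, hp, hq, hr, one_mul, one_pow, pow_one,
      mul_neg, neg_neg, mul_smul_comm, smul_mul_assoc] <;>
    module

end RestBracket

/-! ### The dictionary between operations on functionals and on polynomials -/

section Rep

variable {k : Type u} [Field k] {A : Type v} [Ring A] [Algebra k A] {ε : A →ₗ[k] k}
  {m : ℕ} {e e' : Module.Basis (Fin m) k A}

/-- `F` is concentrated in degree `n` and corresponds to the noncommutative polynomial `b`. -/
def Represents (e e' : Module.Basis (Fin m) k A)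
    (F : Module.Dual k (Tot (HochschildChain k A))) (n : ℤ) (b : NCPoly k A (Fin m)) : Prop :=
  -- Zero is allowed in every integer degree, in particular in the degree p + q - 1 = -1 reached by
  -- the cobrace at p = q = 0.
  (F = 0 ∧ b = 0) ∨ ∃ (l : ℕ) (f : Module.Dual k (HochschildChain k A l)), (l : ℤ) = n ∧
    F = pureFun l f ∧ b = polyOf e e' l f

variable {F G : Module.Dual k (Tot (HochschildChain k A))} {n n' : ℤ} {b b' : NCPoly k A (Fin m)}

theorem represents_pureFun (l : ℕ) (f : Module.Dual k (HochschildChain k A l)) :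
    Represents e e' (pureFun l f) l (polyOf e e' l f) := Or.inr ⟨l, f, rfl, rfl, rfl⟩

theorem Represents.congr (h : Represents e e' F n b) (hn : n = n') (hb : b = b') :
    Represents e e' F n' b' := hn ▸ hb ▸ h

theorem polyOf_zero (l : ℕ) : polyOf e e' l (0 : Module.Dual k (HochschildChain k A l)) = 0 := by
  simpa using polyOf_smul l (0 : k) (0 : Module.Dual k (HochschildChain k A l))

theorem Represents.add (h : Represents e e' F n b) (h' : Represents e e' G n b') :
    Represents e e' (F + G) n (b + b') := by
  rcases h with ⟨rfl, rfl⟩ | ⟨l, f, rfl, rfl, rfl⟩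
  · simpa using h'
  · rcases h' with ⟨rfl, rfl⟩ | ⟨l', g, h, rfl, rfl⟩
    · simpa using represents_pureFun l f
    · obtain rfl : l' = l := by exact_mod_cast h
      exact Or.inr ⟨l', f + g, rfl, rfl, (polyOf_add _ _ _).symm⟩

theorem Represents.smul (h : Represents e e' F n b) (r : k) :
    Represents e e' (r • F) n (r • b) := by
  rcases h with ⟨rfl, rfl⟩ | ⟨l, f, rfl, rfl, rfl⟩
  · left; simp
  · exact Or.inr ⟨l, r • f, rfl, rfl, (polyOf_smul _ _ _).symm⟩

theorem Represents.sub (h : Represents e e' F n b) (h' : Represents e e' G n b') :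
    Represents e e' (F - G) n (b - b') := by
  have := h.add (h'.smul (-1))
  refine ((congrArg (Represents e e' · n _) ?_).mp this).congr rfl ?_ <;> module

theorem Represents.eq_zero (h : Represents e e' F n 0) : F = 0 := by
  rcases h with ⟨rfl, -⟩ | ⟨l, f, rfl, rfl, hf⟩
  · rfl
  · rw [eq_zero_of_polyOf_eq_zero hf.symm]; rfl

/-- `polyOf` is injective in each degree; this converts identities of polynomials into identities of
functionals. -/
theorem Represents.unique (h : Represents e e' F n b) (h' : Represents e e' G n b) : F = G :=
  sub_eq_zero.mp ((h.sub h').congr rfl (sub_self b)).eq_zero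

variable {σ : A ≃ₐ[k] A}

/-- Homogeneous functionals of degrees p and q see only the (p, q) summand of the coproduct. -/
theorem star_cup (hd : IsDualBases ε e e') {p q : ℕ} (f : Module.Dual k (HochschildChain k A p))
    (g : Module.Dual k (HochschildChain k A q)) :
    star ((chainCooperad hd).cup (chainComultiplication hd)) (pureFun p f) (pureFun q g) =
      pureFun (p + q) (cupFun ε e e' (p + q) f g) := by
  refine DirectSum.linearMap_ext k fun n => LinearMap.ext fun x => ?_
  simp only [star, LinearMap.comp_apply, Cooperad.cup, DirectSum.toModule_lof,
    LinearMap.sum_apply, map_sum]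
  by_cases hn : n = p + q
  · subst hn
    rw [Finset.sum_eq_single (p, q), pairFun_pureFun_incl₂, pureFun_lof]
    · rfl
    · intro pq _ hpq
      exact pairFun_pureFun_incl₂_of_ne hpq _ _ _
    · simp
  · rw [pureFun_lof_of_ne hn]
    refine Finset.sum_eq_zero fun pq hpq => pairFun_pureFun_incl₂_of_ne ?_ _ _ _
    obtain ⟨a, b⟩ := pq
    rintro ⟨⟩
    exact hn (Finset.HasAntidiagonal.mem_antidiagonal.mp hpq).symm

theorem star_cobrace (hd : IsDualBases ε e e') {n p q : ℕ} (h : p + q = n + 1)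
    (f : Module.Dual k (HochschildChain k A p)) (g : Module.Dual k (HochschildChain k A q)) :
    star (chainCooperad hd).cobrace (pureFun p f) (pureFun q g) =
      pureFun n (insertFun e e' n f g) := by
  refine DirectSum.linearMap_ext k fun l => LinearMap.ext fun x => ?_
  simp only [star, LinearMap.comp_apply, Cooperad.cobrace, DirectSum.toModule_lof,
    LinearMap.sum_apply, map_sum, LinearMap.smul_apply, map_smul]
  by_cases hn : l = n
  · subst hn
    rw [Finset.sum_eq_single (p, q), pureFun_lof, insertFun, LinearMap.sum_apply]
    · refine Finset.sum_congr rfl fun i _ => ?_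
      rw [pairFun_pureFun_incl₂]
      rfl
    · intro pq _ hpq
      refine Finset.sum_eq_zero fun i _ => ?_
      rw [pairFun_pureFun_incl₂_of_ne hpq, smul_zero]
    · intro hpq
      exact absurd (Finset.HasAntidiagonal.mem_antidiagonal.mpr h) hpq
  · rw [pureFun_lof_of_ne hn]
    refine Finset.sum_eq_zero fun pq hpq => Finset.sum_eq_zero fun i _ => ?_
    rw [pairFun_pureFun_incl₂_of_ne, smul_zero]
    obtain ⟨a, b⟩ := pq
    rintro ⟨⟩
    have := Finset.HasAntidiagonal.mem_antidiagonal.mp hpq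
    simp only at this
    omega

/-- No degree n satisfies 0 + 0 = n + 1. -/
theorem star_cobrace_zero (hd : IsDualBases ε e e')
    (f g : Module.Dual k (HochschildChain k A 0)) :
    star (chainCooperad hd).cobrace (pureFun 0 f) (pureFun 0 g) = 0 := by
  refine DirectSum.linearMap_ext k fun l => LinearMap.ext fun x => ?_
  simp only [star, LinearMap.comp_apply, Cooperad.cobrace, DirectSum.toModule_lof,
    LinearMap.sum_apply, map_sum, LinearMap.smul_apply, map_smul, LinearMap.zero_apply]
  refine Finset.sum_eq_zero fun pq hpq => Finset.sum_eq_zero fun i _ => ?_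
  rw [pairFun_pureFun_incl₂_of_ne, smul_zero]
  obtain ⟨a, b⟩ := pq
  rintro ⟨⟩
  have := Finset.HasAntidiagonal.mem_antidiagonal.mp hpq
  simp only at this
  omega

theorem star_zero_left {V : ℕ → Type w} [∀ n, AddCommGroup (V n)] [∀ n, Module k (V n)]
    (Φ : Tot V →ₗ[k] Tot V ⊗[k] Tot V) (G : Module.Dual k (Tot V)) : star Φ 0 G = 0 := by
  have : pairFun (0 : Module.Dual k (Tot V)) G = 0 := TensorProduct.ext' fun x y => by simp
  rw [star, this, LinearMap.zero_comp]

theorem star_zero_right {V : ℕ → Type w} [∀ n, AddCommGroup (V n)] [∀ n, Module k (V n)]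
    (Φ : Tot V →ₗ[k] Tot V ⊗[k] Tot V) (F : Module.Dual k (Tot V)) : star Φ F 0 = 0 := by
  have : pairFun F (0 : Module.Dual k (Tot V)) = 0 := TensorProduct.ext' fun x y => by simp
  rw [star, this, LinearMap.zero_comp]

theorem Represents.star_cup (hd : IsDualBases ε e e') (hσ : IsNakayama ε σ)
    (h : Represents e e' F n b) (h' : Represents e e' G n' b') :
    Represents e e' (star ((chainCooperad hd).cup (chainComultiplication hd)) F G) (n + n')
      (b * b') := by
  rcases h with ⟨rfl, rfl⟩ | ⟨p, f, rfl, rfl, rfl⟩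
  · left; simp [star_zero_left]
  rcases h' with ⟨rfl, rfl⟩ | ⟨q, g, rfl, rfl, rfl⟩
  · left; simp [star_zero_right]
  exact Or.inr ⟨p + q, _, by simp, FrobHoch.star_cup hd f g, (polyOf_cupFun hd hσ rfl f g).symm⟩

theorem Represents.star_cobrace (hd : IsDualBases ε e e')
    (h : Represents e e' F n b) (h' : Represents e e' G n' b') {s : ℕ}
    (hs : Even ((s : ℤ) + n' + 1)) :
    Represents e e' (star (chainCooperad hd).cobrace F G) (n + n' - 1) (der e s b' b) := by
  rcases h with ⟨rfl, rfl⟩ | ⟨p, f, rfl, rfl, rfl⟩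
  · left; simp [star_zero_left]
  rcases h' with ⟨rfl, rfl⟩ | ⟨q, g, rfl, rfl, rfl⟩
  · left; simp [star_zero_right]
  by_cases hpq : p + q = 0
  · obtain ⟨rfl, rfl⟩ : p = 0 ∧ q = 0 := by omega
    left
    exact ⟨star_cobrace_zero hd f g, by simp [polyOf, wordSum]⟩
  · obtain ⟨l, hl⟩ : ∃ l, p + q = l + 1 := ⟨p + q - 1, by omega⟩
    refine Or.inr ⟨l, _, by omega, FrobHoch.star_cobrace hd hl f g, ?_⟩
    rw [polyOf_insertFun hl, der_congr]
    rw [add_assoc] at hs; exact_mod_cast hs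

theorem pureFun_comp_totalDiff {X : ℕ → Type w} [∀ n, AddCommGroup (X n)] [∀ n, Module k (X n)]
    (d : ∀ n, X (n + 1) →ₗ[k] X n) (l : ℕ) (f : Module.Dual k (X l)) :
    pureFun l f ∘ₗ totalDiff d = pureFun (l + 1) (f ∘ₗ d l) := by
  refine DirectSum.linearMap_ext k fun n => LinearMap.ext fun x => ?_
  simp only [LinearMap.comp_apply, totalDiff, DirectSum.toModule_lof]
  rcases n with _ | n
  · rw [pureFun_lof_of_ne (by omega)]; simp
  · by_cases hn : n = l
    · subst hn
      simp only [LinearMap.comp_apply, pureFun_lof]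
    · rw [pureFun_lof_of_ne (by omega)]
      simp only [LinearMap.comp_apply]
      rw [pureFun_lof_of_ne hn]

theorem Represents.comp_totalDiff (hd : IsDualBases ε e e') (hσ : IsNakayama ε σ)
    (h : Represents e e' F n b) {s : ℕ} (hs : Even ((s : ℤ) + n)) :
    Represents e e' (F ∘ₗ totalDiff (hochschildD σ)) (n + 1) (delta e s b) := by
  rcases h with ⟨rfl, rfl⟩ | ⟨p, f, rfl, rfl, rfl⟩
  · left; simp
  refine Or.inr ⟨p + 1, _, by simp, pureFun_comp_totalDiff _ _ _, ?_⟩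
  rw [polyOf_comp_hochschildD hd hσ, delta_congr]
  exact_mod_cast hs

/-- In the range where the degree r + p + q - 2 is a natural number, `der₂_wordSum` and the
surjectivity of `polyOf` apply. In the remaining cases fewer than two letters are available and the
polynomial is zero. -/
theorem exists_represents_der₂ (hd : IsDualBases ε e e') {p q r : ℕ}
    (f : Module.Dual k (HochschildChain k A p)) (g : Module.Dual k (HochschildChain k A q))
    (h : Module.Dual k (HochschildChain k A r)) (s t : ℕ) :
    ∃ U, Represents e e' U (r + p + q - 2)
      (der₂ e s (polyOf e e' p f) t (polyOf e e' q g) (polyOf e e' r h)) := by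
  rcases r with _ | r
  · exact ⟨0, Or.inl ⟨rfl, by simp [polyOf, wordSum]⟩⟩
  by_cases hn : 2 ≤ r + 1 + p + q
  · obtain ⟨n, hn⟩ : ∃ n, n + 2 = r + 1 + p + q := ⟨_, Nat.sub_add_cancel hn⟩
    obtain ⟨K, hK⟩ := der₂_wordSum e s t p q (r + 1) n hn (cochainOf e e' f) (cochainOf e e' g)
      (cochainOf e e' h)
    obtain ⟨u, hu⟩ := hd.exists_polyOf_eq n K
    exact ⟨pureFun n u, Or.inr ⟨n, u, by push_cast; omega, rfl, hK.trans hu.symm⟩⟩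
  · obtain rfl : r = 0 := by omega
    refine ⟨0, Or.inl ⟨rfl, ?_⟩⟩
    simp only [polyOf, zero_add]
    rw [show wordSum k 1 (cochainOf e e' h) =
        ∑ c, genX k A c * (cochainOf e e' h [c] ⊗ₜ 1) from rfl,
      map_sum]
    refine Finset.sum_eq_zero fun c _ => ?_
    rw [der₂_mul]
    simp

end Rep

/-! ### Separating tensors by products of functionals -/

section Separation

variable {k : Type u} [Field k]

theorem coord_tensorProduct {M N I J : Type*} [AddCommGroup M] [Module k M] [AddCommGroup N]
    [Module k N] (b : Module.Basis I k M) (c : Module.Basis J k N) (i : I) (j : J) :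
    (b.tensorProduct c).coord (i, j) = pairFun (b.coord i) (c.coord j) :=
  TensorProduct.ext' fun x y => by simp [mul_comm]

variable {V : ℕ → Type w} [∀ n, AddCommGroup (V n)] [∀ n, Module k (V n)]

variable (k V) in
/-- A homogeneous basis of the total module. -/
noncomputable def totBasis :
    Module.Basis (Σ n, Module.Basis.ofVectorSpaceIndex k (V n)) k (Tot V) :=
  DFinsupp.basis fun n => Module.Basis.ofVectorSpace k (V n)

theorem coord_totBasis (i : Σ n, Module.Basis.ofVectorSpaceIndex k (V n)) :
    (totBasis k V).coord i =
      pureFun i.1 ((Module.Basis.ofVectorSpace k (V i.1)).coord i.2) := rfl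

/-- For a homogeneous basis of the total module, coordinates on the tensor square are products of
homogeneous functionals. -/
theorem eq_of_pairFun_eq {t t' : Tot V ⊗[k] Tot V}
    (h : ∀ p q (f : Module.Dual k (V p)) (g : Module.Dual k (V q)),
      pairFun (pureFun p f) (pureFun q g) t = pairFun (pureFun p f) (pureFun q g) t') : t = t' := by
  refine ((totBasis k V).tensorProduct (totBasis k V)).ext_elem fun ⟨i, j⟩ => ?_
  simp only [← Module.Basis.coord_apply, coord_tensorProduct, coord_totBasis]
  exact h _ _ _ _

theorem eq_of_pairFun_pairFun_eq {t t' : Tot V ⊗[k] (Tot V ⊗[k] Tot V)}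
    (h : ∀ p q r (f : Module.Dual k (V p)) (g : Module.Dual k (V q)) (h : Module.Dual k (V r)),
      pairFun (pureFun p f) (pairFun (pureFun q g) (pureFun r h)) t =
        pairFun (pureFun p f) (pairFun (pureFun q g) (pureFun r h)) t') : t = t' := by
  refine ((totBasis k V).tensorProduct ((totBasis k V).tensorProduct
    (totBasis k V))).ext_elem fun ⟨i, j, l⟩ => ?_
  simp only [← Module.Basis.coord_apply, coord_tensorProduct, coord_totBasis]
  exact h _ _ _ _ _ _

theorem eq_of_pureFun_eq {t t' : Tot V}
    (h : ∀ p (f : Module.Dual k (V p)), pureFun p f t = pureFun p f t') : t = t' := by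
  refine (totBasis k V).ext_elem fun i => ?_
  simp only [← Module.Basis.coord_apply, coord_totBasis]
  exact h _ _

end Separation

/-! ### Contracting a complex onto its homology -/

section Retract

variable {k : Type u} [Field k] {X : ℕ → Type w} [∀ n, AddCommGroup (X n)]
  [∀ n, Module k (X n)] (d : ∀ n, X (n + 1) →ₗ[k] X n)
  (W : ℕ → Type w') [∀ n, AddCommGroup (W n)] [∀ n, Module k (W n)]

/-- An identification of `W` with the homology of a complex, by projections extended to all chains
and by a choice of representing cycles. -/
structure HomologyRetract where
  proj : ∀ n, X n →ₗ[k] W n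
  repr : ∀ n, W n →ₗ[k] X n
  proj_d : ∀ n, proj n ∘ₗ d n = 0
  repr_mem : ∀ n x, repr n x ∈ cycles d n
  proj_repr : ∀ n x, proj n (repr n x) = x
  exact : ∀ n, ∀ z ∈ cycles d n, proj n z = 0 → z ∈ LinearMap.range (d n)

/-- The map `(-1) ^ (|x| + e) x`. -/
noncomputable def totSign (e : ℕ) : Tot X →ₗ[k] Tot X :=
  DirectSum.toModule k ℕ _ fun n => (-1 : k) ^ (n + e) • DirectSum.lof k ℕ X n

theorem totSign_lof (e n : ℕ) (x : X n) : totSign (k := k) e (DirectSum.lof k ℕ X n x) =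
    (-1 : k) ^ (n + e) • DirectSum.lof k ℕ X n x := by
  simp [totSign]

theorem totalDiff_lof_succ (n : ℕ) (x : X (n + 1)) :
    totalDiff d (DirectSum.lof k ℕ X (n + 1) x) = DirectSum.lof k ℕ X n (d n x) := by
  simp [totalDiff]

theorem totalDiff_lof_zero (x : X 0) : totalDiff d (DirectSum.lof k ℕ X 0 x) = 0 := by
  simp [totalDiff]

theorem totalDiff_lof_of_mem {n : ℕ} {x : X n} (hx : x ∈ cycles d n) :
    totalDiff d (DirectSum.lof k ℕ X n x) = 0 := by
  rcases n with _ | n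
  · exact totalDiff_lof_zero d x
  · rw [totalDiff_lof_succ, show d n x = 0 from hx, map_zero]

theorem totSign_totSign (e : ℕ) (y : Tot X) : totSign (k := k) e (totSign (k := k) e y) = y := by
  have : totSign (k := k) (X := X) e ∘ₗ totSign e = LinearMap.id := by
    refine DirectSum.linearMap_ext k fun n => LinearMap.ext fun x => ?_
    simp [totSign_lof, smul_smul, ← mul_pow]
  exact LinearMap.congr_fun this y

theorem totalDiff_totSign (e : ℕ) (y : Tot X) :
    totalDiff d (totSign (k := k) e y) = -totSign (k := k) e (totalDiff d y) := by
  have : totalDiff d ∘ₗ totSign e = -(totSign e ∘ₗ totalDiff d) := by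
    refine DirectSum.linearMap_ext k fun n => LinearMap.ext fun x => ?_
    rcases n with _ | n
    · simp [totSign_lof, totalDiff_lof_zero]
    · simp only [LinearMap.comp_apply, LinearMap.neg_apply, totSign_lof, map_smul,
        totalDiff_lof_succ]
      rw [show n + 1 + e = n + e + 1 by ring, pow_succ]; simp
  exact LinearMap.congr_fun this y

theorem tensorDiff_tmul (e : ℕ) (x y : Tot X) :
    tensorDiff d e (x ⊗ₜ y) = totalDiff d x ⊗ₜ y + totSign (k := k) e x ⊗ₜ totalDiff d y := rfl

theorem pairFun_comp_tensorDiff (e : ℕ) (F G : Module.Dual k (Tot X)) :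
    pairFun F G ∘ₗ tensorDiff d e =
      pairFun (F ∘ₗ totalDiff d) G + pairFun (F ∘ₗ totSign e) (G ∘ₗ totalDiff d) :=
  TensorProduct.ext' fun x y => by simp [tensorDiff_tmul]

/-- Over a field, f has a section over its range, and this section extends to the whole target. -/
theorem exists_quasiInverse {M N : Type*} [AddCommGroup M] [Module k M] [AddCommGroup N]
    [Module k N] (f : M →ₗ[k] N) : ∃ g : N →ₗ[k] M, ∀ x, f (g (f x)) = f x := by
  obtain ⟨g, hg⟩ := f.rangeRestrict.exists_rightInverse_of_surjective f.range_rangeRestrict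
  obtain ⟨g', hg'⟩ := LinearMap.exists_extend g
  refine ⟨g', fun x => ?_⟩
  have h1 : g' (f x) = g (f.rangeRestrict x) := LinearMap.congr_fun hg' (f.rangeRestrict x)
  rw [h1]
  exact congrArg Subtype.val (LinearMap.congr_fun hg (f.rangeRestrict x))

variable {d W} (R : HomologyRetract d W)

namespace HomologyRetract

/-- The total projection. -/
noncomputable def P : Tot X →ₗ[k] Tot W := DirectSum.lmap R.proj

/-- The total section. -/
noncomputable def S : Tot W →ₗ[k] Tot X := DirectSum.lmap R.repr

theorem P_lof (n : ℕ) (x : X n) :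
    R.P (DirectSum.lof k ℕ X n x) = DirectSum.lof k ℕ W n (R.proj n x) := by
  simp [P]

theorem S_lof (n : ℕ) (x : W n) :
    R.S (DirectSum.lof k ℕ W n x) = DirectSum.lof k ℕ X n (R.repr n x) := by
  simp [S]

theorem P_totalDiff (y : Tot X) : R.P (totalDiff d y) = 0 := by
  have : R.P ∘ₗ totalDiff d = 0 := by
    refine DirectSum.linearMap_ext k fun n => LinearMap.ext fun x => ?_
    rcases n with _ | n
    · simp [totalDiff_lof_zero]
    · simp only [LinearMap.comp_apply, totalDiff_lof_succ, P_lof]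
      rw [show R.proj n (d n x) = 0 from LinearMap.congr_fun (R.proj_d n) x]; simp
  exact LinearMap.congr_fun this y

theorem totalDiff_S (y : Tot W) : totalDiff d (R.S y) = 0 := by
  have : totalDiff d ∘ₗ R.S = 0 := by
    refine DirectSum.linearMap_ext k fun n => LinearMap.ext fun x => ?_
    simp only [LinearMap.comp_apply, S_lof]
    rw [totalDiff_lof_of_mem d (R.repr_mem n x)]; simp
  exact LinearMap.congr_fun this y

theorem P_S (y : Tot W) : R.P (R.S y) = y := by
  have : R.P ∘ₗ R.S = LinearMap.id := by
    refine DirectSum.linearMap_ext k fun n => LinearMap.ext fun x => ?_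
    simp only [LinearMap.comp_apply, S_lof, P_lof, R.proj_repr]; simp
  exact LinearMap.congr_fun this y

theorem totSign_S_P (e : ℕ) (y : Tot X) :
    totSign (k := k) e (R.S (R.P y)) = R.S (R.P (totSign (k := k) e y)) := by
  have : totSign (k := k) e ∘ₗ R.S ∘ₗ R.P = R.S ∘ₗ R.P ∘ₗ totSign e := by
    refine DirectSum.linearMap_ext k fun n => LinearMap.ext fun x => ?_
    simp [totSign_lof, P_lof, S_lof]
  exact LinearMap.congr_fun this y

/-- With r a quasi-inverse of d, the map 1 - rd sends chains to cycles and 1 - SP sends cycles to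
boundaries, for which r chooses primitives. Subtracting SPr corrects Hd, so that the two halves add
up to 1 - SP. Raising degree by one makes H anticommute with the sign operator. -/
theorem exists_homotopy (hd : ∀ n x, d n (d (n + 1) x) = 0) :
    ∃ H : Tot X →ₗ[k] Tot X,
      (∀ y, totalDiff d (H y) + H (totalDiff d y) = y - R.S (R.P y)) ∧
      ∀ e y, H (totSign (k := k) e y) = -totSign (k := k) e (H y) := by
  choose r hr using fun n => exists_quasiInverse (d n)
  let E : ∀ n, X n →ₗ[k] X n := fun n => match n with
    | 0 => 0
    | n + 1 => r n ∘ₗ d n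
  let h : ∀ n, X n →ₗ[k] X (n + 1) := fun n =>
    r n ∘ₗ (LinearMap.id - R.repr n ∘ₗ R.proj n) ∘ₗ (LinearMap.id - E n)
      - R.repr (n + 1) ∘ₗ R.proj (n + 1) ∘ₗ r n
  have hE (n : ℕ) (x : X n) : x - E n x ∈ cycles d n := by
    rcases n with _ | n
    · exact Submodule.mem_top
    · change d n (x - r n (d n x)) = 0
      rw [map_sub, hr, sub_self]
  have hdr (n : ℕ) (z : X n) (hz : z ∈ cycles d n) (h0 : R.proj n z = 0) : d n (r n z) = z := by
    obtain ⟨y, rfl⟩ := R.exact n z hz h0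
    exact hr n y
  have hdrepr (n : ℕ) (x : W (n + 1)) : d n (R.repr (n + 1) x) = 0 := R.repr_mem (n + 1) x
  have hdh (n : ℕ) (x : X n) :
      d n (h n x) = (x - E n x) - R.repr n (R.proj n (x - E n x)) := by
    change d n (r n ((x - E n x) - R.repr n (R.proj n (x - E n x)))
      - R.repr (n + 1) (R.proj (n + 1) (r n x))) = _
    rw [map_sub, hdrepr, sub_zero, hdr]
    · exact (cycles d n).sub_mem (hE n x) (R.repr_mem _ _)
    · rw [map_sub, R.proj_repr, sub_self]
  have hhd (n : ℕ) (x : X (n + 1)) :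
      h n (d n x) = E (n + 1) x - R.repr (n + 1) (R.proj (n + 1) (E (n + 1) x)) := by
    have hE0 : E n (d n x) = 0 := by
      rcases n with _ | n
      · rfl
      · change r n (d n (d (n + 1) x)) = 0
        rw [hd, map_zero]
    change r n ((d n x - E n (d n x)) - R.repr n (R.proj n (d n x - E n (d n x))))
      - R.repr (n + 1) (R.proj (n + 1) (r n (d n x))) = _
    rw [hE0, sub_zero, show R.proj n (d n x) = 0 from LinearMap.congr_fun (R.proj_d n) x, map_zero,
      sub_zero]
    rfl
  let H : Tot X →ₗ[k] Tot X :=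
    DirectSum.toModule k ℕ _ fun n => DirectSum.lof k ℕ X (n + 1) ∘ₗ h n
  have hH (n : ℕ) (x : X n) : H (DirectSum.lof k ℕ X n x) =
      DirectSum.lof k ℕ X (n + 1) (h n x) := by
    simp [H]
  refine ⟨H, fun y => ?_, fun e y => ?_⟩
  · have : totalDiff d ∘ₗ H + H ∘ₗ totalDiff d = LinearMap.id - R.S ∘ₗ R.P := by
      refine DirectSum.linearMap_ext k fun n => LinearMap.ext fun x => ?_
      simp only [LinearMap.comp_apply, LinearMap.add_apply, LinearMap.sub_apply, LinearMap.id_apply,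
        hH, totalDiff_lof_succ, P_lof, S_lof]
      rcases n with _ | n
      · rw [totalDiff_lof_zero, map_zero, add_zero, hdh, ← map_sub]
        simp [E]
      · rw [totalDiff_lof_succ, hH, hhd, hdh, ← map_add, ← map_sub]
        congr 1
        simp only [map_sub]
        abel
    exact LinearMap.congr_fun this y
  · have : H ∘ₗ totSign e = -(totSign e ∘ₗ H) := by
      refine DirectSum.linearMap_ext k fun n => LinearMap.ext fun x => ?_
      simp only [LinearMap.comp_apply, LinearMap.neg_apply, totSign_lof, map_smul, hH]
      rw [show n + 1 + e = n + e + 1 by ring, pow_succ]; simp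
    exact LinearMap.congr_fun this y

theorem sub_mem_range_tensorDiff (hd : ∀ n x, d n (d (n + 1) x) = 0) (e : ℕ)
    {t : Tot X ⊗[k] Tot X} (ht : tensorDiff d e t = 0) :
    t - TensorProduct.map (R.S ∘ₗ R.P) (R.S ∘ₗ R.P) t ∈ LinearMap.range (tensorDiff d e) := by
  obtain ⟨H, hH, hHs⟩ := R.exists_homotopy hd
  -- The tensor product homotopy: the first factor is contracted, then the second after projecting
  -- the first. The sign is that of moving H past the first factor.
  let K : Tot X ⊗[k] Tot X →ₗ[k] Tot X ⊗[k] Tot X :=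
    H.rTensor _ + TensorProduct.map (R.S ∘ₗ R.P ∘ₗ totSign e) H
  have hK : tensorDiff d e ∘ₗ K + K ∘ₗ tensorDiff d e =
      LinearMap.id - TensorProduct.map (R.S ∘ₗ R.P) (R.S ∘ₗ R.P) := by
    refine TensorProduct.ext' fun x y => ?_
    simp only [K, LinearMap.add_apply, LinearMap.comp_apply, LinearMap.sub_apply,
      LinearMap.id_apply, LinearMap.rTensor_tmul, TensorProduct.map_tmul, map_add, tensorDiff_tmul,
      R.totalDiff_S, TensorProduct.zero_tmul, totSign_S_P, totSign_totSign, hHs,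
      ← R.totSign_S_P e (totalDiff d x), R.P_totalDiff, map_zero, zero_add, add_zero,
      TensorProduct.neg_tmul]
    have h1 : x ⊗ₜ[k] y = (x - R.S (R.P x)) ⊗ₜ y + R.S (R.P x) ⊗ₜ (y - R.S (R.P y))
        + R.S (R.P x) ⊗ₜ R.S (R.P y) := by
      rw [TensorProduct.sub_tmul, TensorProduct.tmul_sub]; abel
    rw [h1, ← hH x, ← hH y, TensorProduct.add_tmul, TensorProduct.tmul_add]
    abel
  refine ⟨K t, ?_⟩
  have := LinearMap.congr_fun hK t
  simpa [ht] using this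

/-- A cocycle is determined up to a coboundary by its values on representing cycles. -/
theorem exists_coboundary (hd : ∀ n x, d n (d (n + 1) x) = 0) {F : Module.Dual k (Tot X)}
    (hF : F ∘ₗ totalDiff d = 0) :
    ∃ U : Module.Dual k (Tot X), F = F ∘ₗ R.S ∘ₗ R.P + U ∘ₗ totalDiff d := by
  obtain ⟨H, hH, -⟩ := R.exists_homotopy hd
  refine ⟨F ∘ₗ H, LinearMap.ext fun y => ?_⟩
  have h1 : F (totalDiff d (H y)) = 0 := LinearMap.congr_fun hF (H y)
  have h2 := congrArg F (hH y)
  rw [map_add, h1, zero_add, map_sub] at h2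
  simp [h2]

/-- The operation on `W` induced by an operation on chains. -/
noncomputable def induced (Φ : Tot X →ₗ[k] Tot X ⊗[k] Tot X) : Tot W →ₗ[k] Tot W ⊗[k] Tot W :=
  TensorProduct.map R.P R.P ∘ₗ Φ ∘ₗ R.S

theorem star_induced (Φ : Tot X →ₗ[k] Tot X ⊗[k] Tot X) (φ χ : Module.Dual k (Tot W)) :
    star (R.induced Φ) φ χ = star Φ (φ ∘ₗ R.P) (χ ∘ₗ R.P) ∘ₗ R.S := by
  rw [star, star, induced, ← LinearMap.comp_assoc, pairFun_comp_map, LinearMap.comp_assoc]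

theorem map_P_tensorDiff (e : ℕ) (t : Tot X ⊗[k] Tot X) :
    TensorProduct.map R.P R.P (tensorDiff d e t) = 0 := by
  have : TensorProduct.map R.P R.P ∘ₗ tensorDiff d e = 0 :=
    TensorProduct.ext' fun x y => by simp [tensorDiff_tmul, R.P_totalDiff]
  exact LinearMap.congr_fun this t

end HomologyRetract

/-- `Φ` is a morphism of complexes. -/
def IsChainOp (d : ∀ n, X (n + 1) →ₗ[k] X n) (e : ℕ) (Φ : Tot X →ₗ[k] Tot X ⊗[k] Tot X) : Prop :=
  Φ ∘ₗ totalDiff d = tensorDiff d e ∘ₗ Φ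

/-! ### Transposed chain maps on cocycles and coboundaries -/

section ChainOp

variable {e : ℕ} {Φ : Tot X →ₗ[k] Tot X ⊗[k] Tot X} (hΦ : IsChainOp d e Φ)
include hΦ

theorem IsChainOp.star_comp_totalDiff (F G : Module.Dual k (Tot X)) :
    star Φ F G ∘ₗ totalDiff d =
      star Φ (F ∘ₗ totalDiff d) G + star Φ (F ∘ₗ totSign e) (G ∘ₗ totalDiff d) := by
  rw [star, LinearMap.comp_assoc, hΦ, ← LinearMap.comp_assoc, pairFun_comp_tensorDiff,
    LinearMap.add_comp]
  rfl

theorem IsChainOp.star_cocycle {F G : Module.Dual k (Tot X)} (hF : F ∘ₗ totalDiff d = 0)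
    (hG : G ∘ₗ totalDiff d = 0) : star Φ F G ∘ₗ totalDiff d = 0 := by
  rw [hΦ.star_comp_totalDiff, hF, hG, star_zero_left, star_zero_right, add_zero]

theorem IsChainOp.star_coboundary_left (U : Module.Dual k (Tot X)) {G : Module.Dual k (Tot X)}
    (hG : G ∘ₗ totalDiff d = 0) :
    star Φ (U ∘ₗ totalDiff d) G = star Φ U G ∘ₗ totalDiff d := by
  rw [hΦ.star_comp_totalDiff, hG, star_zero_right, add_zero]

/-- Moving the differential past F costs the sign operator, an involution preserving cocycles, so it
is absorbed into F. -/
theorem IsChainOp.star_coboundary_right (U : Module.Dual k (Tot X)) {F : Module.Dual k (Tot X)}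
    (hF : F ∘ₗ totalDiff d = 0) :
    star Φ F (U ∘ₗ totalDiff d) = star Φ (F ∘ₗ totSign e) U ∘ₗ totalDiff d := by
  have h1 : (F ∘ₗ totSign e) ∘ₗ totalDiff d = 0 := LinearMap.ext fun y => by
    have h2 : F (totalDiff d (totSign (k := k) e y)) = 0 := LinearMap.congr_fun hF _
    rw [totalDiff_totSign, map_neg, neg_eq_zero] at h2
    exact h2
  have h3 : (F ∘ₗ totSign e) ∘ₗ totSign e = F := LinearMap.ext fun y => by
    simp [totSign_totSign]
  rw [hΦ.star_comp_totalDiff, h1, star_zero_left, zero_add, h3]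

end ChainOp

theorem star_add_left (Φ : Tot X →ₗ[k] Tot X ⊗[k] Tot X) (F F' G : Module.Dual k (Tot X)) :
    star Φ (F + F') G = star Φ F G + star Φ F' G := by
  have : pairFun (F + F') G = pairFun F G + pairFun F' G :=
    TensorProduct.ext' fun x y => by simp [add_mul]
  rw [star, this, LinearMap.add_comp]; rfl

theorem star_add_right (Φ : Tot X →ₗ[k] Tot X ⊗[k] Tot X) (F G G' : Module.Dual k (Tot X)) :
    star Φ F (G + G') = star Φ F G + star Φ F G' := by
  have : pairFun F (G + G') = pairFun F G + pairFun F G' :=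
    TensorProduct.ext' fun x y => by simp [mul_add]
  rw [star, this, LinearMap.add_comp]; rfl

theorem pairFun_applyLeft (Φ : Tot X →ₗ[k] Tot X ⊗[k] Tot X) (F G H : Module.Dual k (Tot X)) :
    pairFun F (pairFun G H) ∘ₗ applyLeft k X Φ = pairFun (star Φ F G) H := by
  have h1 : pairFun F (pairFun G H) ∘ₗ (TensorProduct.assoc k (Tot X) (Tot X) (Tot X)).toLinearMap =
      pairFun (pairFun F G) H := TensorProduct.ext_threefold fun x y z => by simp [mul_assoc]
  rw [applyLeft, ← LinearMap.comp_assoc, h1]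
  exact TensorProduct.ext' fun x y => by simp [star]

theorem pairFun_lTensor (Φ : Tot X →ₗ[k] Tot X ⊗[k] Tot X) (F G H : Module.Dual k (Tot X)) :
    pairFun F (pairFun G H) ∘ₗ Φ.lTensor (Tot X) = pairFun F (star Φ G H) :=
  TensorProduct.ext' fun x y => by simp [star]

namespace HomologyRetract

theorem comp_P_cocycle (φ : Module.Dual k (Tot W)) : (φ ∘ₗ R.P) ∘ₗ totalDiff d = 0 :=
  LinearMap.ext fun y => by simp [R.P_totalDiff]

variable (hd : ∀ n x, d n (d (n + 1) x) = 0) {e e' : ℕ} {Φ Ψ : Tot X →ₗ[k] Tot X ⊗[k] Tot X}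
  (hΦ : IsChainOp d e Φ) (hΨ : IsChainOp d e' Ψ)
include hd hΦ hΨ

/-- Passing through homology between the operations changes the inner cocycle by a coboundary. The
outer chain map sends this to a coboundary, which vanishes on representing cycles. -/
theorem star_star_left (φ χ ω : Module.Dual k (Tot W)) :
    star (R.induced Ψ) (star (R.induced Φ) φ χ) ω =
      star Ψ (star Φ (φ ∘ₗ R.P) (χ ∘ₗ R.P)) (ω ∘ₗ R.P) ∘ₗ R.S := by
  obtain ⟨U, hU⟩ := R.exists_coboundary hd
    (hΦ.star_cocycle (R.comp_P_cocycle φ) (R.comp_P_cocycle χ))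
  rw [star_induced, star_induced]
  conv_rhs => rw [hU, star_add_left, hΨ.star_coboundary_left U (R.comp_P_cocycle ω)]
  exact LinearMap.ext fun y => by simp [R.totalDiff_S, LinearMap.comp_assoc]

theorem star_star_right (φ χ ω : Module.Dual k (Tot W)) :
    star (R.induced Ψ) φ (star (R.induced Φ) χ ω) =
      star Ψ (φ ∘ₗ R.P) (star Φ (χ ∘ₗ R.P) (ω ∘ₗ R.P)) ∘ₗ R.S := by
  obtain ⟨U, hU⟩ := R.exists_coboundary hd
    (hΦ.star_cocycle (R.comp_P_cocycle χ) (R.comp_P_cocycle ω))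
  rw [star_induced, star_induced]
  conv_rhs => rw [hU, star_add_right, hΨ.star_coboundary_right U (R.comp_P_cocycle φ)]
  exact LinearMap.ext fun y => by simp [R.totalDiff_S, LinearMap.comp_assoc]

end HomologyRetract

end Retract

/-! ### Signed flips and degrees -/

section General

variable {k : Type u} [Field k] {V : ℕ → Type w} [∀ n, AddCommGroup (V n)] [∀ n, Module k (V n)]

theorem star_smul_left (Φ : Tot V →ₗ[k] Tot V ⊗[k] Tot V) (c : k) (F G : Module.Dual k (Tot V)) :
    star Φ (c • F) G = c • star Φ F G := by
  have : pairFun (c • F) G = c • pairFun F G :=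
    TensorProduct.ext' fun x y => by simp [mul_assoc]
  rw [star, this, LinearMap.smul_comp]; rfl

theorem pureFun_comp_totSign (p e : ℕ) (f : Module.Dual k (V p)) :
    pureFun p f ∘ₗ totSign e = (-1 : k) ^ (p + e) • pureFun p f := by
  refine DirectSum.linearMap_ext k fun n => LinearMap.ext fun x => ?_
  simp only [LinearMap.comp_apply, totSign_lof, map_smul, LinearMap.smul_apply]
  by_cases hn : n = p
  · subst hn; rfl
  · rw [pureFun_lof_of_ne hn, smul_zero, smul_zero]

theorem pairFun_lTensor_signedFlip (s : ℕ → ℕ → ℕ) (F : Module.Dual k (Tot V)) (p q : ℕ)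
    (f : Module.Dual k (V p)) (g : Module.Dual k (V q)) :
    pairFun F (pairFun (pureFun p f) (pureFun q g)) ∘ₗ (signedFlip k V s).lTensor (Tot V) =
      (-1 : k) ^ s q p • pairFun F (pairFun (pureFun q g) (pureFun p f)) := by
  refine TensorProduct.ext' fun x y => ?_
  have h := LinearMap.congr_fun (pairFun_comp_signedFlip s p q f g) y
  rw [LinearMap.comp_apply] at h
  simp only [LinearMap.comp_apply, LinearMap.lTensor_tmul, pairFun_tmul, h, LinearMap.smul_apply,
    smul_eq_mul]
  ring

theorem pairFun_onFirstTwo_signedFlip (s : ℕ → ℕ → ℕ) (F : Module.Dual k (Tot V)) (p q : ℕ)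
    (f : Module.Dual k (V p)) (g : Module.Dual k (V q)) :
    pairFun (pureFun p f) (pairFun (pureFun q g) F) ∘ₗ onFirstTwo k V (signedFlip k V s) =
      (-1 : k) ^ s q p • pairFun (pureFun q g) (pairFun (pureFun p f) F) := by
  have h1 (a b : Module.Dual k (Tot V)) :
      pairFun a (pairFun b F) ∘ₗ (TensorProduct.assoc k (Tot V) (Tot V) (Tot V)).toLinearMap =
      pairFun (pairFun a b) F := TensorProduct.ext_threefold fun x y z => by simp [mul_assoc]
  rw [onFirstTwo, ← LinearMap.comp_assoc, h1, ← LinearMap.comp_assoc]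
  have h2 : pairFun (pairFun (pureFun p f) (pureFun q g)) F ∘ₗ (signedFlip k V s).rTensor (Tot V) =
      (-1 : k) ^ s q p • pairFun (pairFun (pureFun q g) (pureFun p f)) F := by
    refine TensorProduct.ext' fun x y => ?_
    have h := LinearMap.congr_fun (pairFun_comp_signedFlip s p q f g) x
    rw [LinearMap.comp_apply] at h
    simp only [LinearMap.comp_apply, LinearMap.rTensor_tmul, pairFun_tmul, h, LinearMap.smul_apply,
      smul_eq_mul]
    ring
  rw [h2, LinearMap.smul_comp, ← h1, LinearMap.comp_assoc]
  congr 1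
  refine LinearMap.ext fun x => ?_
  simp

theorem linearMap_eq_of_pairFun_pairFun {M : Type*} [AddCommGroup M] [Module k M]
    {T T' : M →ₗ[k] Tot V ⊗[k] (Tot V ⊗[k] Tot V)}
    (h : ∀ p q r (f : Module.Dual k (V p)) (g : Module.Dual k (V q)) (h : Module.Dual k (V r)),
      pairFun (pureFun p f) (pairFun (pureFun q g) (pureFun r h)) ∘ₗ T =
        pairFun (pureFun p f) (pairFun (pureFun q g) (pureFun r h)) ∘ₗ T') : T = T' :=
  LinearMap.ext fun x => eq_of_pairFun_pairFun_eq fun p q r f g l =>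
    LinearMap.congr_fun (h p q r f g l) x

theorem linearMap_eq_of_pairFun {M : Type*} [AddCommGroup M] [Module k M]
    {T T' : M →ₗ[k] Tot V ⊗[k] Tot V}
    (h : ∀ p q (f : Module.Dual k (V p)) (g : Module.Dual k (V q)),
      pairFun (pureFun p f) (pureFun q g) ∘ₗ T = pairFun (pureFun p f) (pureFun q g) ∘ₗ T') :
    T = T' :=
  LinearMap.ext fun x => eq_of_pairFun_eq fun p q f g => LinearMap.congr_fun (h p q f g) x

theorem signedFlip_map {W : ℕ → Type w'} [∀ n, AddCommGroup (W n)] [∀ n, Module k (W n)]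
    (s : ℕ → ℕ → ℕ) (π : ∀ n, V n →ₗ[k] W n) :
    signedFlip k W s ∘ₗ TensorProduct.map (DirectSum.lmap π) (DirectSum.lmap π) =
      TensorProduct.map (DirectSum.lmap π) (DirectSum.lmap π) ∘ₗ signedFlip k V s := by
  refine TensorProduct.ext (DirectSum.linearMap_ext k fun a => LinearMap.ext fun x =>
    DirectSum.linearMap_ext k fun b => LinearMap.ext fun y => ?_)
  change signedFlip k W s (TensorProduct.map (DirectSum.lmap π) (DirectSum.lmap π)
      (DirectSum.lof k ℕ V a x ⊗ₜ DirectSum.lof k ℕ V b y)) =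
    TensorProduct.map (DirectSum.lmap π) (DirectSum.lmap π)
      (signedFlip k V s (DirectSum.lof k ℕ V a x ⊗ₜ DirectSum.lof k ℕ V b y))
  simp [signedFlip_lof]

theorem incl₂_mem_tensorDegree {p q m : ℕ} (h : p + q = m) (t : V p ⊗[k] V q) :
    incl₂ k V p q t ∈ tensorDegree k V m :=
  (le_iSup₂_of_le (p, q) (Finset.HasAntidiagonal.mem_antidiagonal.mpr h) le_rfl :
    LinearMap.range (incl₂ k V p q) ≤ _) ⟨t, rfl⟩

theorem tensorDegree_induction {m : ℕ} {S : Submodule k (Tot V ⊗[k] Tot V)}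
    (h : ∀ p q, p + q = m → ∀ (x : V p) (y : V q),
      DirectSum.lof k ℕ V p x ⊗ₜ DirectSum.lof k ℕ V q y ∈ S) : tensorDegree k V m ≤ S := by
  refine iSup₂_le fun pq hpq => ?_
  rintro _ ⟨t, rfl⟩
  induction t using TensorProduct.induction_on with
  | zero => simp
  | tmul x y => exact h _ _ (Finset.HasAntidiagonal.mem_antidiagonal.mp hpq) x y
  | add a b ha hb => rw [map_add]; exact S.add_mem ha hb

theorem signedFlip_mem_tensorDegree (s : ℕ → ℕ → ℕ) {m : ℕ} {t : Tot V ⊗[k] Tot V}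
    (ht : t ∈ tensorDegree k V m) : signedFlip k V s t ∈ tensorDegree k V m := by
  refine tensorDegree_induction (S := (tensorDegree k V m).comap (signedFlip k V s))
    (fun p q h x y => ?_) ht
  rw [Submodule.mem_comap, signedFlip_lof]
  exact Submodule.smul_mem _ _ (incl₂_mem_tensorDegree (by omega) (y ⊗ₜ x))

theorem map_mem_tensorDegree {W : ℕ → Type w'} [∀ n, AddCommGroup (W n)] [∀ n, Module k (W n)]
    (π : ∀ n, V n →ₗ[k] W n) {m : ℕ} {t : Tot V ⊗[k] Tot V} (ht : t ∈ tensorDegree k V m) :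
    TensorProduct.map (DirectSum.lmap π) (DirectSum.lmap π) t ∈ tensorDegree k W m := by
  refine tensorDegree_induction (S := (tensorDegree k W m).comap
    (TensorProduct.map (DirectSum.lmap π) (DirectSum.lmap π))) (fun p q h x y => ?_) ht
  rw [Submodule.mem_comap, TensorProduct.map_tmul, DirectSum.lmap_lof, DirectSum.lmap_lof]
  exact incl₂_mem_tensorDegree h (π p x ⊗ₜ π q y)

theorem Cooperad.cup_degree (C : Cooperad k V) (ψ : C.Comultiplication) (n : ℕ) (x : V n) :
    C.cup ψ (DirectSum.lof k ℕ V n x) ∈ tensorDegree k V n := by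
  rw [Cooperad.cup, DirectSum.toModule_lof, LinearMap.sum_apply]
  exact Submodule.sum_mem _ fun pq hpq =>
    incl₂_mem_tensorDegree (Finset.HasAntidiagonal.mem_antidiagonal.mp hpq) _

theorem Cooperad.cobracket_degree (C : Cooperad k V) (n : ℕ) (x : V n) :
    C.cobracket (DirectSum.lof k ℕ V n x) ∈ tensorDegree k V (n + 1) := by
  have h : C.cobrace (DirectSum.lof k ℕ V n x) ∈ tensorDegree k V (n + 1) := by
    rw [Cooperad.cobrace, DirectSum.toModule_lof, LinearMap.sum_apply]
    refine Submodule.sum_mem _ fun pq hpq => ?_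
    rw [LinearMap.sum_apply]
    exact Submodule.sum_mem _ fun i _ => Submodule.smul_mem _ _
      (incl₂_mem_tensorDegree (Finset.HasAntidiagonal.mem_antidiagonal.mp hpq) _)
  exact Submodule.sub_mem _ h (signedFlip_mem_tensorDegree _ h)

end General

/-! ### The cup coproduct and the cobracket as chain maps -/

section ChainOps

variable {k : Type u} [Field k] {A : Type v} [Ring A] [Algebra k A] {ε : A →ₗ[k] k}
  {m : ℕ} {e e' : Module.Basis (Fin m) k A} {σ : A ≃ₐ[k] A}
  {F G : Module.Dual k (Tot (HochschildChain k A))} {n n' : ℤ} {b b' : NCPoly k A (Fin m)}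

theorem bracket_congr {ι : Type*} (e : Module.Basis ι k A) {p q p' q' : ℕ} (hp : Even (p + p'))
    (hq : Even (q + q')) (f g : NCPoly k A ι) :
    bracket e p q f g = bracket e p' q' f g := by
  rw [bracket, bracket, der_congr e (show Even (q + 1 + (q' + 1)) by grind),
    der_congr e (show Even (p + 1 + (p' + 1)) by grind),
    neg_one_pow_congr (show Even ((p + 1) * (q + 1) + (p' + 1) * (q' + 1)) by
      rcases Nat.even_or_odd (p + 1) with h | h <;> rcases Nat.even_or_odd (q + 1) with h' | h'
      · exact (h.mul_right _).add ((show Even (p' + 1) by grind).mul_right _)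
      · exact (h.mul_right _).add ((show Even (p' + 1) by grind).mul_right _)
      · exact (h'.mul_left _).add ((show Even (q' + 1) by grind).mul_left _)
      · exact (h.mul h').add_odd ((show Odd (p' + 1) by grind).mul (show Odd (q' + 1) by grind)))]

theorem Represents.star_cobracket (hd : IsDualBases ε e e') (h : Represents e e' F n b)
    (h' : Represents e e' G n' b') {s t : ℕ} (hs : Even ((s : ℤ) + n)) (ht : Even ((t : ℤ) + n')) :
    Represents e e' (star (chainCooperad hd).cobracket F G) (n + n' - 1) (bracket e s t b b') := by
  have h1 := h.star_cobrace hd h' (s := t + 1) (by push_cast; grind)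
  have h2 := h'.star_cobrace hd h (s := s + 1) (by push_cast; grind)
  rcases h with ⟨rfl, rfl⟩ | ⟨p, f, rfl, rfl, rfl⟩
  · left; simp [star_zero_left, bracket, der_zero]
  rcases h' with ⟨rfl, rfl⟩ | ⟨q, g, rfl, rfl, rfl⟩
  · left; simp [star_zero_right, bracket, der_zero]
  refine ((congrArg (Represents e e' · _ _) ?_).mp
    (h1.sub ((h2.smul ((-1 : k) ^ ((p + 1) * (q + 1)))).congr (by ring) rfl))).congr rfl ?_
  · rw [star, star, star, Cooperad.cobracket, ← LinearMap.comp_assoc, LinearMap.comp_sub, flipρ,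
      pairFun_comp_signedFlip, LinearMap.comp_id, LinearMap.sub_comp, LinearMap.smul_comp,
      mul_comm (q + 1)]
  · have hs' : Even (s + p) := by exact_mod_cast hs
    have ht' : Even (t + q) := by exact_mod_cast ht
    rw [bracket_congr e hs' ht', bracket, der_congr e (show Even (t + 1 + (q + 1)) by grind),
      der_congr e (show Even (s + 1 + (p + 1)) by grind)]

/-- The transpose of `delta_delta`: a chain annihilated by all functionals is zero. -/
theorem hochschildD_hochschildD (hd : IsDualBases ε e e') (hσ : IsNakayama ε σ) (n : ℕ)
    (x : HochschildChain k A (n + 2)) : hochschildD σ n (hochschildD σ (n + 1) x) = 0 := by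
  refine (Module.forall_dual_apply_eq_zero_iff k _).mp fun f => ?_
  have h := ((represents_pureFun (e := e) (e' := e') n f).comp_totalDiff hd hσ (s := n)
    (by exact Even.add_self _)).comp_totalDiff hd hσ (s := n + 1)
    (by push_cast; exact Even.add_self _)
  rw [polyOf, delta_delta e (hasParity_wordSum n _)] at h
  have h2 := LinearMap.congr_fun h.eq_zero (DirectSum.lof k ℕ _ (n + 2) x)
  simp only [LinearMap.comp_apply, totalDiff_lof_succ, pureFun_lof] at h2
  exact h2

/-- Tested on pairs of functionals, this is `delta_mul`. -/
theorem isChainOp_cup (hd : IsDualBases ε e e') (hσ : IsNakayama ε σ) :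
    IsChainOp (hochschildD σ) 0 ((chainCooperad hd).cup (chainComultiplication hd)) := by
  refine linearMap_eq_of_pairFun fun p q f g => ?_
  have hf := represents_pureFun (e := e) (e' := e') p f
  have hg := represents_pureFun (e := e) (e' := e') q g
  have h1 := (hf.star_cup hd hσ hg).comp_totalDiff hd hσ (s := p + q)
    (by push_cast; exact Even.add_self _)
  have h2 := (hf.comp_totalDiff hd hσ (s := p) (Even.add_self _)).star_cup hd hσ hg
  have h3 := (hf.star_cup hd hσ (hg.comp_totalDiff hd hσ (s := q) (Even.add_self _))).smul
    ((-1 : k) ^ p)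
  rw [← LinearMap.comp_assoc, ← LinearMap.comp_assoc, pairFun_comp_tensorDiff,
    pureFun_comp_totSign, LinearMap.add_comp]
  change star _ _ _ ∘ₗ _ = star _ _ _ + star _ _ _
  rw [star_smul_left]
  exact h1.unique ((h2.add (h3.congr (by ring) rfl)).congr (by ring)
    (delta_mul e (hasParity_wordSum q _)).symm)

/-- Tested on pairs of functionals, this is `delta_bracket`. The shift 1 reflects that the bracket
has degree zero only in suspended degrees. -/
theorem isChainOp_cobracket (hd : IsDualBases ε e e') (hσ : IsNakayama ε σ) :
    IsChainOp (hochschildD σ) 1 (chainCooperad hd).cobracket := by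
  refine linearMap_eq_of_pairFun fun p q f g => ?_
  have hf := represents_pureFun (e := e) (e' := e') p f
  have hg := represents_pureFun (e := e) (e' := e') q g
  have h1 := (hf.star_cobracket hd hg (s := p) (t := q) (Even.add_self _)
    (Even.add_self _)).comp_totalDiff hd hσ (s := p + q + 1) (by push_cast; grind)
  have h2 := (hf.comp_totalDiff hd hσ (s := p) (Even.add_self _)).star_cobracket hd hg (s := p + 1)
    (t := q) (by push_cast; exact Even.add_self _) (Even.add_self _)
  have h3 := (hf.star_cobracket hd (hg.comp_totalDiff hd hσ (s := q) (Even.add_self _)) (s := p)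
    (t := q + 1) (Even.add_self _) (by push_cast; exact Even.add_self _)).smul ((-1 : k) ^ (p + 1))
  rw [← LinearMap.comp_assoc, ← LinearMap.comp_assoc, pairFun_comp_tensorDiff,
    pureFun_comp_totSign, LinearMap.add_comp]
  change star _ _ _ ∘ₗ _ = star _ _ _ + star _ _ _
  rw [star_smul_left]
  exact h1.unique ((h2.add (h3.congr (by ring) rfl)).congr (by ring)
    (delta_bracket e (hasParity_wordSum p _) (hasParity_wordSum q _)).symm)

/-- Since ∑ ε(e'_c) e_c = 1, the functional ε corresponds to the unit for the cup product. -/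
theorem polyOf_augProd_zero (hd : IsDualBases ε e e') :
    polyOf e e' 0 (augProd ε 0) = 1 := by
  have h := hd.sum_left 1
  simp only [mul_one] at h
  have h2 : cochainOf e e' (augProd ε 0) [] = 1 := by
    simp only [cochainOf, evalWord, augProd_chain]
    simpa [wordSeq] using h
  rw [polyOf, wordSum, h2]
  rfl

theorem augProd_zero_cocycle (hd : IsDualBases ε e e') (hσ : IsNakayama ε σ) :
    pureFun 0 (augProd ε 0) ∘ₗ totalDiff (hochschildD σ) = 0 := by
  have h := (represents_pureFun (e := e) (e' := e') 0 (augProd ε 0)).comp_totalDiff hd hσ (s := 0)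
    (by simp)
  rw [polyOf_augProd_zero hd] at h
  refine (h.congr rfl ?_).eq_zero
  have h1 : derMul e (1 : NCPoly k A (Fin m)) = 0 := der_coeff e 1 _ 1
  rw [delta_apply, h1, mul_one, one_mul, pow_zero, one_smul, smul_zero, sub_self, zero_add]

end ChainOps

/-! ### The Gerstenhaber coalgebra on homology -/

section Induced

variable {k : Type u} [Field k] {A : Type v} [Ring A] [Algebra k A] {ε : A →ₗ[k] k}
  {m : ℕ} {e e' : Module.Basis (Fin m) k A} {σ : A ≃ₐ[k] A}
  {W : ℕ → Type w'} [∀ n, AddCommGroup (W n)] [∀ n, Module k (W n)]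

namespace HomologyRetract

section

variable {X : ℕ → Type w} [∀ n, AddCommGroup (X n)] [∀ n, Module k (X n)]
  {d : ∀ n, X (n + 1) →ₗ[k] X n} (R : HomologyRetract d W)

theorem pureFun_comp_P (p : ℕ) (f : Module.Dual k (W p)) :
    pureFun p f ∘ₗ R.P = pureFun p (f ∘ₗ R.proj p) := by
  refine DirectSum.linearMap_ext k fun n => LinearMap.ext fun x => ?_
  simp only [LinearMap.comp_apply, P_lof]
  by_cases hn : n = p
  · subst hn; simp only [pureFun_lof, LinearMap.comp_apply]
  · rw [pureFun_lof_of_ne hn, pureFun_lof_of_ne hn]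

theorem comp_totalDiff_comp_S (U : Module.Dual k (Tot X)) : (U ∘ₗ totalDiff d) ∘ₗ R.S = 0 :=
  LinearMap.ext fun y => by simp [R.totalDiff_S]

end

variable (R : HomologyRetract (hochschildD σ) W) (hd : IsDualBases ε e e') (hσ : IsNakayama ε σ)

theorem represents (p : ℕ) (f : Module.Dual k (W p)) :
    Represents e e' (pureFun p f ∘ₗ R.P) p (polyOf e e' p (f ∘ₗ R.proj p)) := by
  rw [pureFun_comp_P]
  exact represents_pureFun _ _

include hd hσ in
theorem delta_polyOf_proj (p : ℕ) (f : Module.Dual k (W p)) :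
    delta e p (polyOf e e' p (f ∘ₗ R.proj p)) = 0 := by
  rw [← polyOf_comp_hochschildD hd hσ, LinearMap.comp_assoc, R.proj_d, LinearMap.comp_zero,
    polyOf_zero]

-- On chains ε is a strict unit for the transposed cup product. The counit on W sees ε only through
-- representing cycles, which changes the cocycle ε by a coboundary and hence does not matter.
include hσ in
theorem star_counit_left (p : ℕ) (f : Module.Dual k (W p)) :
    star (R.induced ((chainCooperad hd).cup (chainComultiplication hd)))
      (pureFun 0 (augProd ε 0) ∘ₗ R.S) (pureFun p f) = pureFun p f := by
  have h0 := represents_pureFun (e := e) (e' := e') 0 (augProd ε 0)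
  rw [polyOf_augProd_zero hd] at h0
  have hf := R.represents (e := e) (e' := e') p f
  obtain ⟨U, hU⟩ := R.exists_coboundary (hochschildD_hochschildD hd hσ)
    (augProd_zero_cocycle hd hσ)
  have h1 := ((h0.star_cup hd hσ hf).congr (by simp) (one_mul _)).unique hf
  rw [hU, star_add_left, (isChainOp_cup hd hσ).star_coboundary_left U (R.comp_P_cocycle _)] at h1
  have h2 := congrArg (· ∘ₗ R.S) h1
  simp only [LinearMap.add_comp, comp_totalDiff_comp_S, add_zero] at h2
  rw [star_induced, LinearMap.comp_assoc, h2]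
  exact LinearMap.ext fun y => by simp [R.P_S]

include hσ in
theorem star_counit_right (p : ℕ) (f : Module.Dual k (W p)) :
    star (R.induced ((chainCooperad hd).cup (chainComultiplication hd))) (pureFun p f)
      (pureFun 0 (augProd ε 0) ∘ₗ R.S) = pureFun p f := by
  have h0 := represents_pureFun (e := e) (e' := e') 0 (augProd ε 0)
  rw [polyOf_augProd_zero hd] at h0
  have hf := R.represents (e := e) (e' := e') p f
  obtain ⟨U, hU⟩ := R.exists_coboundary (hochschildD_hochschildD hd hσ)
    (augProd_zero_cocycle hd hσ)
  have h1 := ((hf.star_cup hd hσ h0).congr (by simp) (mul_one _)).unique hf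
  rw [hU, star_add_right, (isChainOp_cup hd hσ).star_coboundary_right U (R.comp_P_cocycle _)] at h1
  have h2 := congrArg (· ∘ₗ R.S) h1
  simp only [LinearMap.add_comp, comp_totalDiff_comp_S, add_zero] at h2
  rw [star_induced, LinearMap.comp_assoc, h2]
  exact LinearMap.ext fun y => by simp [R.P_S]

/-- The Gerstenhaber coalgebra structure on a model of Hochschild homology. -/
noncomputable def gerstenhaber : GerstenhaberCoalgebra k W where
  cup := R.induced ((chainCooperad hd).cup (chainComultiplication hd))
  counit := pureFun 0 (augProd ε 0) ∘ₗ R.S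
  cobracket := R.induced (chainCooperad hd).cobracket
  cup_degree n x := by
    rw [induced, LinearMap.comp_apply, LinearMap.comp_apply, S_lof]
    exact map_mem_tensorDegree _ (Cooperad.cup_degree _ _ _ _)
  counit_degree n x := by
    rw [LinearMap.comp_apply, S_lof, pureFun_lof_of_ne (by omega)]
  cobracket_degree n x := by
    rw [induced, LinearMap.comp_apply, LinearMap.comp_apply, S_lof]
    exact map_mem_tensorDegree _ (Cooperad.cobracket_degree _ _ _)
  coassoc := by
    have hcup := isChainOp_cup hd hσ
    have hdd := hochschildD_hochschildD hd hσ
    refine linearMap_eq_of_pairFun_pairFun fun p q r f g h => ?_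
    rw [← LinearMap.comp_assoc, ← LinearMap.comp_assoc, pairFun_applyLeft, pairFun_lTensor]
    change star _ (star _ _ _) _ = star _ _ (star _ _ _)
    rw [R.star_star_left hdd hcup hcup, R.star_star_right hdd hcup hcup]
    congr 1
    have hf := R.represents (e := e) (e' := e') p f
    have hg := R.represents (e := e) (e' := e') q g
    have hh := R.represents (e := e) (e' := e') r h
    -- Coassociativity holds strictly on chains, as associativity of polynomial multiplication.
    exact ((hf.star_cup hd hσ hg).star_cup hd hσ hh).unique
      ((hf.star_cup hd hσ (hg.star_cup hd hσ hh)).congr (by ring) (mul_assoc _ _ _).symm)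
  counit_left := LinearMap.ext fun y => eq_of_pureFun_eq fun p f => by
    have h (η φ : Module.Dual k (Tot W)) :
        φ ∘ₗ (TensorProduct.lid k (Tot W)).toLinearMap ∘ₗ η.rTensor (Tot W) = pairFun η φ :=
      TensorProduct.ext' fun x y => by simp
    have h2 := LinearMap.congr_fun (R.star_counit_left hd hσ p f) y
    rwa [star, ← h] at h2
  counit_right := LinearMap.ext fun y => eq_of_pureFun_eq fun p f => by
    have h (η φ : Module.Dual k (Tot W)) :
        φ ∘ₗ (TensorProduct.rid k (Tot W)).toLinearMap ∘ₗ η.lTensor (Tot W) = pairFun φ η :=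
      TensorProduct.ext' fun x y => by simp [mul_comm]
    have h2 := LinearMap.congr_fun (R.star_counit_right hd hσ p f) y
    rwa [star, ← h] at h2
  cocomm := by
    refine linearMap_eq_of_pairFun fun p q f g => ?_
    rw [← LinearMap.comp_assoc, flipτ, pairFun_comp_signedFlip, LinearMap.smul_comp]
    change _ • star _ _ _ = star _ _ _
    rw [star_induced, star_induced, ← LinearMap.smul_comp]
    have hf := R.represents (e := e) (e' := e') p f
    have hg := R.represents (e := e) (e' := e') q g
    -- By `delta_der` the graded commutator of two cocycles is, up to sign, the coboundary of an
    -- insertion; it vanishes on representing cycles.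
    have h1 := ((hf.star_cobrace hd hg (s := q + 1) (by push_cast; grind)).comp_totalDiff hd hσ
      (s := p + q + 1) (by push_cast; grind)).smul ((-1 : k) ^ p)
    have h2 := (hf.star_cup hd hσ hg).sub (((hg.star_cup hd hσ hf).smul ((-1 : k) ^ (p * q))).congr
      (by ring) rfl)
    have h3 := (h2.congr (n' := p + q - 1 + 1) (by ring) ?_).unique h1
    · have h4 := congrArg (· ∘ₗ R.S) h3
      simp only [LinearMap.sub_comp, LinearMap.smul_comp, comp_totalDiff_comp_S, smul_zero] at h4
      rw [LinearMap.smul_comp, mul_comm q]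
      exact (sub_eq_zero.mp h4).symm
    · have h5 := R.delta_polyOf_proj hd hσ p f
      have h6 := R.delta_polyOf_proj hd hσ q g
      simp only [polyOf] at h5 h6 ⊢
      rw [delta_der e (hasParity_wordSum p _) (hasParity_wordSum q _), h5, h6, der_zero, map_zero,
        LinearMap.zero_apply, smul_zero, zero_add, zero_add, smul_smul, ← mul_pow, neg_one_mul,
        neg_neg, one_pow, one_smul]
  coantisymm := by
    rintro _ ⟨x, rfl⟩
    -- P ⊗ P commutes with the flip, so the image of the chain level cobrace is a witness;
    -- compatibility of the cobrace with d is not needed.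
    refine ⟨TensorProduct.map R.P R.P ((chainCooperad hd).cobrace (R.S x)), ?_⟩
    have h := LinearMap.congr_fun (signedFlip_map (fun p q => (p + 1) * (q + 1)) R.proj)
      ((chainCooperad hd).cobrace (R.S x))
    simp only [LinearMap.comp_apply] at h
    rw [LinearMap.sub_apply, LinearMap.id_apply, induced, LinearMap.comp_apply,
      LinearMap.comp_apply, Cooperad.cobracket, LinearMap.comp_apply, LinearMap.sub_apply,
      LinearMap.id_apply, map_sub]
    exact congrArg _ h
  coJacobi := by
    have hcob := isChainOp_cobracket hd hσ
    have hdd := hochschildD_hochschildD hd hσ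
    refine linearMap_eq_of_pairFun_pairFun fun p q r f g h => ?_
    rw [← LinearMap.comp_assoc, ← LinearMap.comp_assoc, LinearMap.comp_add, LinearMap.comp_add,
      LinearMap.comp_id, ← LinearMap.comp_assoc, ← LinearMap.comp_assoc, flipρ,
      pairFun_lTensor_signedFlip, pairFun_onFirstTwo_signedFlip, LinearMap.smul_comp,
      LinearMap.smul_comp, pairFun_lTensor_signedFlip, pairFun_onFirstTwo_signedFlip,
      LinearMap.comp_zero]
    simp only [LinearMap.add_comp, LinearMap.smul_comp, pairFun_applyLeft]
    change star _ (star _ _ _) _ + _ • _ • star _ (star _ _ _) _ + _ • _ • star _ (star _ _ _) _ = 0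
    rw [R.star_star_left hdd hcob hcob, R.star_star_left hdd hcob hcob,
      R.star_star_left hdd hcob hcob, ← LinearMap.smul_comp, ← LinearMap.smul_comp,
      ← LinearMap.smul_comp, ← LinearMap.smul_comp, ← LinearMap.add_comp, ← LinearMap.add_comp]
    -- The iterated bracket is formed for the three cyclic orders; their signed sum vanishes already
    -- on chains.
    have key {p q r : ℕ} (f : Module.Dual k (W p)) (g : Module.Dual k (W q))
        (h : Module.Dual k (W r)) :=
      ((R.represents (e := e) (e' := e') p f).star_cobracket hd
        (R.represents (e := e) (e' := e') q g) (s := p) (t := q) (Even.add_self _)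
        (Even.add_self _)).star_cobracket hd (R.represents (e := e) (e' := e') r h)
        (s := p + q + 1) (t := r) (by push_cast; grind) (Even.add_self _)
    have h1 := ((key f g h).add (((key h f g).congr (by ring) rfl).smul
      ((-1 : k) ^ ((p + 1) * (r + 1) + (q + 1) * (r + 1))))).add
      (((key g h f).congr (by ring) rfl).smul ((-1 : k) ^ ((p + 1) * (q + 1) + (p + 1) * (r + 1))))
    have h2 := jacobi e (hasParity_wordSum p (cochainOf e e' (f ∘ₗ R.proj p)))
      (hasParity_wordSum q (cochainOf e e' (g ∘ₗ R.proj q)))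
      (hasParity_wordSum r (cochainOf e e' (h ∘ₗ R.proj r)))
    have h3 := (h1.congr (b' := 0) rfl (by rw [← h2]; simp only [polyOf]; abel)).eq_zero
    rw [← LinearMap.zero_comp R.S, ← h3]
    congr 1
    rw [smul_smul, smul_smul, ← pow_add, ← pow_add, mul_comm (r + 1) (q + 1),
      mul_comm (r + 1) (p + 1), mul_comm (q + 1) (p + 1), add_comm ((q + 1) * (r + 1))]
  coLeibniz := by
    have hcup := isChainOp_cup hd hσ
    have hcob := isChainOp_cobracket hd hσ
    have hdd := hochschildD_hochschildD hd hσ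
    refine linearMap_eq_of_pairFun_pairFun fun p q r f g h => ?_
    rw [← LinearMap.comp_assoc, ← LinearMap.comp_assoc, pairFun_lTensor, LinearMap.comp_add,
      pairFun_applyLeft, ← LinearMap.comp_assoc, flipMixed, pairFun_onFirstTwo_signedFlip,
      LinearMap.smul_comp, pairFun_lTensor, LinearMap.add_comp, LinearMap.smul_comp]
    change star _ _ (star _ _ _) = star _ (star _ _ _) _ + _ • star _ _ (star _ _ _)
    rw [R.star_star_left hdd hcob hcup, R.star_star_right hdd hcup hcob,
      R.star_star_right hdd hcob hcup, ← LinearMap.smul_comp, ← LinearMap.add_comp]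
    have hf := R.represents (e := e) (e' := e') p f
    have hg := R.represents (e := e) (e' := e') q g
    have hh := R.represents (e := e) (e' := e') r h
    have h1 := hf.star_cobracket hd (hg.star_cup hd hσ hh) (s := p) (t := q + r) (Even.add_self _)
      (by push_cast; exact Even.add_self _)
    have h2 := (hf.star_cobracket hd hg (s := p) (t := q) (Even.add_self _)
      (Even.add_self _)).star_cup hd hσ hh
    have h3 := (hg.star_cup hd hσ (hf.star_cobracket hd hh (s := p) (t := r) (Even.add_self _)
      (Even.add_self _))).smul ((-1 : k) ^ (q * (p + 1)))
    -- Double insertion of g and h into f is a primitive for the failure of the Leibniz rule.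
    obtain ⟨U, hU⟩ := exists_represents_der₂ hd (g ∘ₗ R.proj q) (h ∘ₗ R.proj r) (f ∘ₗ R.proj p)
      (q + 1) (r + 1)
    have h4 := (hU.comp_totalDiff hd hσ (s := p + q + r) (by push_cast; grind)).smul
      (-(-1 : k) ^ p)
    have h5 := (((h1.sub (h2.congr (by ring) rfl)).sub (h3.congr (by ring) rfl)).congr
      (by ring) (bracket_mul_homotopy e (hasParity_wordSum q _) (hasParity_wordSum r _)
        (hasParity_wordSum p _) (R.delta_polyOf_proj hd hσ q g) (R.delta_polyOf_proj hd hσ r h)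
        (R.delta_polyOf_proj hd hσ p f))).unique h4
    have h6 := congrArg (· ∘ₗ R.S) h5
    simp only [LinearMap.sub_comp, LinearMap.smul_comp, comp_totalDiff_comp_S, smul_zero] at h6
    rw [sub_sub, sub_eq_zero] at h6
    rw [h6, LinearMap.add_comp, LinearMap.smul_comp]

end HomologyRetract
end Induced

/-! ### Homology as a retract and the operations induced on it -/

section Model

variable {k : Type u} [Field k] {X : ℕ → Type w} [∀ n, AddCommGroup (X n)]
  [∀ n, Module k (X n)] {d : ∀ n, X (n + 1) →ₗ[k] X n}
  {W : ℕ → Type w'} [∀ n, AddCommGroup (W n)] [∀ n, Module k (W n)]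

theorem homologyClass_eq_zero_iff {n : ℕ} (z : cycles d n) :
    homologyClass d n z = 0 ↔ (z : X n) ∈ LinearMap.range (d n) := by
  rw [homologyClass, Submodule.mkQ_apply, Submodule.Quotient.mk_eq_zero]
  rfl

theorem d_mem_cycles (hd : ∀ n x, d n (d (n + 1) x) = 0) (n : ℕ) (x : X (n + 1)) :
    d n x ∈ cycles d n := by
  rcases n with _ | n
  · exact Submodule.mem_top
  · exact hd n x

/-- Over a field the class map extends from cycles to all chains and has a linear section. -/
theorem exists_homologyRetract (hd : ∀ n x, d n (d (n + 1) x) = 0) :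
    ∃ R : HomologyRetract d (Homology d), ∀ n (z : cycles d n),
      R.proj n z = homologyClass d n z := by
  choose π hπ using fun n => LinearMap.exists_extend (homologyClass d n)
  choose s hs using fun n => (homologyClass d n).exists_rightInverse_of_surjective
    (Submodule.range_mkQ _)
  have hπ' (n : ℕ) (z : cycles d n) : π n z = homologyClass d n z := LinearMap.congr_fun (hπ n) z
  refine ⟨⟨π, fun n => (cycles d n).subtype ∘ₗ s n, fun n => LinearMap.ext fun x => ?_,
    fun n x => (s n x).2, fun n x => ?_, fun n z hz h => ?_⟩, hπ'⟩
  · exact (hπ' n ⟨d n x, d_mem_cycles hd n x⟩).trans ((homologyClass_eq_zero_iff _).mpr ⟨x, rfl⟩)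
  · exact (hπ' n (s n x)).trans (LinearMap.congr_fun (hs n) x)
  · exact (homologyClass_eq_zero_iff ⟨z, hz⟩).mp ((hπ' n ⟨z, hz⟩).symm.trans h)

/-- Transport of an identification of the homology along an isomorphism. -/
noncomputable def HomologyRetract.congr {W' : ℕ → Type*} [∀ n, AddCommGroup (W' n)]
    [∀ n, Module k (W' n)] (R : HomologyRetract d W) (θ : ∀ n, W n ≃ₗ[k] W' n) :
    HomologyRetract d W' where
  proj n := (θ n).toLinearMap ∘ₗ R.proj n
  repr n := R.repr n ∘ₗ (θ n).symm.toLinearMap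
  proj_d n := by rw [LinearMap.comp_assoc, R.proj_d, LinearMap.comp_zero]
  repr_mem n x := R.repr_mem n _
  proj_repr n x := by simp [R.proj_repr]
  exact n z hz h := R.exact n z hz (by simpa using h)

theorem HomologyRetract.sub_mem_range (R : HomologyRetract d W)
    (hd : ∀ n x, d n (d (n + 1) x) = 0) {y : Tot X} (hy : totalDiff d y = 0) :
    y - R.S (R.P y) ∈ LinearMap.range (totalDiff d) := by
  obtain ⟨H, hH, -⟩ := R.exists_homotopy hd
  refine ⟨H y, ?_⟩
  rw [← hH, hy, map_zero, add_zero]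

/-- The tensor of cycles is obtained by lifting the induced value through the chosen
representatives. Φz is a cycle of the tensor square, hence homologous to its image under SP ⊗ SP,
and that image is the chosen tensor. -/
theorem IsChainOp.isInducedOnHomology {e : ℕ} {Φ : Tot X →ₗ[k] Tot X ⊗[k] Tot X}
    (hΦ : IsChainOp d e Φ) (hd : ∀ n x, d n (d (n + 1) x) = 0)
    (R : HomologyRetract d (Homology d))
    (hR : ∀ n (z : cycles d n), R.proj n z = homologyClass d n z) :
    IsInducedOnHomology d e Φ (R.induced Φ) := by
  intro n z
  let s (n : ℕ) : Homology d n →ₗ[k] cycles d n := (R.repr n).codRestrict _ (R.repr_mem n)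
  have hz : totalDiff d (DirectSum.lof k ℕ X n z) = 0 := totalDiff_lof_of_mem d z.2
  have hP : DirectSum.lof k ℕ (Homology d) n (homologyClass d n z) =
      R.P (DirectSum.lof k ℕ X n z) := by rw [R.P_lof, hR]
  have h1 : R.induced Φ (R.P (DirectSum.lof k ℕ X n z)) =
      TensorProduct.map R.P R.P (Φ (DirectSum.lof k ℕ X n z)) := by
    obtain ⟨y, hy⟩ := R.sub_mem_range hd hz
    have h2 : TensorProduct.map R.P R.P (Φ (totalDiff d y)) = 0 := by
      rw [← LinearMap.comp_apply Φ, hΦ, LinearMap.comp_apply, R.map_P_tensorDiff]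
    rw [hy, map_sub, map_sub, sub_eq_zero] at h2
    exact h2.symm
  have hs : TensorProduct.map (DirectSum.lmap fun m => (cycles d m).subtype)
      (DirectSum.lmap fun m => (cycles d m).subtype) ∘ₗ
        TensorProduct.map (DirectSum.lmap s) (DirectSum.lmap s) = TensorProduct.map R.S R.S := by
    have : (DirectSum.lmap fun m => (cycles d m).subtype) ∘ₗ DirectSum.lmap s = R.S := by
      refine DirectSum.linearMap_ext k fun n => LinearMap.ext fun x => ?_
      simp only [LinearMap.comp_apply, DirectSum.lmap_lof, R.S_lof]
      rfl
    rw [← TensorProduct.map_comp, this]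
  have hc : TensorProduct.map (DirectSum.lmap (homologyClass d)) (DirectSum.lmap (homologyClass d))
      ∘ₗ TensorProduct.map (DirectSum.lmap s) (DirectSum.lmap s) = LinearMap.id := by
    have : DirectSum.lmap (homologyClass d) ∘ₗ DirectSum.lmap s = LinearMap.id := by
      refine DirectSum.linearMap_ext k fun n => LinearMap.ext fun x => ?_
      simp only [LinearMap.comp_apply, DirectSum.lmap_lof, LinearMap.id_apply]
      rw [← hR, show ((s n x : cycles d n) : X n) = R.repr n x from rfl, R.proj_repr]
    rw [← TensorProduct.map_comp, this, TensorProduct.map_id]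
  refine ⟨TensorProduct.map (DirectSum.lmap s) (DirectSum.lmap s)
    (R.induced Φ (DirectSum.lof k ℕ (Homology d) n (homologyClass d n z))),
    LinearMap.congr_fun hc _, ?_⟩
  rw [← LinearMap.comp_apply (TensorProduct.map (DirectSum.lmap fun m => (cycles d m).subtype) _),
    hs, hP, h1, ← LinearMap.comp_apply (TensorProduct.map R.S R.S), ← TensorProduct.map_comp]
  refine R.sub_mem_range_tensorDiff hd e ?_
  rw [← LinearMap.comp_apply, ← hΦ, LinearMap.comp_apply, hz, map_zero]

end Model

/-! ### The counit on classes and transport along isomorphisms -/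

section Model

variable {k : Type u} [Field k] {A : Type v} [Ring A] [Algebra k A] {ε : A →ₗ[k] k}
  {m : ℕ} {e e' : Module.Basis (Fin m) k A} {σ : A ≃ₐ[k] A}

/-- ε vanishes on boundaries, so the choice of representing cycle is immaterial. -/
theorem HomologyRetract.gerstenhaber_counit_class
    (R : HomologyRetract (hochschildD σ) (HochschildHomology σ))
    (hR : ∀ n (z : cycles (hochschildD σ) n), R.proj n z = homologyClass (hochschildD σ) n z)
    (hd : IsDualBases ε e e') (hσ : IsNakayama ε σ) (z : cycles (hochschildD σ) 0) :
    (R.gerstenhaber hd hσ).counit (DirectSum.lof k ℕ (HochschildHomology σ) 0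
      (homologyClass (hochschildD σ) 0 z)) = augProd ε 0 z := by
  obtain ⟨y, hy⟩ := R.sub_mem_range (hochschildD_hochschildD hd hσ)
    (totalDiff_lof_of_mem (hochschildD σ) z.2)
  have h := LinearMap.congr_fun (augProd_zero_cocycle hd hσ) y
  rw [LinearMap.comp_apply, hy, map_sub, pureFun_lof, R.P_lof, hR] at h
  exact (sub_eq_zero.mp h).symm

theorem HomologyRetract.gerstenhaber_isIso {W W' : ℕ → Type*} [∀ n, AddCommGroup (W n)]
    [∀ n, Module k (W n)] [∀ n, AddCommGroup (W' n)] [∀ n, Module k (W' n)]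
    (R : HomologyRetract (hochschildD σ) W) (θ : ∀ n, W n ≃ₗ[k] W' n)
    (hd : IsDualBases ε e e') (hσ : IsNakayama ε σ) :
    (R.gerstenhaber hd hσ).IsIso ((R.congr θ).gerstenhaber hd hσ) θ := by
  have hS : (R.congr θ).S ∘ₗ DirectSum.lmap (fun n => (θ n).toLinearMap) = R.S := by
    refine DirectSum.linearMap_ext k fun n => LinearMap.ext fun x => ?_
    simp only [LinearMap.comp_apply, DirectSum.lmap_lof, HomologyRetract.S_lof]
    simp [HomologyRetract.congr]
  have hP : (R.congr θ).P = DirectSum.lmap (fun n => (θ n).toLinearMap) ∘ₗ R.P := by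
    refine DirectSum.linearMap_ext k fun n => LinearMap.ext fun x => ?_
    simp only [LinearMap.comp_apply, DirectSum.lmap_lof, HomologyRetract.P_lof]
    rfl
  have key (Φ : Tot (HochschildChain k A) →ₗ[k] Tot (HochschildChain k A) ⊗[k] Tot _) :
      (R.congr θ).induced Φ ∘ₗ DirectSum.lmap (fun n => (θ n).toLinearMap) =
        TensorProduct.map (DirectSum.lmap (fun n => (θ n).toLinearMap))
          (DirectSum.lmap (fun n => (θ n).toLinearMap)) ∘ₗ R.induced Φ := by
    rw [HomologyRetract.induced, HomologyRetract.induced, LinearMap.comp_assoc,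
      LinearMap.comp_assoc, hS, hP, TensorProduct.map_comp, LinearMap.comp_assoc]
  refine ⟨key _, ?_, key _⟩
  change (pureFun 0 (augProd ε 0) ∘ₗ (R.congr θ).S) ∘ₗ _ = pureFun 0 (augProd ε 0) ∘ₗ R.S
  rw [LinearMap.comp_assoc, hS]

end Model

/-! ### The bar complex and its contraction -/

section Bar

variable {k : Type u} [Field k] {A : Type v} [Ring A] [Algebra k A] {m : ℕ}
  (e : Module.Basis (Fin m) k A)

variable (k A) in
/-- The `n`-th term of the bar resolution, as a free module. -/
noncomputable def barObj (m n : ℕ) : ModuleCat.{v} (Env k A) :=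
  ModuleCat.of (Env k A) ((Fin n → Fin m) →₀ Env k A)

variable (k A) in
/-- The basis of a term of the bar resolution. -/
noncomputable def barBasis (m n : ℕ) : Module.Basis (Fin n → Fin m) (Env k A) (barObj k A m n) :=
  Finsupp.basisSingleOne

/-- The universal multilinear map `(a_1, …, a_n) ↦ 1 ⊗ (a_1, …, a_n) ⊗ 1`. -/
noncomputable def barGen (n : ℕ) : MultilinearMap k (fun _ : Fin n => A) (barObj k A m n) :=
  ∑ v : Fin n → Fin m,
    (LinearMap.toSpanSingleton k _ (barBasis k A m n v)).compMultilinearMap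
      ((MultilinearMap.mkPiAlgebra k (Fin n) k).compLinearMap fun i => e.coord (v i))

theorem barGen_apply (n : ℕ) (a : Fin n → A) :
    barGen e n a = ∑ v : Fin n → Fin m, (∏ i, e.coord (v i) (a i)) • barBasis k A m n v := by
  simp [barGen]

theorem barGen_basis (n : ℕ) (v : Fin n → Fin m) :
    barGen e n (fun i => e (v i)) = barBasis k A m n v := by
  rw [barGen_apply, Finset.sum_eq_single v]
  · simp
  · intro w _ hw
    obtain ⟨i, hi⟩ := Function.ne_iff.mp hw
    rw [Finset.prod_eq_zero (Finset.mem_univ i), zero_smul]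
    simp [hi.symm]
  · simp

/-- Elements of a term of the bar resolution are combinations of elementary tensors. -/
theorem bar_induction {n : ℕ} {p : barObj k A m n → Prop} (y : barObj k A m n)
    (zero : p 0) (add : ∀ x y, p x → p y → p (x + y))
    (gen : ∀ (a b : A) (x : Fin n → A), p ((a ⊗ₜ[k] MulOpposite.op b : Env k A) • barGen e n x)) :
    p y := by
  rw [← (barBasis k A m n).sum_repr y]
  refine Finset.sum_induction _ p add zero fun v _ => ?_
  induction (barBasis k A m n).repr y v using TensorProduct.induction_on with
  | zero => exact (congrArg p (zero_smul (Env k A) _)).mpr zero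
  | tmul a b =>
    rw [← barGen_basis e]
    exact gen a b.unop _
  | add s t hs ht => rw [add_smul]; exact add _ _ hs ht

theorem bar_hom_ext {n : ℕ} {N : ModuleCat.{v} (Env k A)}
    {f g : barObj k A m n →ₗ[Env k A] N} (h : ∀ x, f (barGen e n x) = g (barGen e n x)) : f = g :=
  (barBasis k A m n).ext fun v => by rw [← barGen_basis e, h]

/-- The extension of a multilinear map to the bar resolution. -/
noncomputable def barLift {n : ℕ} {N : ModuleCat.{v} (Env k A)}
    (f : MultilinearMap k (fun _ : Fin n => A) N) : barObj k A m n →ₗ[Env k A] N :=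
  (barBasis k A m n).constr ℕ fun v => f fun i => e (v i)

theorem barLift_barGen {n : ℕ} {N : ModuleCat.{v} (Env k A)}
    (f : MultilinearMap k (fun _ : Fin n => A) N) (x : Fin n → A) :
    barLift e f (barGen e n x) = f x := by
  have : ((barLift e f).restrictScalars k).compMultilinearMap (barGen e n) = f :=
    Module.Basis.ext_multilinear (fun _ => e) fun v => by
      change barLift e f (barGen e n fun i => e (v i)) = _
      rw [barGen_basis, barLift, Module.Basis.constr_basis]
  exact congrArg (fun g => g x) this

/-- Formulas that single out the first entry extend from basis words to all tuples; the bar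
differential is defined by a recursion of this kind. -/
theorem barLift_cons {n : ℕ} {N : ModuleCat.{v} (Env k A)}
    (f : barObj k A m (n + 1) →ₗ[Env k A] N) (T : A →ₗ[k] barObj k A m n →ₗ[k] N)
    (h : ∀ v : Fin (n + 1) → Fin m, f (barBasis k A m (n + 1) v) =
      T (e (v 0)) (barGen e n fun i => e (v i.succ))) (a : A) (x : Fin n → A) :
    f (barGen e (n + 1) (Fin.cons a x)) = T a (barGen e n x) := by
  have : (f.restrictScalars k).compMultilinearMap (barGen e (n + 1)) = LinearMap.uncurryLeft
      { toFun := fun a => (T a).compMultilinearMap (barGen e n)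
        map_add' := fun a b => by ext; simp
        map_smul' := fun a b => by ext; simp } :=
    Module.Basis.ext_multilinear (fun _ => e) fun v => by
      change f (barGen e (n + 1) fun i => e (v i)) = T (e (v 0)) (barGen e n fun i => e (v i.succ))
      rw [barGen_basis, h]
  exact congrArg (fun g => g (Fin.cons a x)) this

/-- The left action of `A` on a bimodule. -/
noncomputable def leftAct (N : ModuleCat.{v} (Env k A)) : A →ₗ[k] N →ₗ[k] N :=
  LinearMap.mk₂ k (fun a y => (a ⊗ₜ[k] 1 : Env k A) • y)
    (fun a b y => by rw [TensorProduct.add_tmul, add_smul])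
    (fun c a y => by rw [← TensorProduct.smul_tmul', smul_assoc])
    (fun a y z => smul_add _ _ _) (fun c a y => smul_comm _ _ _)

/-- The right action of `A` on a bimodule. -/
noncomputable def rightAct (N : ModuleCat.{v} (Env k A)) : A →ₗ[k] N →ₗ[k] N :=
  LinearMap.mk₂ k (fun a y => (1 ⊗ₜ[k] MulOpposite.op a : Env k A) • y)
    (fun a b y => by rw [MulOpposite.op_add, TensorProduct.tmul_add, add_smul])
    (fun c a y => by rw [MulOpposite.op_smul, TensorProduct.tmul_smul, smul_assoc])
    (fun a y z => smul_add _ _ _) (fun c a y => smul_comm _ _ _)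

theorem leftAct_apply (N : ModuleCat.{v} (Env k A)) (a : A) (y : N) :
    leftAct N a y = (a ⊗ₜ[k] 1 : Env k A) • y := rfl

theorem rightAct_apply (N : ModuleCat.{v} (Env k A)) (a : A) (y : N) :
    rightAct N a y = (1 ⊗ₜ[k] MulOpposite.op a : Env k A) • y := rfl

/-- The extra degeneracy of the bar resolution,
`a ⊗ (a_1, …, a_n) ⊗ b ↦ 1 ⊗ (a, a_1, …, a_n) ⊗ b`. -/
noncomputable def barShift (n : ℕ) : barObj k A m n →ₗ[k] barObj k A m (n + 1) :=
  ∑ v : Fin n → Fin m, TensorProduct.lift (LinearMap.mk₂ k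
      (fun a b => (1 ⊗ₜ b : Env k A) • barGen e (n + 1) (Fin.cons a fun i => e (v i)))
      (fun a a' b => by rw [MultilinearMap.cons_add, smul_add])
      (fun c a b => by rw [MultilinearMap.cons_smul, smul_comm])
      (fun a b b' => by rw [TensorProduct.tmul_add, add_smul])
      (fun c a b => by rw [TensorProduct.tmul_smul, smul_assoc])) ∘ₗ
    ((barBasis k A m n).coord v).restrictScalars k

theorem barShift_smul_barBasis {n : ℕ} (a b : A) (v : Fin n → Fin m) :
    barShift e n ((a ⊗ₜ[k] MulOpposite.op b : Env k A) • barBasis k A m n v) =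
      (1 ⊗ₜ[k] MulOpposite.op b : Env k A) • barGen e (n + 1) (Fin.cons a fun i => e (v i)) := by
  rw [barShift, LinearMap.sum_apply, Finset.sum_eq_single v]
  · simp
  · intro w _ hw
    simp [Finsupp.single_eq_of_ne hw]
  · simp

theorem barShift_smul_barGen {n : ℕ} (a b : A) (x : Fin n → A) :
    barShift e n ((a ⊗ₜ[k] MulOpposite.op b : Env k A) • barGen e n x) =
      (1 ⊗ₜ[k] MulOpposite.op b : Env k A) • barGen e (n + 1) (Fin.cons a x) := by
  have : (barShift e n ∘ₗ (Module.toModuleEnd k (S := Env k A) (barObj k A m n)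
      (a ⊗ₜ[k] MulOpposite.op b))).compMultilinearMap (barGen e n) =
      (Module.toModuleEnd k (S := Env k A) (barObj k A m (n + 1))
        (1 ⊗ₜ[k] MulOpposite.op b)).compMultilinearMap ((barGen e (n + 1)).curryLeft a) :=
    Module.Basis.ext_multilinear (fun _ => e) fun v => by
      change barShift e n ((a ⊗ₜ[k] MulOpposite.op b : Env k A) • barGen e n fun i => e (v i)) = _
      rw [barGen_basis, barShift_smul_barBasis]
      rfl
  exact congrArg (fun g => g x) this

variable (k A) in
/-- The unit of `A`, as an element of the bimodule `A`. -/
noncomputable def bimoduleOne : selfBimodule k A := (1 : A)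

/-- The augmentation of the bar resolution. -/
noncomputable def barAug : barObj k A m 0 →ₗ[Env k A] selfBimodule k A :=
  (barBasis k A m 0).constr ℕ fun _ => bimoduleOne k A

/-- The differential of the bar resolution. -/
noncomputable def barD : ∀ n, barObj k A m (n + 1) →ₗ[Env k A] barObj k A m n
  | 0 => (barBasis k A m 1).constr ℕ fun v =>
      (e (v 0) ⊗ₜ[k] 1 : Env k A) • barGen e 0 Fin.elim0
        - (1 ⊗ₜ[k] MulOpposite.op (e (v 0)) : Env k A) • barGen e 0 Fin.elim0
  -- With s the extra degeneracy, ds + sd = 1 at a · x forces d(1 ⊗ (a, x) ⊗ 1) = a · x - s(a · dx),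
  -- which serves as the definition.
  | n + 1 => (barBasis k A m (n + 2)).constr ℕ fun v =>
      (e (v 0) ⊗ₜ[k] 1 : Env k A) • barGen e (n + 1) (fun i => e (v i.succ))
        - barShift e n ((e (v 0) ⊗ₜ[k] 1 : Env k A) •
            barD n (barGen e (n + 1) fun i => e (v i.succ)))

theorem barD_zero (a : A) (x : Fin 0 → A) : barD e 0 (barGen e 1 (Fin.cons a x)) =
    (a ⊗ₜ[k] 1 : Env k A) • barGen e 0 x
      - (1 ⊗ₜ[k] MulOpposite.op a : Env k A) • barGen e 0 x := by
  refine barLift_cons e (barD e 0) (leftAct _ - rightAct _) (fun v => ?_) a x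
  rw [barD, Module.Basis.constr_basis]
  simp only [LinearMap.sub_apply, leftAct_apply, rightAct_apply]
  rw [Subsingleton.elim (fun i : Fin 0 => e (v i.succ)) Fin.elim0]

theorem barD_succ (n : ℕ) (a : A) (x : Fin (n + 1) → A) :
    barD e (n + 1) (barGen e (n + 2) (Fin.cons a x)) =
    (a ⊗ₜ[k] 1 : Env k A) • barGen e (n + 1) x
      - barShift e n ((a ⊗ₜ[k] 1 : Env k A) • barD e n (barGen e (n + 1) x)) := by
  refine barLift_cons e (barD e (n + 1)) (leftAct _ - (LinearMap.llcomp k _ _ _ (barShift e n)) ∘ₗ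
    (LinearMap.lcomp k _ ((barD e n).restrictScalars k)) ∘ₗ leftAct _) (fun v => ?_) a x
  rw [barD, Module.Basis.constr_basis]
  rfl

/-- The extra degeneracy alters only the left end of a tensor, so it respects the right action. -/
theorem barShift_rightAct (n : ℕ) (b : A) (y : barObj k A m n) :
    barShift e n ((1 ⊗ₜ[k] MulOpposite.op b : Env k A) • y) =
      (1 ⊗ₜ[k] MulOpposite.op b : Env k A) • barShift e n y := by
  induction y using bar_induction e with
  | zero => simp
  | add x y hx hy => simp only [smul_add, map_add, hx, hy]
  | gen a c x =>
    rw [smul_smul, barShift_smul_barGen, smul_smul, Algebra.TensorProduct.tmul_mul_tmul,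
      ← MulOpposite.op_mul, one_mul, barShift_smul_barGen, Algebra.TensorProduct.tmul_mul_tmul,
      ← MulOpposite.op_mul, one_mul]

/-- On generators this is the recursion defining the differential; right linearity of the degeneracy
gives the rest. -/
theorem barD_barShift (n : ℕ) (y : barObj k A m (n + 1)) :
    barD e (n + 1) (barShift e (n + 1) y) + barShift e n (barD e n y) = y := by
  induction y using bar_induction e with
  | zero => simp
  | add x y hx hy =>
    nth_rewrite 3 [← hx, ← hy]
    simp only [map_add]; abel
  | gen a b x =>
    have h : (a ⊗ₜ[k] MulOpposite.op b : Env k A) =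
        (1 ⊗ₜ[k] MulOpposite.op b : Env k A) * (a ⊗ₜ[k] 1 : Env k A) := by
      simp
    rw [barShift_smul_barGen, (barD e (n + 1)).map_smul, barD_succ, (barD e n).map_smul, h,
      mul_smul, mul_smul, barShift_rightAct, ← smul_add, sub_add_cancel]

theorem barAug_barGen (x : Fin 0 → A) : barAug (barGen e 0 x) = bimoduleOne k A := by
  rw [Subsingleton.elim x fun i => e ((Fin.elim0 : Fin 0 → Fin m) i), barGen_basis, barAug,
    Module.Basis.constr_basis]

theorem barAug_smul_barGen (a b : A) (x : Fin 0 → A) :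
    barAug ((a ⊗ₜ[k] MulOpposite.op b : Env k A) • barGen e 0 x) = (a * b : A) := by
  rw [barAug.map_smul, barAug_barGen]
  exact (selfBimodule_smul k A a b 1).trans (by rw [one_mul])

/-- The augmentation as a map to `A`. -/
noncomputable def barAugVal : barObj k A m 0 →+ A := (barAug (k := k) (A := A)).toAddMonoidHom

/-- In degree zero the contraction is completed by the section a ↦ 1 ⊗ a of the augmentation. -/
theorem barD_barShift_zero (y : barObj k A m 0) :
    barD e 0 (barShift e 0 y) +
      rightAct _ (barAugVal y) (barGen e 0 Fin.elim0) = y := by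
  induction y using bar_induction e with
  | zero =>
    rw [map_zero, map_zero, map_zero, zero_add, map_zero, LinearMap.zero_apply]
  | add x y hx hy =>
    refine Eq.trans ?_ (congrArg₂ (· + ·) hx hy)
    simp only [map_add, LinearMap.add_apply]; abel
  | gen a b x =>
    rw [barShift_smul_barGen, (barD e 0).map_smul, barD_zero,
      show barAugVal _ = a * b from barAug_smul_barGen e a b x, rightAct_apply,
      smul_sub, smul_smul, smul_smul, Algebra.TensorProduct.tmul_mul_tmul,
      Algebra.TensorProduct.tmul_mul_tmul, ← MulOpposite.op_mul, one_mul, mul_one, mul_one,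
      Subsingleton.elim x Fin.elim0, sub_add_cancel]

/-- The extra degeneracy images generate. -/
theorem bar_hom_ext_shift {n : ℕ} {N : ModuleCat.{v} (Env k A)}
    {f g : barObj k A m (n + 1) →ₗ[Env k A] N}
    (h : ∀ y, f (barShift e n y) = g (barShift e n y)) : f = g := by
  refine bar_hom_ext e fun x => ?_
  have := h ((x 0 ⊗ₜ[k] MulOpposite.op 1 : Env k A) • barGen e n (Fin.tail x))
  rw [barShift_smul_barGen, Fin.cons_self_tail, map_smul, map_smul] at this
  rwa [MulOpposite.op_one, ← Algebra.TensorProduct.one_def, one_smul, one_smul] at this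

theorem barAug_barD : barAug ∘ₗ barD e 0 = 0 := by
  refine bar_hom_ext e fun x => ?_
  rw [← Fin.cons_self_tail x, LinearMap.comp_apply, barD_zero, map_sub, ← MulOpposite.op_one,
    barAug_smul_barGen, barAug_smul_barGen, LinearMap.zero_apply, mul_one, one_mul]
  exact sub_self (x 0)

/-- It suffices to test on s y. Using ds + sd = 1 twice turns d d s y into s d d y, which vanishes
by induction; the start is the vanishing of the augmentation on boundaries. -/
theorem barD_barD (n : ℕ) : barD e n ∘ₗ barD e (n + 1) = 0 := by
  induction n with
  | zero =>
    refine bar_hom_ext_shift e fun y => ?_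
    have h1 := barD_barShift e 0 y
    have h2 := barD_barShift_zero e (barD e 0 y)
    have h3 : barAugVal (barD e 0 y) = 0 := LinearMap.congr_fun (barAug_barD e) y
    rw [h3, map_zero, LinearMap.zero_apply, add_zero] at h2
    have h4 := congrArg (barD e 0) h1
    rw [map_add, h2, add_eq_right] at h4
    exact h4
  | succ n ih =>
    refine bar_hom_ext_shift e fun y => ?_
    have h1 := barD_barShift e (n + 1) y
    have h2 := barD_barShift e n (barD e (n + 1) y)
    have h3 : barD e n (barD e (n + 1) y) = 0 := LinearMap.congr_fun ih y
    rw [h3, map_zero, add_zero] at h2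
    have h4 := congrArg (barD e (n + 1)) h1
    rw [map_add, h2, add_eq_right] at h4
    exact h4

end Bar

/-! ### The bar resolution -/

section BarResolution

variable {k : Type u} [Field k] {A : Type v} [Ring A] [Algebra k A] {m : ℕ}
  (e : Module.Basis (Fin m) k A)

theorem barShift_smul_barGen_seq {n : ℕ} (a b : A) {x y : ℕ → A} (h0 : y 0 = a)
    (h : ∀ l, y (l + 1) = x l) :
    barShift e n ((a ⊗ₜ[k] MulOpposite.op b : Env k A) • barGen e n fun l => x l) =
      (1 ⊗ₜ[k] MulOpposite.op b : Env k A) • barGen e (n + 1) fun l => y l := by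
  rw [barShift_smul_barGen]
  congr 2
  refine funext fun l => Fin.cases h0.symm (fun i => ?_) l
  rw [Fin.cons_succ, Fin.val_succ, h]

/-- Unfolding the recursion, the degeneracy turns the left multiplication of the previous stage into
the merge at 0 and raises the index of every other merge by one. -/
theorem barD_barGen (n : ℕ) (a : ℕ → A) :
    barD e n (barGen e (n + 1) fun l => a l) =
      (a 0 ⊗ₜ[k] 1 : Env k A) • barGen e n (fun l => a (l + 1))
      + ∑ i ∈ Finset.range n, (-1 : k) ^ (i + 1) • barGen e n (fun l => merge i a l)
      + (-1 : k) ^ (n + 1) • ((1 ⊗ₜ[k] MulOpposite.op (a n) : Env k A) •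
        barGen e n (fun l => a l)) := by
  have hcons (n : ℕ) (a : ℕ → A) : (fun l : Fin (n + 1) => a l) =
      Fin.cons (a 0) fun l : Fin n => a (l + 1) :=
    funext fun l => Fin.cases rfl (fun i => rfl) l
  induction n generalizing a with
  | zero =>
    rw [hcons, barD_zero, Finset.sum_range_zero, add_zero, zero_add, pow_one, neg_one_smul,
      ← sub_eq_add_neg]
    rw [Subsingleton.elim (fun l : Fin 0 => a l) fun l : Fin 0 => a (l + 1)]
  | succ n ih =>
    have h1 : barShift e n ((a 0 ⊗ₜ[k] 1 : Env k A) • (a 1 ⊗ₜ[k] 1 : Env k A) •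
        barGen e n (fun l => a (l + 1 + 1))) = barGen e (n + 1) fun l => merge 0 a l := by
      rw [smul_smul, Algebra.TensorProduct.tmul_mul_tmul, mul_one, ← MulOpposite.op_one,
        barShift_smul_barGen_seq e (x := fun l => a (l + 1 + 1)) (y := merge 0 a) _ _
          (by simp [merge]) (fun l => by simp [merge]), MulOpposite.op_one,
        ← Algebra.TensorProduct.one_def, one_smul]
    have h2 (i : ℕ) : barShift e n ((a 0 ⊗ₜ[k] 1 : Env k A) •
        barGen e n (fun l => merge i (fun l => a (l + 1)) l)) =
          barGen e (n + 1) fun l => merge (i + 1) a l := by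
      rw [← MulOpposite.op_one,
        barShift_smul_barGen_seq e (x := merge i fun l => a (l + 1)) (y := merge (i + 1) a) _ _
          (by simp [merge]) (fun l => by simp [merge]), MulOpposite.op_one,
        ← Algebra.TensorProduct.one_def, one_smul]
    have h3 : barShift e n ((a 0 ⊗ₜ[k] 1 : Env k A) •
        (1 ⊗ₜ[k] MulOpposite.op (a (n + 1)) : Env k A) • barGen e n (fun l => a (l + 1))) =
        (1 ⊗ₜ[k] MulOpposite.op (a (n + 1)) : Env k A) • barGen e (n + 1) fun l => a l := by
      rw [smul_smul, Algebra.TensorProduct.tmul_mul_tmul, mul_one, one_mul,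
        barShift_smul_barGen_seq e (x := fun l => a (l + 1)) (y := a) _ _ rfl fun l => rfl]
    have h4 (i : ℕ) : barShift e n ((a 0 ⊗ₜ[k] 1 : Env k A) • (-1 : k) ^ (i + 1) •
        barGen e n (fun l => merge i (fun l => a (l + 1)) l)) =
          (-1 : k) ^ (i + 1) • barGen e (n + 1) fun l => merge (i + 1) a l := by
      rw [smul_comm, map_smul, h2]
    have h5 (j : ℕ) (z : barObj k A m (n + 1)) :
        (-1 : k) ^ (j + 1 + 1) • z = -((-1 : k) ^ (j + 1) • z) := by
      rw [pow_succ, mul_neg_one, neg_smul]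
    rw [hcons, barD_succ, ih fun l => a (l + 1), smul_add, smul_add, map_add, map_add, h1,
      Finset.smul_sum, map_sum, smul_comm _ ((-1 : k) ^ (n + 1)), map_smul, h3,
      Finset.sum_range_succ', zero_add, pow_one, neg_one_smul]
    simp only [h4, h5, Finset.sum_neg_distrib]
    abel

theorem bar_exact (n : ℕ) (y : barObj k A m (n + 1)) (hy : barD e n y = 0) :
    barD e (n + 1) (barShift e (n + 1) y) = y := by
  have h := barD_barShift e n y
  rwa [hy, map_zero, add_zero] at h

theorem bar_exact_zero (y : barObj k A m 0) (hy : barAug y = 0) :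
    barD e 0 (barShift e 0 y) = y := by
  have h := barD_barShift_zero e y
  rwa [show barAugVal y = 0 from hy, map_zero, LinearMap.zero_apply, add_zero] at h

include e in
theorem barAug_surjective : Function.Surjective (barAug (k := k) (A := A) (m := m)) := fun x =>
  ⟨((id x : A) ⊗ₜ[k] MulOpposite.op 1 : Env k A) • barGen e 0 Fin.elim0,
    (barAug_smul_barGen e (id x : A) 1 Fin.elim0).trans (mul_one (id x : A))⟩

/-- A linear map as a morphism of the category of modules. -/
def toHom {R : Type*} [Ring R] {N N' : ModuleCat.{w} R} (f : N →ₗ[R] N') : N ⟶ N' :=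
  ModuleCat.ofHom f

theorem toHom_comp {R : Type*} [Ring R] {N N' N'' : ModuleCat.{w} R} (f : N →ₗ[R] N')
    (g : N' →ₗ[R] N'') : toHom f ≫ toHom g = toHom (g ∘ₗ f) := rfl

theorem toHom_zero {R : Type*} [Ring R] {N N' : ModuleCat.{w} R} :
    toHom (0 : N →ₗ[R] N') = 0 := rfl

/-- The bar complex. -/
noncomputable def barComplex : ChainComplex (ModuleCat.{v} (Env k A)) ℕ :=
  ChainComplex.of (barObj k A m) (fun n => toHom (barD e n)) fun n => by
    rw [toHom_comp, barD_barD, toHom_zero]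

theorem barComplex_d (n : ℕ) : (barComplex e).d (n + 1) n = toHom (barD e n) :=
  ChainComplex.of_d (barObj k A m) (fun n => toHom (barD e n)) n

/-- The augmentation of the bar complex. -/
noncomputable def barComplexAug :
    barComplex e ⟶ (ChainComplex.single₀ _).obj (selfBimodule k A) :=
  (ChainComplex.toSingle₀Equiv _ _).symm ⟨toHom barAug, by
    rw [barComplex_d]
    exact (toHom_comp _ _).trans ((congrArg toHom (barAug_barD e)).trans toHom_zero)⟩

theorem barComplexAug_f_zero : (barComplexAug e).f 0 = toHom barAug :=
  ChainComplex.toSingle₀Equiv_symm_apply_f_zero _ _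

/-- The contraction supplies a preimage of every cycle, and this gives exactness in each degree. -/
instance barComplexAug_quasiIso : QuasiIso (barComplexAug e) where
  quasiIsoAt n := by
    cases n with
    | zero =>
      rw [ChainComplex.quasiIsoAt₀_iff, ShortComplex.quasiIso_iff_of_zeros' _ rfl (by rfl) (by rfl)]
      have hex : (ShortComplex.mk (toHom (barD e 0)) (toHom barAug)
          (by rw [toHom_comp, barAug_barD, toHom_zero])).Exact :=
        (ShortComplex.moduleCat_exact_iff _).mpr fun y hy => ⟨_, bar_exact_zero e y hy⟩
      have hepi : Epi (toHom (barAug (k := k) (A := A) (m := m))) :=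
        (ModuleCat.epi_iff_surjective _).mpr (barAug_surjective e)
      refine (ShortComplex.exact_and_epi_g_iff_of_iso ?_).2 ⟨hex, hepi⟩
      exact ShortComplex.isoMk (Iso.refl _) (Iso.refl _) (Iso.refl _)
        ((Category.id_comp _).trans ((barComplex_d e 0).symm.trans (Category.comp_id _).symm))
        ((Category.id_comp _).trans ((barComplexAug_f_zero e).symm.trans
          (Category.comp_id _).symm))
    | succ n =>
      rw [quasiIsoAt_iff_exactAt']
      · rw [HomologicalComplex.exactAt_iff' _ (n + 1 + 1) (n + 1) n (by simp) (by simp)]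
        have hex : (ShortComplex.mk (toHom (barD e (n + 1))) (toHom (barD e n))
            (by rw [toHom_comp, barD_barD, toHom_zero])).Exact :=
          (ShortComplex.moduleCat_exact_iff _).mpr fun y hy => ⟨_, bar_exact e n y hy⟩
        refine (ShortComplex.exact_iff_of_iso ?_).2 hex
        exact ShortComplex.isoMk (Iso.refl _) (Iso.refl _) (Iso.refl _)
          ((Category.id_comp _).trans ((barComplex_d e (n + 1)).symm.trans
            (Category.comp_id _).symm))
          ((Category.id_comp _).trans ((barComplex_d e n).symm.trans (Category.comp_id _).symm))
      · apply ChainComplex.exactAt_succ_single_obj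

/-- The bar resolution of `A`. -/
noncomputable def barResolution : ProjectiveResolution (selfBimodule k A) where
  complex := barComplex e
  projective n := ModuleCat.projective_of_free (barBasis k A m n)
  π := barComplexAug e

/-- The bar resolution, compared with itself. -/
noncomputable def barSelfComparison : BarComparison (barResolution e) where
  f := barGen e
  comm n a := by
    exact (congrArg (fun f : barObj k A m (n + 1) ⟶ barObj k A m n =>
      f (barGen e (n + 1) fun l => a l)) (barComplex_d e n)).trans (barD_barGen e n a)
  augmentation := by
    have h : (barResolution e).π.f 0 ≫ (HomologicalComplex.singleObjXSelf (ComplexShape.down ℕ) 0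
        (selfBimodule k A)).hom = toHom barAug :=
      (Category.comp_id _).trans (barComplexAug_f_zero e)
    exact (congrArg (fun f : barObj k A m 0 ⟶ selfBimodule k A => f (barGen e 0 Fin.elim0)) h).trans
      (barAug_barGen e Fin.elim0)

end BarResolution

/-! ### Comparing the bar resolution with projective resolutions -/

section Comparison

variable {k : Type u} [Field k] {A : Type v} [Ring A] [Algebra k A] {m : ℕ}
  (e : Module.Basis (Fin m) k A)

theorem map_barFormula {N N' : ModuleCat.{v} (Env k A)} (f : N →ₗ[Env k A] N') (s t : Env k A)
    (x z : N) (n : ℕ) (c : ℕ → k) (y : ℕ → N) (c' : k) :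
    f (s • x + ∑ i ∈ Finset.range n, c i • y i + c' • (t • z)) =
      s • f x + ∑ i ∈ Finset.range n, c i • f (y i) + c' • (t • f z) := by
  have h (c : k) (y : N) : f (c • y) = c • f y := (f.restrictScalars k).map_smul c y
  rw [map_add, map_add, map_sum, f.map_smul, h, f.map_smul]
  simp only [h]

/-- A comparison with the bar resolution, followed by a morphism of resolutions. -/
noncomputable def BarComparison.comp {P Q : ProjectiveResolution (selfBimodule k A)}
    (B : BarComparison P) (φ : P.complex ⟶ Q.complex) (hφ : φ.f 0 ≫ Q.π.f 0 = P.π.f 0) :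
    BarComparison Q where
  f n := (groundLinear (φ.f n)).compMultilinearMap (B.f n)
  comm n a := by
    have h := congrArg (fun g : P.complex.X (n + 1) ⟶ Q.complex.X n => g (B.f (n + 1) fun l => a l))
      (φ.comm (n + 1) n)
    refine h.trans ((congrArg (φ.f n) (B.comm n a)).trans ?_)
    exact map_barFormula (φ.f n).hom _ _ _ _ _ _ _ _
  augmentation := by
    refine Eq.trans ?_ B.augmentation
    exact congrArg (fun g : P.complex.X 0 ⟶ _ => (g ≫ (HomologicalComplex.singleObjXSelf
      (ComplexShape.down ℕ) 0 (selfBimodule k A)).hom) (B.f 0 Fin.elim0)) hφ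

-- The identity of A lifts to a map from the bar resolution to P, along which the tautological
-- comparison is pushed forward.
include e in
theorem nonempty_barComparison (P : ProjectiveResolution (selfBimodule k A)) :
    Nonempty (BarComparison P) :=
  ⟨(barSelfComparison e).comp (ProjectiveResolution.lift (𝟙 _) (barResolution e) P)
    ((ProjectiveResolution.lift_commutes_zero _ _ _).trans (Category.comp_id _))⟩

theorem exists_seq_eq {n : ℕ} (x : Fin n → A) : ∃ a : ℕ → A, (fun l : Fin n => a l) = x :=
  ⟨fun l => if h : l < n then x ⟨l, h⟩ else 0, funext fun l => by simp⟩

/-- The morphism from the bar resolution belonging to a comparison. -/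
noncomputable def BarComparison.hom {P : ProjectiveResolution (selfBimodule k A)}
    (B : BarComparison P) : (barResolution e).complex ⟶ P.complex where
  f n := toHom (barLift e (B.f n))
  comm' i j hij := by
    obtain rfl : j + 1 = i := hij
    have h : (P.complex.d (j + 1) j).hom ∘ₗ barLift e (B.f (j + 1)) =
        barLift e (B.f j) ∘ₗ barD e j := by
      refine bar_hom_ext e fun x => ?_
      obtain ⟨a, rfl⟩ := exists_seq_eq x
      rw [LinearMap.comp_apply, LinearMap.comp_apply, barLift_barGen]
      refine (B.comm j a).trans ?_
      rw [barD_barGen, map_barFormula]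
      simp only [barLift_barGen]
    exact (congrArg toHom h).trans
      (congrArg (· ≫ toHom (barLift e (B.f j))) (barComplex_d e j).symm)

theorem BarComparison.hom_f_barGen {P : ProjectiveResolution (selfBimodule k A)}
    (B : BarComparison P) (n : ℕ) (x : Fin n → A) :
    (B.hom e).f n (barGen e n x) = B.f n x := barLift_barGen e (B.f n) x

theorem BarComparison.hom_f_zero_comp_π {P : ProjectiveResolution (selfBimodule k A)}
    (B : BarComparison P) : (B.hom e).f 0 ≫ P.π.f 0 = (barResolution e).π.f 0 := by
  have h : (P.π.f 0).hom ∘ₗ barLift e (B.f 0) = barAug := by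
    refine bar_hom_ext e fun x => ?_
    rw [LinearMap.comp_apply, barLift_barGen, Subsingleton.elim x Fin.elim0]
    exact ((congrArg (fun g : P.complex.X 0 ⟶ selfBimodule k A => g (B.f 0 Fin.elim0))
      (Category.comp_id (P.π.f 0))).symm.trans B.augmentation).trans
        (barAug_barGen e Fin.elim0).symm
  exact (congrArg toHom h).trans (barComplexAug_f_zero e).symm

variable {e} (σ : A ≃ₐ[k] A) {P : ProjectiveResolution (selfBimodule k A)} (B : BarComparison P)

/-- The class of `a ⊗ x` in the twisted tensor product. -/
noncomputable def twistedMk (N : ModuleCat.{v} (Env k A)) :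
    A →ₗ[k] N →ₗ[k] (twistedTensor σ).obj N :=
  (TensorProduct.mk k A N).compr₂ (balancing σ N).mkQ

theorem twistedMk_smul (N : ModuleCat.{v} (Env k A)) (a b c : A) (x : N) :
    twistedMk σ N a ((b ⊗ₜ[k] MulOpposite.op c : Env k A) • x) = twistedMk σ N (σ c * a * b) x := by
  refine ((Submodule.Quotient.eq _).mpr ?_).symm
  exact Submodule.subset_span ⟨b, c, a, x, rfl⟩

theorem twistedMk_smul_left (N : ModuleCat.{v} (Env k A)) (a b : A) (x : N) :
    twistedMk σ N a ((b ⊗ₜ[k] 1 : Env k A) • x) = twistedMk σ N (a * b) x := by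
  rw [← MulOpposite.op_one, twistedMk_smul, map_one, one_mul]

theorem twistedMk_smul_right (N : ModuleCat.{v} (Env k A)) (a b : A) (x : N) :
    twistedMk σ N a ((1 ⊗ₜ[k] MulOpposite.op b : Env k A) • x) = twistedMk σ N (σ b * a) x := by
  rw [twistedMk_smul, mul_one]

theorem BarComparison.chainMap_chain (n : ℕ) (a : ℕ → A) :
    B.chainMap σ n (chain k n a) =
      twistedMk σ (P.complex.X n) (a 0) (B.f n fun l => a (l + 1)) := by
  rw [BarComparison.chainMap, chain, PiTensorProduct.lift.tprod]
  rfl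

theorem twistedMk_barFormula (N : ModuleCat.{v} (Env k A)) (a b b' : A) (x z : N) (n : ℕ)
    (c : ℕ → k) (y : ℕ → N) (c' : k) :
    twistedMk σ N a ((b ⊗ₜ[k] 1 : Env k A) • x + ∑ i ∈ Finset.range n, c i • y i +
        c' • ((1 ⊗ₜ[k] MulOpposite.op b' : Env k A) • z)) =
      twistedMk σ N (a * b) x + ∑ i ∈ Finset.range n, c i • twistedMk σ N a (y i) +
        c' • twistedMk σ N (σ b' * a) z := by
  rw [map_add, map_add, map_sum, LinearMap.map_smul _ c', twistedMk_smul_left, twistedMk_smul_right]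
  simp only [LinearMap.map_smul]

/-- The outer terms of the bar differential move across the balanced tensor product: the left
multiplier lands to the right of a_0, the right one returns to its left with σ applied. -/
theorem BarComparison.d_chainMap (n : ℕ) (x : HochschildChain k A (n + 1)) :
    (((twistedTensor σ).mapHomologicalComplex (ComplexShape.down ℕ)).obj P.complex).d (n + 1) n
      (B.chainMap σ (n + 1) x) = B.chainMap σ n (hochschildD σ n x) := by
  let F (n : ℕ) : HochschildChain k A n →ₗ[k] (twistedTensor σ).obj (P.complex.X n) :=
    B.chainMap σ n
  have hF (n : ℕ) (a : ℕ → A) : F n (chain k n a) =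
      twistedMk σ (P.complex.X n) (a 0) (B.f n fun l => a (l + 1)) := B.chainMap_chain σ n a
  have h : ((twistedTensor σ).map (P.complex.d (n + 1) n)).hom ∘ₗ F (n + 1) =
      F n ∘ₗ hochschildD σ n := by
    refine hom_ext_chain fun a => ?_
    rw [LinearMap.comp_apply, hF]
    refine (congrArg (twistedMk σ (P.complex.X n) (a 0)) (B.comm n fun l => a (l + 1))).trans ?_
    rw [twistedMk_barFormula, LinearMap.comp_apply, hochschildD, LinearMap.add_apply,
      LinearMap.sum_apply, map_add, map_sum, Fin.sum_univ_succ]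
    simp only [LinearMap.smul_apply, map_smul, innerFace_chain, lastFace_chain, hF]
    congr 1
    · rw [Finset.sum_range]
      congr 1
      · simp [outerSeq]
      · refine Finset.sum_congr rfl fun i _ => ?_
        have h1 (l : ℕ) : merge i (fun l => a (l + 1)) l =
            outerSeq (i + 1) 2 (a (i + 1) * a (i + 1 + 1)) a (l + 1) := by
          simp only [merge, outerSeq, add_lt_add_iff_right, add_left_inj]
          rfl
        simp only [h1]
        rfl
    · simp [innerSeq, add_comm 1]
  exact LinearMap.congr_fun h x

theorem BarComparison.map_hom_chainMap (n : ℕ) (x : HochschildChain k A n) :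
    (((twistedTensor σ).mapHomologicalComplex (ComplexShape.down ℕ)).map (B.hom e)).f n
      ((barSelfComparison e).chainMap σ n x) = B.chainMap σ n x := by
  let F : HochschildChain k A n →ₗ[k] (twistedTensor σ).obj (P.complex.X n) := B.chainMap σ n
  let F' : HochschildChain k A n →ₗ[k] (twistedTensor σ).obj ((barResolution e).complex.X n) :=
    (barSelfComparison e).chainMap σ n
  have h : ((twistedTensor σ).map ((B.hom e).f n)).hom ∘ₗ F' = F := by
    refine hom_ext_chain fun a => ?_
    refine Eq.trans ?_ (B.chainMap_chain σ n a).symm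
    refine (congrArg ((twistedTensor σ).map ((B.hom e).f n)).hom
      ((barSelfComparison e).chainMap_chain σ n a)).trans ?_
    exact congrArg (twistedMk σ (P.complex.X n) (a 0)) (B.hom_f_barGen e n _)
  exact LinearMap.congr_fun h x

end Comparison

/-! ### Hochschild chains as σA tensored with the bar resolution -/

section Bijective

variable {k : Type u} [Field k] {A : Type v} [Ring A] [Algebra k A] {m : ℕ}
  (e : Module.Basis (Fin m) k A) (σ : A ≃ₐ[k] A)

/-- The right action of the enveloping algebra on the twisted bimodule. -/
noncomputable def twistedAct : Env k A →ₗ[k] A →ₗ[k] A :=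
  TensorProduct.lift <| LinearMap.mk₂ k
    (fun a b => LinearMap.mulRight k a ∘ₗ LinearMap.mulLeft k (σ b.unop))
    (fun a a' b => by ext; simp [mul_add]) (fun c a b => by ext; simp)
    (fun a b b' => by ext; simp [add_mul]) (fun c a b => by ext; simp)

theorem twistedAct_tmul (a b x : A) :
    twistedAct σ (a ⊗ₜ[k] MulOpposite.op b) x = σ b * x * a := rfl

theorem twistedAct_mul (s t : Env k A) (x : A) :
    twistedAct σ (s * t) x = twistedAct σ t (twistedAct σ s x) := by
  induction s using TensorProduct.induction_on with
  | zero => simp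
  | add s s' hs hs' => simp only [add_mul, map_add, LinearMap.add_apply, hs, hs']
  | tmul a b =>
    induction t using TensorProduct.induction_on with
    | zero => simp
    | add t t' ht ht' => simp only [mul_add, map_add, LinearMap.add_apply, ht, ht']
    | tmul a' b' =>
      obtain ⟨b, rfl⟩ := MulOpposite.op_surjective b
      obtain ⟨b', rfl⟩ := MulOpposite.op_surjective b'
      rw [Algebra.TensorProduct.tmul_mul_tmul, ← MulOpposite.op_mul, twistedAct_tmul,
        twistedAct_tmul, twistedAct_tmul, map_mul]
      simp only [mul_assoc]

/-- The chain with the given entry in degree zero and basis elements in the other places. -/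
noncomputable def chainHead {n : ℕ} (v : Fin n → Fin m) : A →ₗ[k] HochschildChain k A n where
  toFun a := PiTensorProduct.tprod k (Fin.cons a fun i => e (v i) : Fin (n + 1) → A)
  map_add' _ _ := MultilinearMap.cons_add _ _ _ _
  map_smul' _ _ := MultilinearMap.cons_smul _ _ _ _

/-- The inverse of the identification of Hochschild chains with the twisted tensor product with the
bar resolution. -/
noncomputable def chainInv (n : ℕ) :
    A ⊗[k] barObj k A m n →ₗ[k] HochschildChain k A n :=
  TensorProduct.lift <| LinearMap.flip <| ∑ v : Fin n → Fin m,
    LinearMap.llcomp k A A _ (chainHead e v) ∘ₗ twistedAct σ ∘ₗ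
      ((barBasis k A m n).coord v).restrictScalars k

theorem chainInv_tmul (n : ℕ) (a : A) (y : barObj k A m n) :
    chainInv e σ n (a ⊗ₜ y) =
      ∑ v, chainHead e v (twistedAct σ ((barBasis k A m n).repr y v) a) := by
  simp [chainInv]

theorem balancing_le_ker_chainInv (n : ℕ) :
    balancing σ (barObj k A m n) ≤ LinearMap.ker (chainInv e σ n) := by
  rw [balancing, Submodule.span_le]
  rintro _ ⟨a, b, x, y, rfl⟩
  rw [SetLike.mem_coe, LinearMap.mem_ker, map_sub, chainInv_tmul, chainInv_tmul, sub_eq_zero]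
  refine Finset.sum_congr rfl fun v _ => ?_
  rw [map_smul, Finsupp.smul_apply, smul_eq_mul, twistedAct_mul, twistedAct_tmul]

theorem linearMap_ext_chainHead {n : ℕ} {M : Type*} [AddCommGroup M] [Module k M]
    {f g : HochschildChain k A n →ₗ[k] M}
    (h : ∀ (v : Fin n → Fin m) a, f (chainHead e v a) = g (chainHead e v a)) : f = g := by
  refine PiTensorProduct.ext (Module.Basis.ext_multilinear (fun _ => e) fun v => ?_)
  have := h (fun i => v i.succ) (e (v 0))
  have h2 : chainHead e (fun i => v i.succ) (e (v 0)) =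
      PiTensorProduct.tprod k fun i => e (v i) := by
    change PiTensorProduct.tprod k _ = _
    congr 1
    exact funext fun i => Fin.cases rfl (fun i => rfl) i
  rwa [h2] at this

theorem chainMap_chainHead {P : ProjectiveResolution (selfBimodule k A)} (B : BarComparison P)
    {n : ℕ} (v : Fin n → Fin m) (a : A) :
    B.chainMap σ n (chainHead e v a) =
      twistedMk σ (P.complex.X n) a (B.f n fun i => e (v i)) := by
  obtain ⟨s, hs⟩ := exists_seq_eq fun i => e (v i)
  have h : chainHead e v a = chain k n fun l => Nat.casesOn l a s := by
    change PiTensorProduct.tprod k _ = PiTensorProduct.tprod k _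
    congr 1
    exact funext fun i => Fin.cases rfl (fun i => (congrFun hs i).symm) i
  rw [h, B.chainMap_chain, ← hs]
  rfl

/-- The bar terms are free over the enveloping algebra on basis words, so the tensor product is one
copy of σA per word. The inverse lets the coefficient at each word act on the head entry. -/
theorem bijective_chainMap (n : ℕ) :
    Function.Bijective ((barSelfComparison e).chainMap σ n) := by
  let F : HochschildChain k A n →ₗ[k] (twistedTensor σ).obj (barObj k A m n) :=
    (barSelfComparison e).chainMap σ n
  have hF (v : Fin n → Fin m) (a : A) :
      F (chainHead e v a) = twistedMk σ _ a (barBasis k A m n v) := by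
    rw [← barGen_basis e]
    exact chainMap_chainHead e σ (barSelfComparison e) v a
  constructor
  · let L : (twistedTensor σ).obj (barObj k A m n) →ₗ[k] HochschildChain k A n :=
      (balancing σ (barObj k A m n)).liftQ _ (balancing_le_ker_chainInv e σ n)
    have hL : L ∘ₗ F = LinearMap.id := linearMap_ext_chainHead e fun v a => by
      rw [LinearMap.comp_apply, hF]
      refine (chainInv_tmul e σ n a _).trans ?_
      rw [Finset.sum_eq_single v]
      · rw [Module.Basis.repr_self, Finsupp.single_eq_same, Algebra.TensorProduct.one_def,
          ← MulOpposite.op_one, twistedAct_tmul, map_one, one_mul, mul_one]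
        rfl
      · intro w _ hw
        rw [Module.Basis.repr_self, Finsupp.single_eq_of_ne hw, map_zero, LinearMap.zero_apply,
          map_zero]
      · simp
    exact Function.LeftInverse.injective (LinearMap.congr_fun hL)
  · intro y
    obtain ⟨t, rfl⟩ := (balancing σ (barObj k A m n)).mkQ_surjective y
    suffices t ∈ (LinearMap.range F).comap (balancing σ (barObj k A m n)).mkQ from this
    induction t using TensorProduct.induction_on with
    | zero => exact zero_mem _
    | add s t hs ht => exact add_mem hs ht
    | tmul a y =>
      induction y using bar_induction e with
      | zero => rw [TensorProduct.tmul_zero]; exact zero_mem _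
      | add s t hs ht => rw [TensorProduct.tmul_add]; exact add_mem hs ht
      | gen b c x =>
        obtain ⟨s, rfl⟩ := exists_seq_eq x
        refine ⟨chain k n fun l => Nat.casesOn l (σ c * a * b) s, ?_⟩
        exact ((barSelfComparison e).chainMap_chain σ n _).trans (twistedMk_smul σ _ a b c _).symm

end Bijective

/-! ### Homology of complexes in terms of elements -/

section ChainComplexHomology

variable {k : Type u} [Field k] (K : ChainComplex (ModuleCat.{v} k) ℕ)

theorem exists_iCycles_eq {n : ℕ} (x : K.X n) (hx : ∀ j, K.d n j x = 0) :
    ∃ c, K.iCycles n c = x :=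
  ⟨K.cyclesMk x _ rfl (hx _), K.i_cyclesMk x _ rfl (hx _)⟩

theorem iCycles_injective (n : ℕ) : Function.Injective (K.iCycles n) :=
  (ModuleCat.mono_iff_injective _).mp inferInstance

theorem homologyπ_surjective (n : ℕ) : Function.Surjective (K.homologyπ n) :=
  (ModuleCat.epi_iff_surjective _).mp inferInstance

theorem homologyπ_eq_zero_iff {n : ℕ} (c : K.cycles n) :
    K.homologyπ n c = 0 ↔ ∃ y, K.d (n + 1) n y = K.iCycles n c := by
  have hex : (ShortComplex.mk (K.toCycles (n + 1) n) (K.homologyπ n)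
      (K.toCycles_comp_homologyπ _ _)).Exact :=
    ShortComplex.exact_of_g_is_cokernel _ (K.homologyIsCokernel _ _ (by simp))
  have hi (y : K.X (n + 1)) : K.iCycles n (K.toCycles (n + 1) n y) = K.d (n + 1) n y :=
    congrArg (fun f : K.X (n + 1) ⟶ K.X n => f y) (K.toCycles_i (n + 1) n)
  constructor
  · intro h
    obtain ⟨y, rfl⟩ := (ShortComplex.moduleCat_exact_iff _).mp hex c h
    exact ⟨y, (hi y).symm⟩
  · rintro ⟨y, hy⟩
    rw [← iCycles_injective K n ((hi y).trans hy)]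
    exact congrArg (fun f : K.X (n + 1) ⟶ K.homology n => f y) (K.toCycles_comp_homologyπ _ _)

variable {K} {X : ℕ → Type w} [∀ n, AddCommGroup (X n)] [∀ n, Module k (X n)]
  {d : ∀ n, X (n + 1) →ₗ[k] X n} {J : ∀ n, X n →ₗ[k] K.X n}

theorem exists_cycles_lift (hJ : ∀ n x, K.d (n + 1) n (J (n + 1) x) = J n (d n x)) (n : ℕ) :
    ∃ j : cycles d n →ₗ[k] K.cycles n, ∀ z, K.iCycles n (j z) = J n z := by
  have h (z : cycles d n) : ∃ c, K.iCycles n c = J n z := by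
    refine exists_iCycles_eq K _ fun i => ?_
    by_cases hi : i + 1 = n
    · subst hi
      rw [hJ, show d i z = 0 from z.2, map_zero]
    · rw [K.shape _ _ hi]
      rfl
  choose f hf using h
  refine ⟨⟨⟨f, fun x y => ?_⟩, fun c x => ?_⟩, hf⟩
  · apply iCycles_injective K n
    rw [map_add, hf, hf, hf, Submodule.coe_add, map_add]
  · apply iCycles_injective K n
    change K.iCycles n (f (c • x)) = (K.iCycles n).hom (c • f x)
    rw [LinearMap.map_smul, hf, Submodule.coe_smul, LinearMap.map_smul]
    exact congrArg (c • ·) (hf x).symm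

/-- A degreewise bijective chain map matches cycles with cycles and boundaries with boundaries. -/
theorem exists_homologyEquiv (hJ : ∀ n x, K.d (n + 1) n (J (n + 1) x) = J n (d n x))
    (hJ' : ∀ n, Function.Bijective (J n)) (n : ℕ) :
    ∃ T : Homology d n ≃ₗ[k] K.homology n, ∀ (z : cycles d n) (c : K.cycles n),
      K.iCycles n c = J n z → T (homologyClass d n z) = K.homologyπ n c := by
  obtain ⟨j, hj⟩ := exists_cycles_lift hJ n
  let q : cycles d n →ₗ[k] K.homology n := (K.homologyπ n).hom ∘ₗ j
  have hq (z : cycles d n) : q z = 0 ↔ homologyClass d n z = 0 := by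
    refine (homologyπ_eq_zero_iff K (j z)).trans ?_
    rw [homologyClass_eq_zero_iff, hj]
    constructor
    · rintro ⟨y, hy⟩
      obtain ⟨x, rfl⟩ := (hJ' (n + 1)).2 y
      exact ⟨x, (hJ' n).1 ((hJ n x).symm.trans hy)⟩
    · rintro ⟨x, hx⟩
      exact ⟨J (n + 1) x, (hJ n x).trans (congrArg (J n) hx)⟩
  have hle : (LinearMap.range (d n)).submoduleOf (cycles d n) ≤ LinearMap.ker q := fun z hz =>
    (hq z).mpr ((homologyClass_eq_zero_iff z).mpr hz)
  let T : Homology d n →ₗ[k] K.homology n := Submodule.liftQ _ q hle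
  have hT (z : cycles d n) : T (homologyClass d n z) = q z := rfl
  have hbij : Function.Bijective T := by
    constructor
    · refine (injective_iff_map_eq_zero T).mpr fun y hy => ?_
      obtain ⟨z, rfl⟩ := Submodule.mkQ_surjective _ y
      exact (hq z).mp hy
    · intro y
      obtain ⟨c, rfl⟩ := homologyπ_surjective K n y
      obtain ⟨x, hx⟩ := (hJ' n).2 (K.iCycles n c)
      have hx' : x ∈ cycles d n := by
        rcases n with _ | n
        · exact Submodule.mem_top
        · refine LinearMap.mem_ker.mpr ((hJ' n).1 ?_)
          rw [← hJ, hx, map_zero]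
          exact congrArg (fun f : K.cycles (n + 1) ⟶ K.X n => f c) (K.iCycles_d (n + 1) n)
      refine ⟨homologyClass d n ⟨x, hx'⟩, congrArg (K.homologyπ n) ?_⟩
      exact iCycles_injective K n ((hj _).trans hx)
  refine ⟨LinearEquiv.ofBijective T hbij, fun z c hc => congrArg (K.homologyπ n) ?_⟩
  exact iCycles_injective K n ((hj z).trans hc.symm)

end ChainComplexHomology

/-! ### The canonical isomorphism with Tor -/

section Tor

variable {k : Type u} [Field k] {A : Type v} [Ring A] [Algebra k A] {m : ℕ}
  (e : Module.Basis (Fin m) k A) (σ : A ≃ₐ[k] A)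

-- θ is defined through the bar resolution. A comparison B with P extends to a map of resolutions
-- over the identity of A, and naturality of the derived functor along it shows that B describes the
-- same θ.
include e in
theorem exists_canonicalTorIso :
    ∃ θ : ∀ n, HochschildHomology σ n ≃ₗ[k] TorEnv σ n, IsCanonicalTorIso σ θ := by
  let F := (twistedTensor σ).mapHomologicalComplex (ComplexShape.down ℕ)
  let R := barResolution e
  choose T hT using exists_homologyEquiv (K := F.obj R.complex)
    (J := (barSelfComparison e).chainMap σ)
    ((barSelfComparison e).d_chainMap σ) (bijective_chainMap e σ)
  refine ⟨fun n => T n ≪≫ₗ (R.isoLeftDerivedObj (twistedTensor σ) n).symm.toLinearEquiv,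
    fun P B n z c hc => ?_⟩
  have hnat := ProjectiveResolution.isoLeftDerivedObj_hom_naturality (𝟙 _) R P (B.hom e)
    ((B.hom_f_zero_comp_π e).trans (Category.comp_id _).symm) (twistedTensor σ) n
  rw [CategoryTheory.Functor.map_id, Category.id_comp] at hnat
  obtain ⟨c', hc'⟩ : ∃ c', (F.obj R.complex).iCycles n c' =
      (barSelfComparison e).chainMap σ n z := by
    obtain ⟨j, hj⟩ := exists_cycles_lift (K := F.obj R.complex)
      ((barSelfComparison e).d_chainMap σ) n
    exact ⟨j z, hj z⟩
  have hcc : HomologicalComplex.cyclesMap (F.map (B.hom e)) n c' = c := by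
    apply iCycles_injective
    refine Eq.trans ?_ (((congrArg _ hc').trans (B.map_hom_chainMap σ n z)).trans hc.symm)
    exact congrArg (fun f : (F.obj R.complex).cycles n ⟶ (F.obj P.complex).X n => f c')
      (HomologicalComplex.cyclesMap_i (F.map (B.hom e)) n)
  have hπ : HomologicalComplex.homologyMap (F.map (B.hom e)) n
      ((F.obj R.complex).homologyπ n c') = (F.obj P.complex).homologyπ n c :=
    (congrArg (fun f : (F.obj R.complex).cycles n ⟶ (F.obj P.complex).homology n => f c')
      (HomologicalComplex.homologyπ_naturality (F.map (B.hom e)) n)).trans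
        (congrArg ((F.obj P.complex).homologyπ n) hcc)
  refine Eq.trans ?_ hπ
  rw [← hT n z c' hc']
  refine (congrArg (fun f : TorEnv σ n ⟶ (F.obj P.complex).homology n =>
    f ((R.isoLeftDerivedObj (twistedTensor σ) n).inv (T n (homologyClass _ n z)))) hnat).trans ?_
  exact congrArg (HomologicalComplex.homologyMap (F.map (B.hom e)) n)
    (congrArg (fun f : (F.obj R.complex).homology n ⟶ (F.obj R.complex).homology n =>
      f (T n (homologyClass _ n z)))
      (R.isoLeftDerivedObj (twistedTensor σ) n).inv_hom_id)

end Tor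

end FrobHoch

theorem proposition5p12 {k : Type*} [Field k] {A : Type*} [Ring A] [Algebra k A]
    (ε : A →ₗ[k] k) (hε : IsFrobenius ε) (σ : A ≃ₐ[k] A) (hσ : IsNakayama ε σ) :
    ∃ (C : Cooperad k (HochschildChain k A)) (ψ : C.Comultiplication),
      -- the partial decompositions, built from the Frobenius coproduct of `1`
      (∀ (m : ℕ) (e e' : Module.Basis (Fin m) k A), IsDualBases ε e e' →
        ∀ (n p q i : ℕ) (a : ℕ → A), p + q = n + 1 → 1 ≤ i → i ≤ p →
          C.decomp n p q i (chain k n a) =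
            ∑ j, chain k p (fun l => if l < i then a l else if l = i then e j else a (l + q - 1))
              ⊗ₜ[k] chain k q (fun l => if l = 0 then e' j else a (i + l - 1))) ∧
      (∀ a : ℕ → A, C.counit (chain k 1 a) = ε (a 0 * a 1)) ∧
      (∀ (n : ℕ) (a : ℕ → A),
        ψ.map n (chain k n a) = ε (List.ofFn fun l : Fin (n + 1) => a l).prod) ∧
      -- the induced differential is the Hochschild differential
      (∀ n, C.differential ψ n = hochschildD σ n) ∧
      -- Hochschild homology is a Gerstenhaber coalgebra
      ∃ G : GerstenhaberCoalgebra k (HochschildHomology σ),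
        IsInducedOnHomology (hochschildD σ) 0 (C.cup ψ) G.cup ∧
        IsInducedOnHomology (hochschildD σ) 1 C.cobracket G.cobracket ∧
        (∀ z : cycles (hochschildD σ) 0,
          G.counit (DirectSum.lof k ℕ (HochschildHomology σ) 0
            (homologyClass (hochschildD σ) 0 z)) = ψ.map 0 z) ∧
        -- and so is `Tor`, through the canonical isomorphism
        (∀ P : ProjectiveResolution (selfBimodule k A), Nonempty (BarComparison P)) ∧
        ∃ (θ : ∀ n, HochschildHomology σ n ≃ₗ[k] TorEnv σ n)
          (G' : GerstenhaberCoalgebra k (fun n => TorEnv σ n)),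
          IsCanonicalTorIso σ θ ∧ G.IsIso G' θ := by
  obtain ⟨m, e, e', hd⟩ := hε.exists_dualBases
  obtain ⟨R, hR⟩ := exists_homologyRetract (hochschildD_hochschildD hd hσ)
  obtain ⟨θ, hθ⟩ := exists_canonicalTorIso e σ
  refine ⟨chainCooperad hd, chainComultiplication hd, ?_, fun a => ?_, augProd_chain ε,
    differential_chainCooperad hd hσ, R.gerstenhaber hd hσ,
    (isChainOp_cup hd hσ).isInducedOnHomology (hochschildD_hochschildD hd hσ) R hR,
    (isChainOp_cobracket hd hσ).isInducedOnHomology (hochschildD_hochschildD hd hσ) R hR,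
    R.gerstenhaber_counit_class hR hd hσ, nonempty_barComparison e, θ,
    (R.congr θ).gerstenhaber hd hσ, hθ, R.gerstenhaber_isIso θ hd hσ⟩
  · intro m' f f' hf n p q i a h h1 h2
    rw [chainCooperad_decomp, decompose_chain e e' h h1 h2]
    -- The cooperad is built from one chosen pair of dual bases. The formula for any other pair
    -- follows because the Casimir element is independent of the pair.
    have hsum := hd.sum_bilin hf (splitBilin k p q i h2 a)
    simp only [splitBilin_apply] at hsum
    exact hsum.symm
  · exact (augProd_chain ε 1 a).trans (by simp)
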